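/- Let $S$ be a finite-dimensional algebra over a field $k$, let $(\Lambda,\le)$ be a partially ordered set labelling a full set of simple $S$-modules $L(\lambda)$, $\lambda\in\Lambda$, and let $P(\lambda)$ and $I(\lambda)$ be the projective cover and the injective hull of $L(\lambda)$. All modules are finite-dimensional left modules. The standard module $\Delta(\lambda)$ is the largest quotient of $P(\lambda)$, and the costandard module $\nabla(\lambda)$ the largest submodule of $I(\lambda)$, all of whose composition factors are of the form $L(\mu)$ with $\mu\le\lambda$. Assume that $S$ is quasi-hereditary: for each $\lambda$, $L(\lambda)$ occurs exactly once as a composition factor of $\Delta(\lambda)$, and $P(\lambda)$ has a filtration by standard modules in which $\Delta(\lambda)$ occurs exactly once and $\Delta(\mu)$ occurs only if $\mu\ge\lambda$. For an $S$-module $X$, the $\Delta$-filtration dimension $\mathrm{wfd}(X)$ is the least $d$ for which there is an exact sequence $0\to M_d\to\cdots\to M_0\to X\to 0$ in which every $M_i$ has a filtration with sections of the form $\Delta(\mu)$; the $\nabla$-filtration dimension $\mathrm{gfd}(X)$ is the least $d$ for which there is an exact sequence $0\to X\to M_0\to\cdots\to M_d\to 0$ in which every $M_i$ has a filtration with sections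 of the form $\nabla(\mu)$ (either dimension is $\infty$ if there is no such sequence). A tilting module is a module that has both a $\Delta$-filtration and a $\nabla$-filtration. Let $T(\lambda)$ be the indecomposable tilting module in which $L(\lambda)$ occurs exactly once as a composition factor and all other composition factors $L(\mu)$ have $\mu<\lambda$. Let $T$ be a full tilting module, that is, a tilting module having every $T(\lambda)$, $\lambda\in\Lambda$, as a direct summand, and let $S'=\mathrm{End}_S(T)^{\mathrm{op}}$ be the corresponding Ringel dual. Label the simple $S'$-modules by $\Lambda$ so that $L'(\lambda)$ is the simple quotient of the $S'$-module $\mathrm{Hom}_S(T,T(\lambda))$, order the labels by the opposite of $\le$, and denote by $\Delta'(\lambda)$ and $\nabla'(\lambda)$ the resulting standard and costandard $S'$-modules, and by $\mathrm{wfd}$ and $\mathrm{gfd}$ also the filtration dimensions of $S'$-modules defined by them. Then for every $\lambda\in\Lambda$: (i) $\mathrm{wfd}(\nabla(\lambda))=\mathrm{proj.dim}(\Delta'(\lambda))$; (ii) $\mathrm{inj.dim}(\nabla(\lambda))=\mathrm{gfd}(\Delta'(\lambda))$; (iii) $\mathrm{proj.dim}(\Delta(\lambda))=\mathrm{wfd}(\nabla'(\lambda))$;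 (iv) $\mathrm{gfd}(\Delta(\lambda))=\mathrm{inj.dim}(\nabla'(\lambda))$. -/

import Mathlib

open CategoryTheory

universe u v w

namespace QuasiHereditary

noncomputable section

/-- `p : P → M` is a projective cover: `P` is projective, `p` is onto and its kernel is
superfluous. -/
def IsProjectiveCover {S : Type u} [Ring S] {P M : ModuleCat.{u} S} (p : P →ₗ[S] M) : Prop :=
  Module.Projective S P ∧ Function.Surjective p ∧
    ∀ N : Submodule S P, N ⊔ LinearMap.ker p = ⊤ → N = ⊤

/-- `i : M → I` is an injective hull: `I` is injective, `i` is one-to-one and its image is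
essential. -/
def IsInjectiveHull {S : Type u} [Ring S] {M I : ModuleCat.{u} S} (i : M →ₗ[S] I) : Prop :=
  Module.Injective S I ∧ Function.Injective i ∧
    ∀ N : Submodule S I, N ⊓ LinearMap.range i = ⊥ → N = ⊥

/-- `HasFiltration X [a₁, …, aₙ] M`: the module `M` has a finite filtration
`M = M₀ ⊇ M₁ ⊇ ⋯ ⊇ Mₙ = 0` whose sections are, from the top down, `X a₁, …, X aₙ`. -/
inductive HasFiltration {S : Type u} [Ring S] {Λ : Type w} (X : Λ → ModuleCat.{u} S) :
    List Λ → ModuleCat.{u} S → Prop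
  | nil (M : ModuleCat.{u} S) (h : Subsingleton M) : HasFiltration X [] M
  | cons (a : Λ) (l : List Λ) (N M : ModuleCat.{u} S) (i : N →ₗ[S] M) (p : M →ₗ[S] X a)
      (hi : Function.Injective i) (hip : Function.Exact i p) (hp : Function.Surjective p)
      (h : HasFiltration X l N) : HasFiltration X (a :: l) M

/-- `M` has some finite filtration with sections among the `X a`. -/
def Filtered {S : Type u} [Ring S] {Λ : Type w} (X : Λ → ModuleCat.{u} S)
    (M : ModuleCat.{u} S) : Prop :=
  ∃ l : List Λ, HasFiltration X l M

/-- `HasResolution C d X`: there is an exact sequence `0 → M_d → ⋯ → M_0 → X → 0` with all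
`M_i` in the (isomorphism-closed) class `C`; the sequence is cut into short exact sequences. -/
inductive HasResolution {S : Type u} [Ring S] (C : ModuleCat.{u} S → Prop) :
    ℕ → ModuleCat.{u} S → Prop
  | zero (X : ModuleCat.{u} S) (h : C X) : HasResolution C 0 X
  | succ (d : ℕ) (K M X : ModuleCat.{u} S) (i : K →ₗ[S] M) (p : M →ₗ[S] X)
      (hi : Function.Injective i) (hip : Function.Exact i p) (hp : Function.Surjective p)
      (hM : C M) (h : HasResolution C d K) : HasResolution C (d + 1) X

/-- `HasCoresolution C d X`: there is an exact sequence `0 → X → M_0 → ⋯ → M_d → 0` with all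
`M_i` in the (isomorphism-closed) class `C`; the sequence is cut into short exact sequences. -/
inductive HasCoresolution {S : Type u} [Ring S] (C : ModuleCat.{u} S → Prop) :
    ℕ → ModuleCat.{u} S → Prop
  | zero (X : ModuleCat.{u} S) (h : C X) : HasCoresolution C 0 X
  | succ (d : ℕ) (X M Q : ModuleCat.{u} S) (i : X →ₗ[S] M) (p : M →ₗ[S] Q)
      (hi : Function.Injective i) (hip : Function.Exact i p) (hp : Function.Surjective p)
      (hM : C M) (h : HasCoresolution C d Q) : HasCoresolution C (d + 1) X

/-- Simple `S`-modules `L a` labelled by `a : Λ`, with a projective cover `P a → L a` and an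
injective hull `L a → I a` for each label. -/
structure Labelling (S : Type u) [Ring S] (Λ : Type w) where
  /-- the simple modules -/
  L : Λ → ModuleCat.{u} S
  /-- their projective covers -/
  P : Λ → ModuleCat.{u} S
  /-- their injective hulls -/
  I : Λ → ModuleCat.{u} S
  /-- the covering maps -/
  cover (a : Λ) : P a →ₗ[S] L a
  /-- the embeddings into the hulls -/
  hull (a : Λ) : L a →ₗ[S] I a
  isSimple (a : Λ) : IsSimpleModule S (L a)
  isCover (a : Λ) : IsProjectiveCover (cover a)
  isHull (a : Λ) : IsInjectiveHull (hull a)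

namespace Labelling

variable {S : Type u} [Ring S] {Λ : Type w}

/-- The `L a` form a full set of simple modules: every simple module is isomorphic to `L a` for
exactly one label `a`. -/
def IsFull (D : Labelling S Λ) : Prop :=
  (∀ a b : Λ, Nonempty (D.L a ≃ₗ[S] D.L b) → a = b) ∧
    ∀ X : ModuleCat.{u} S, IsSimpleModule S X → ∃ a : Λ, Nonempty (X ≃ₗ[S] D.L a)

variable [PartialOrder Λ]

/-- `M` has finite length and all its composition factors are of the form `L b` with `b ≤ a`. -/
def FactorsLE (D : Labelling S Λ) (a : Λ) (M : ModuleCat.{u} S) : Prop :=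
  ∃ l : List Λ, HasFiltration D.L l M ∧ ∀ b ∈ l, b ≤ a

/-- The standard module `Δ(a)`: the largest quotient of `P a` all of whose composition factors
are of the form `L b` with `b ≤ a`. -/
def Delta (D : Labelling S Λ) (a : Λ) : ModuleCat.{u} S :=
  ModuleCat.of S
    (D.P a ⧸ sInf {N : Submodule S (D.P a) | D.FactorsLE a (ModuleCat.of S (D.P a ⧸ N))})

/-- The costandard module `∇(a)`: the largest submodule of `I a` all of whose composition factors
are of the form `L b` with `b ≤ a`. -/
def Nabla (D : Labelling S Λ) (a : Λ) : ModuleCat.{u} S :=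
  ModuleCat.of S
    (sSup {N : Submodule S (D.I a) | D.FactorsLE a (ModuleCat.of S N)} : Submodule S (D.I a))

open Classical in
/-- `S` is quasi-hereditary with respect to the full set of simple modules `L a` and the partial
order on their labels: `L a` occurs exactly once as a composition factor of `Δ(a)`, and `P a`
has a filtration by standard modules in which `Δ(a)` occurs exactly once and `Δ(b)` occurs
only if `a ≤ b`. -/
structure IsQuasiHereditary (D : Labelling S Λ) : Prop where
  full : D.IsFull
  delta (a : Λ) : ∃ l : List Λ, HasFiltration D.L l (D.Delta a) ∧ l.count a = 1
  proj (a : Λ) : ∃ l : List Λ,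
    HasFiltration D.Delta l (D.P a) ∧ l.count a = 1 ∧ ∀ b ∈ l, a ≤ b

/-- The `Δ`-filtration dimension: the least length of a resolution by modules with a
`Δ`-filtration (`⊤` if there is none). -/
def wfd (D : Labelling S Λ) (X : ModuleCat.{u} S) : ℕ∞ :=
  ⨅ (d : ℕ) (_ : HasResolution (Filtered D.Delta) d X), (d : ℕ∞)

/-- The `∇`-filtration dimension: the least length of a coresolution by modules with a
`∇`-filtration (`⊤` if there is none). -/
def gfd (D : Labelling S Λ) (X : ModuleCat.{u} S) : ℕ∞ :=
  ⨅ (d : ℕ) (_ : HasCoresolution (Filtered D.Nabla) d X), (d : ℕ∞)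

/-- A tilting module has both a `Δ`-filtration and a `∇`-filtration. -/
def IsTilting (D : Labelling S Λ) (T : ModuleCat.{u} S) : Prop :=
  Filtered D.Delta T ∧ Filtered D.Nabla T

open Classical in
/-- `U` is the indecomposable tilting module `T(a)`: `L a` occurs exactly once as a composition
factor of it, and every other composition factor `L b` has `b < a`. -/
def IsIndecomposableTilting (D : Labelling S Λ) (a : Λ) (U : ModuleCat.{u} S) : Prop :=
  D.IsTilting U ∧ Indecomposable U ∧
    ∃ l : List Λ, HasFiltration D.L l U ∧ l.count a = 1 ∧ ∀ b ∈ l, b ≠ a → b < a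

/-- `T` is a full tilting module: it is tilting and each `T(a)` is (isomorphic to) a direct
summand of it. Here `U a` is the module `T(a)`. -/
def IsFullTilting (D : Labelling S Λ) (U : Λ → ModuleCat.{u} S) (T : ModuleCat.{u} S) : Prop :=
  D.IsTilting T ∧
    ∀ a : Λ, ∃ N N' : Submodule S T, IsCompl N N' ∧ Nonempty (N ≃ₗ[S] U a)

end Labelling

/-- The opposite of the endomorphism algebra of an `S`-module `T`. -/
abbrev RingelDual {S : Type u} [Ring S] (T : ModuleCat.{u} S) : Type u :=
  (Module.End S T)ᵐᵒᵖ

/-- `Hom_S(T, M)` is a left module over `End_S(T)ᵒᵖ` by precomposition. -/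
instance homModule {S : Type u} [Ring S] (T M : ModuleCat.{u} S) :
    Module (RingelDual T) (T →ₗ[S] M) where
  smul c f := f.comp c.unop
  one_smul _ := rfl
  mul_smul _ _ _ := rfl
  smul_zero _ := LinearMap.zero_comp _
  smul_add _ _ _ := LinearMap.add_comp _ _ _
  add_smul _ _ f := LinearMap.comp_add _ _ f
  zero_smul f := LinearMap.comp_zero f

/-- `F M = Hom_S(T, M)` as an `End_S(T)ᵒᵖ`-module. -/
def F {S : Type u} [Ring S] (T M : ModuleCat.{u} S) : ModuleCat.{u} (RingelDual T) :=
  ModuleCat.of (RingelDual T) (T →ₗ[S] M)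

end

end QuasiHereditary

/-!
# Homological dimensions under Ringel duality

All eight dimensions in the theorem are controlled by the vanishing of Ext groups between standard
or costandard modules.  Over a quasi-hereditary algebra `Extⁿ(Δ(a), ∇(b)) = 0` for `n ≥ 1`
(`extZero_Delta_Nabla`), and a module is `Δ`-filtered as soon as `Ext¹` from it to all `∇(b)`
vanishes (`filtered_Delta_of_extZero`), dually for `∇`-filtered modules.  By dimension shifting,
for finitely generated `X`,

* `wfd X ≤ d` iff `Ext^{d+1}(X, ∇(b)) = 0` for all `b`, and `gfd X ≤ d` iff
  `Ext^{d+1}(Δ(b), X) = 0` for all `b` (`hasResolution_iff`, `hasCoresolution_iff`);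
* if `X` is `Δ`-filtered, then `proj.dim X ≤ d` iff `Ext^{d+1}(X, Δ(b)) = 0` for all `b`; if `X`
  is `∇`-filtered, then `inj.dim X ≤ d` iff `Ext^{d+1}(∇(b), X) = 0` for all `b`
  (`hasProjectiveDimensionLE_iff`, `hasInjectiveDimensionLE_iff`).

Every `∇`-filtered module has a cover in `add T` with `∇`-filtered kernel
(`exists_cover_of_isFullTilting`).  So `F = Hom(T, -)`, which is exact on `∇`-filtered modules and
takes `add T` to projective modules, is fully faithful on `∇`-filtered modules and preserves and
reflects the vanishing of Ext groups between them (`extZero_F_iff`).  It takes `T(a)` to the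
projective cover of `L'(a)` and `∇(a)` to `Δ'(a)` (`nonempty_Delta_equiv_F`), and with this
dictionary the Ringel dual is quasi-hereditary for the opposite order
(`isQuasiHereditary_ringelDual`).

Symmetrically, every `Δ`-filtered module has a hull in `add T`, and `G = D Hom(-, T)` is exact on
`Δ`-filtered modules, takes `add T` to injective modules, and preserves and reflects the vanishing
of Ext groups between `Δ`-filtered modules (`extZero_G_iff`).  It takes `Δ(a)` to `∇'(a)`
(`nonempty_Nabla_equiv_G`): every map `F M → G N` comes from a functional on `Hom(N, M)`
(`exists_pairing_eq`), so `Hom(Δ'(b), G Δ(a)) = 0` for `b ≠ a` and `Ext¹(Δ'(b), G Δ(a)) = 0`; hence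
`G Δ(a)` is filtered by copies of `∇'(a)`, one of which splits off, and `G Δ(a)` is indecomposable.

The first two equalities now say that `Ext^{d+1}` between costandard modules of `S` vanishes if and
only if it vanishes between the corresponding standard modules of the Ringel dual; the last two say
the same with standard and costandard modules exchanged.
-/

namespace QuasiHereditary

noncomputable section

/-! ### Short exact sequences and vanishing of Ext -/

section Ext

variable {S : Type u} [Ring S]

/-- `0 → A → B → C → 0` is exact. -/
structure IsSES {A B C : ModuleCat.{u} S} (i : A →ₗ[S] B) (p : B →ₗ[S] C) : Prop where
  inj : Function.Injective i
  exact : Function.Exact i p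
  surj : Function.Surjective p

/-- `Extⁿ(X, Y) = 0`. -/
abbrev ExtZero (n : ℕ) (X Y : ModuleCat.{u} S) : Prop :=
  Subsingleton (Abelian.Ext.{u} X Y n)

namespace IsSES

lemma of_submodule {M : ModuleCat.{u} S} (N : Submodule S M) :
    IsSES (A := ModuleCat.of S N) (B := M) (C := ModuleCat.of S (M ⧸ N)) N.subtype N.mkQ :=
  ⟨N.subtype_injective, by
    rw [LinearMap.exact_iff]; simp, N.mkQ_surjective⟩

lemma of_ker {M N : ModuleCat.{u} S} (p : M →ₗ[S] N) (hp : Function.Surjective p) :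
    IsSES (A := ModuleCat.of S (LinearMap.ker p)) (LinearMap.ker p).subtype p :=
  ⟨Submodule.subtype_injective _, by rw [LinearMap.exact_iff]; simp, hp⟩

lemma of_range {M N : ModuleCat.{u} S} (i : M →ₗ[S] N) (hi : Function.Injective i) :
    IsSES (C := ModuleCat.of S (N ⧸ LinearMap.range i)) i (LinearMap.range i).mkQ :=
  ⟨hi, by rw [LinearMap.exact_iff]; simp, Submodule.mkQ_surjective _⟩

variable {A B C : ModuleCat.{u} S} {i : A →ₗ[S] B} {p : B →ₗ[S] C} (h : IsSES i p)
include h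

lemma comp_eq_zero : p ∘ₗ i = 0 := h.exact.linearMap_comp_eq_zero

lemma apply_apply (x : A) : p (i x) = 0 := h.exact.apply_apply_eq_zero x

/-- A map that vanishes on `A` factors through `C`. -/
lemma desc {Y : ModuleCat.{u} S} (f : B →ₗ[S] Y) (hf : f ∘ₗ i = 0) :
    ∃ g : C →ₗ[S] Y, g ∘ₗ p = f := by
  have hk : LinearMap.ker p ≤ LinearMap.ker f := by
    intro x hx
    obtain ⟨y, rfl⟩ := (h.exact x).1 hx
    exact LinearMap.congr_fun hf y
  refine ⟨(LinearMap.ker p).liftQ f hk ∘ₗ (p.quotKerEquivOfSurjective h.surj).symm, ?_⟩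
  ext x
  simp only [LinearMap.comp_apply, LinearEquiv.coe_coe]
  rw [show (p.quotKerEquivOfSurjective h.surj).symm (p x) = (LinearMap.ker p).mkQ x from
    (LinearEquiv.symm_apply_eq _).2 rfl]
  simp

/-- A map that is killed by `p` factors through `A`. -/
lemma lift_of_comp_eq_zero {X : ModuleCat.{u} S} (f : X →ₗ[S] B) (hf : p ∘ₗ f = 0) :
    ∃ g : X →ₗ[S] A, i ∘ₗ g = f := by
  have hr : ∀ x, f x ∈ LinearMap.range i := fun x ↦ by
    obtain ⟨y, hy⟩ := (h.exact (f x)).1 (LinearMap.congr_fun hf x)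
    exact ⟨y, hy⟩
  refine ⟨(LinearEquiv.ofInjective i h.inj).symm ∘ₗ f.codRestrict _ hr, ?_⟩
  ext x
  have := (LinearEquiv.ofInjective i h.inj).apply_symm_apply (f.codRestrict _ hr x)
  exact congrArg Subtype.val this

/-- The short exact sequence as a short complex in the category of modules. -/
lemma shortExact : (ShortComplex.mk (ModuleCat.ofHom i) (ModuleCat.ofHom p)
    (by rw [← ModuleCat.ofHom_comp, h.comp_eq_zero]; rfl)).ShortExact :=
  ModuleCat.shortComplex_shortExact _ h.exact h.inj h.surj

lemma extZero_mid_right {n : ℕ} {X : ModuleCat.{u} S} (hA : ExtZero n X A) (hC : ExtZero n X C) :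
    ExtZero n X B := by
  refine subsingleton_of_forall_eq 0 fun x ↦ ?_
  obtain ⟨y, rfl⟩ := Abelian.Ext.covariant_sequence_exact₂ X h.shortExact x
    (hC.elim _ _)
  rw [hA.elim y 0, Abelian.Ext.zero_comp]

lemma extZero_coker {n : ℕ} {X : ModuleCat.{u} S} (hB : ExtZero n X B)
    (hA : ExtZero (n + 1) X A) : ExtZero n X C := by
  refine subsingleton_of_forall_eq 0 fun x ↦ ?_
  obtain ⟨y, rfl⟩ := Abelian.Ext.covariant_sequence_exact₃ X h.shortExact x rfl
    (hA.elim _ _)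
  rw [hB.elim y 0, Abelian.Ext.zero_comp]

lemma extZero_sub {n : ℕ} {X : ModuleCat.{u} S} (hC : ExtZero n X C)
    (hB : ExtZero (n + 1) X B) : ExtZero (n + 1) X A := by
  refine subsingleton_of_forall_eq 0 fun x ↦ ?_
  obtain ⟨y, rfl⟩ := Abelian.Ext.covariant_sequence_exact₁ X h.shortExact x
    (hB.elim _ _) rfl
  rw [hC.elim y 0, Abelian.Ext.zero_comp]

lemma extZero_mid_left {n : ℕ} {Y : ModuleCat.{u} S} (hA : ExtZero n A Y) (hC : ExtZero n C Y) :
    ExtZero n B Y := by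
  refine subsingleton_of_forall_eq 0 fun x ↦ ?_
  obtain ⟨y, rfl⟩ := Abelian.Ext.contravariant_sequence_exact₂ h.shortExact _ x
    (hA.elim _ _)
  rw [hC.elim y 0, Abelian.Ext.comp_zero]

lemma extZero_ker {n : ℕ} {Y : ModuleCat.{u} S} (hB : ExtZero n B Y)
    (hC : ExtZero (n + 1) C Y) : ExtZero n A Y := by
  refine subsingleton_of_forall_eq 0 fun x ↦ ?_
  obtain ⟨y, rfl⟩ := Abelian.Ext.contravariant_sequence_exact₁ h.shortExact _ x (add_comm 1 n)
    (hC.elim _ _)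
  rw [hB.elim y 0, Abelian.Ext.comp_zero]

lemma extZero_quot {n : ℕ} {Y : ModuleCat.{u} S} (hA : ExtZero n A Y)
    (hB : ExtZero (n + 1) B Y) : ExtZero (n + 1) C Y := by
  refine subsingleton_of_forall_eq 0 fun x ↦ ?_
  obtain ⟨y, rfl⟩ := Abelian.Ext.contravariant_sequence_exact₃ h.shortExact _ x
    (hB.elim _ _) (add_comm 1 n)
  rw [hA.elim y 0, Abelian.Ext.comp_zero]

lemma lift {X : ModuleCat.{u} S} (hX : ExtZero 1 X A) (f : X →ₗ[S] C) :
    ∃ g : X →ₗ[S] B, p ∘ₗ g = f := by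
  obtain ⟨y, hy⟩ := Abelian.Ext.covariant_sequence_exact₃ X h.shortExact
    (Abelian.Ext.mk₀ (ModuleCat.ofHom f)) (zero_add 1) (hX.elim _ _)
  obtain ⟨g, rfl⟩ := Abelian.Ext.homEquiv₀.symm.surjective y
  refine ⟨g.hom, ?_⟩
  have := Abelian.Ext.homEquiv₀.symm.injective (a₁ := g ≫ ModuleCat.ofHom p)
    (a₂ := ModuleCat.ofHom f) (by simpa using hy)
  exact congrArg ModuleCat.Hom.hom this

lemma extend {Y : ModuleCat.{u} S} (hY : ExtZero 1 C Y) (f : A →ₗ[S] Y) :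
    ∃ g : B →ₗ[S] Y, g ∘ₗ i = f := by
  obtain ⟨y, hy⟩ := Abelian.Ext.contravariant_sequence_exact₁ h.shortExact Y
    (Abelian.Ext.mk₀ (ModuleCat.ofHom f)) (add_zero 1) (hY.elim _ _)
  obtain ⟨g, rfl⟩ := Abelian.Ext.homEquiv₀.symm.surjective y
  refine ⟨g.hom, ?_⟩
  have := Abelian.Ext.homEquiv₀.symm.injective (a₁ := ModuleCat.ofHom i ≫ g)
    (a₂ := ModuleCat.ofHom f) (by simpa using hy)
  exact congrArg ModuleCat.Hom.hom this

lemma extZero_one_of_lift {X : ModuleCat.{u} S} (hB : ExtZero 1 X B)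
    (hl : ∀ f : X →ₗ[S] C, ∃ g : X →ₗ[S] B, p ∘ₗ g = f) : ExtZero 1 X A := by
  refine subsingleton_of_forall_eq 0 fun x ↦ ?_
  obtain ⟨y, rfl⟩ := Abelian.Ext.covariant_sequence_exact₁ X h.shortExact x
    (hB.elim _ _) (zero_add 1)
  obtain ⟨f, rfl⟩ := Abelian.Ext.homEquiv₀.symm.surjective y
  obtain ⟨g, hg⟩ := hl f.hom
  have : f = ModuleCat.ofHom g ≫ ModuleCat.ofHom p := ModuleCat.hom_ext hg.symm
  subst this
  have h0 := h.shortExact.comp_extClass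
  dsimp only at h0
  rw [Abelian.Ext.homEquiv₀_symm_apply, ← Abelian.Ext.mk₀_comp_mk₀,
    Abelian.Ext.comp_assoc_of_second_deg_zero, h0, Abelian.Ext.comp_zero]

lemma extZero_one_of_extend {Y : ModuleCat.{u} S} (hB : ExtZero 1 B Y)
    (hl : ∀ f : A →ₗ[S] Y, ∃ g : B →ₗ[S] Y, g ∘ₗ i = f) : ExtZero 1 C Y := by
  refine subsingleton_of_forall_eq 0 fun x ↦ ?_
  obtain ⟨y, rfl⟩ := Abelian.Ext.contravariant_sequence_exact₃ h.shortExact _ x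
    (hB.elim _ _) (add_zero 1)
  obtain ⟨f, rfl⟩ := Abelian.Ext.homEquiv₀.symm.surjective y
  obtain ⟨g, hg⟩ := hl f.hom
  have : f = ModuleCat.ofHom i ≫ ModuleCat.ofHom g := ModuleCat.hom_ext hg.symm
  subst this
  rw [Abelian.Ext.homEquiv₀_symm_apply, ← Abelian.Ext.mk₀_comp_mk₀]
  exact h.shortExact.extClass_comp_assoc _ (h := add_zero 1)

lemma exists_section (hE : ExtZero 1 C A) : ∃ s : C →ₗ[S] B, p ∘ₗ s = LinearMap.id :=
  h.lift hE _

lemma exists_retraction (hE : ExtZero 1 C A) : ∃ r : B →ₗ[S] A, r ∘ₗ i = LinearMap.id :=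
  h.extend hE _

end IsSES

lemma extZero_of_projective {P : ModuleCat.{u} S} (hP : Module.Projective S P) (n : ℕ)
    (Y : ModuleCat.{u} S) : ExtZero (n + 1) P Y := by
  have : Projective P := (IsProjective.iff_projective P).1 hP
  exact Abelian.Ext.subsingleton_of_projective _ _ _

lemma extZero_of_injective {I : ModuleCat.{u} S} (hI : Module.Injective S I) (n : ℕ)
    (X : ModuleCat.{u} S) : ExtZero (n + 1) X I := by
  have : Injective I := (Module.injective_iff_injective_object S I).1 hI
  exact Abelian.Ext.subsingleton_of_injective _ _ _

lemma extZero_retract_left {n : ℕ} {X X' Y : ModuleCat.{u} S} (s : X →ₗ[S] X') (r : X' →ₗ[S] X)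
    (h : r ∘ₗ s = LinearMap.id) (hX : ExtZero n X' Y) : ExtZero n X Y := by
  refine subsingleton_of_forall_eq 0 fun x ↦ ?_
  have : ModuleCat.ofHom s ≫ ModuleCat.ofHom r = 𝟙 X := by rw [← ModuleCat.ofHom_comp, h]; rfl
  rw [← x.mk₀_id_comp, ← this, ← Abelian.Ext.mk₀_comp_mk₀,
    Abelian.Ext.comp_assoc_of_second_deg_zero,
    hX.elim ((Abelian.Ext.mk₀ (ModuleCat.ofHom r)).comp x (zero_add n)) 0, Abelian.Ext.comp_zero]

lemma extZero_retract_right {n : ℕ} {X Y Y' : ModuleCat.{u} S} (s : Y →ₗ[S] Y') (r : Y' →ₗ[S] Y)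
    (h : r ∘ₗ s = LinearMap.id) (hX : ExtZero n X Y') : ExtZero n X Y := by
  refine subsingleton_of_forall_eq 0 fun x ↦ ?_
  have : ModuleCat.ofHom s ≫ ModuleCat.ofHom r = 𝟙 Y := by rw [← ModuleCat.ofHom_comp, h]; rfl
  rw [← x.comp_mk₀_id, ← this, ← Abelian.Ext.mk₀_comp_mk₀,
    ← Abelian.Ext.comp_assoc_of_third_deg_zero,
    hX.elim (x.comp (Abelian.Ext.mk₀ (ModuleCat.ofHom s)) (add_zero n)) 0, Abelian.Ext.zero_comp]

lemma extZero_equiv_left {n : ℕ} {X X' Y : ModuleCat.{u} S} (e : X ≃ₗ[S] X') :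
    ExtZero n X Y ↔ ExtZero n X' Y :=
  ⟨extZero_retract_left e.symm.toLinearMap e.toLinearMap (by ext; simp),
    extZero_retract_left e.toLinearMap e.symm.toLinearMap (by ext; simp)⟩

lemma extZero_equiv_right {n : ℕ} {X Y Y' : ModuleCat.{u} S} (e : Y ≃ₗ[S] Y') :
    ExtZero n X Y ↔ ExtZero n X Y' :=
  ⟨extZero_retract_right e.symm.toLinearMap e.toLinearMap (by ext; simp),
    extZero_retract_right e.toLinearMap e.symm.toLinearMap (by ext; simp)⟩

lemma extZero_of_subsingleton_left {n : ℕ} {X Y : ModuleCat.{u} S} (h : Subsingleton X) :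
    ExtZero n X Y := by
  cases n with
  | zero =>
    refine (Abelian.Ext.homEquiv₀ (X := X) (Y := Y)).subsingleton_congr.2 ⟨fun f g ↦ ?_⟩
    ext x
    rw [h.elim x 0, map_zero, map_zero]
  | succ n => exact extZero_of_projective (.of_equiv (LinearEquiv.ofSubsingleton PUnit.{u+1} X)) n Y

lemma extZero_of_subsingleton_right {n : ℕ} {X Y : ModuleCat.{u} S} (h : Subsingleton Y) :
    ExtZero n X Y := by
  refine subsingleton_of_forall_eq 0 fun x ↦ ?_
  rw [← x.comp_mk₀_id, show 𝟙 Y = 0 by ext; exact h.elim _ _, Abelian.Ext.mk₀_zero,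
    Abelian.Ext.comp_zero]

end Ext

/-! ### Filtrations -/

section Filtrations

variable {S : Type u} [Ring S] {Λ : Type w} {X : Λ → ModuleCat.{u} S}

lemma IsSES.finite {A B C : ModuleCat.{u} S} {i : A →ₗ[S] B} {p : B →ₗ[S] C} (h : IsSES i p)
    (hA : Module.Finite S A) (hC : Module.Finite S C) : Module.Finite S B :=
  Module.Finite.of_exact h.exact h.surj

lemma IsSES.finite_left [IsNoetherianRing S] {A B C : ModuleCat.{u} S} {i : A →ₗ[S] B}
    {p : B →ₗ[S] C} (h : IsSES i p) (hB : Module.Finite S B) : Module.Finite S A :=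
  Module.Finite.of_injective i h.inj

lemma IsSES.finite_right {A B C : ModuleCat.{u} S} {i : A →ₗ[S] B}
    {p : B →ₗ[S] C} (h : IsSES i p) (hB : Module.Finite S B) : Module.Finite S C :=
  Module.Finite.of_surjective p h.surj

lemma IsSES.of_equiv_mid {A B B' C : ModuleCat.{u} S} {i : A →ₗ[S] B} {p : B →ₗ[S] C}
    (h : IsSES i p) (e : B ≃ₗ[S] B') :
    IsSES (e.toLinearMap ∘ₗ i) (p ∘ₗ e.symm.toLinearMap) :=
  ⟨e.injective.comp h.inj, fun y ↦ by
    obtain ⟨x, rfl⟩ := e.surjective y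
    simpa using h.exact x, h.surj.comp e.symm.surjective⟩

lemma IsSES.of_equiv_right {A B C C' : ModuleCat.{u} S} {i : A →ₗ[S] B} {p : B →ₗ[S] C}
    (h : IsSES i p) (e : C ≃ₗ[S] C') : IsSES i (e.toLinearMap ∘ₗ p) :=
  ⟨h.inj, fun y ↦ by simpa using h.exact y, e.surjective.comp h.surj⟩

/-- The preimage of a submodule of the quotient. -/
lemma IsSES.comap {A B C : ModuleCat.{u} S} {i : A →ₗ[S] B} {p : B →ₗ[S] C} (h : IsSES i p)
    {N : ModuleCat.{u} S} (j : N →ₗ[S] C) (hj : Function.Injective j) :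
    ∃ (E : ModuleCat.{u} S) (f : A →ₗ[S] E) (g : E →ₗ[S] N) (m : E →ₗ[S] B),
      IsSES f g ∧ Function.Injective m ∧ m ∘ₗ f = i ∧ p ∘ₗ m = j ∘ₗ g ∧
        ∀ {D : ModuleCat.{u} S} (q : C →ₗ[S] D), IsSES j q → IsSES m (q ∘ₗ p) := by
  let E := (LinearMap.range j).comap p
  have hi : ∀ x, i x ∈ E := fun x ↦ by
    change p (i x) ∈ LinearMap.range j
    rw [h.apply_apply]; exact zero_mem _
  let e := LinearEquiv.ofInjective j hj
  have he : ∀ x, j (e.symm x) = x := fun x ↦ congrArg Subtype.val (e.apply_symm_apply x)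
  refine ⟨ModuleCat.of S E, i.codRestrict E hi,
    e.symm.toLinearMap ∘ₗ (p.comp E.subtype).codRestrict (LinearMap.range j) (fun x ↦ x.2),
    E.subtype, ⟨?_, ?_, ?_⟩, E.subtype_injective, ?_, ?_, ?_⟩
  · intro x y hxy
    exact h.inj (congrArg Subtype.val hxy)
  · intro x
    rw [LinearMap.comp_apply, LinearEquiv.coe_coe, LinearEquiv.map_eq_zero_iff]
    constructor
    · intro hx
      obtain ⟨y, hy⟩ := (h.exact x.1).1 (congrArg Subtype.val hx)
      exact ⟨y, Subtype.ext hy⟩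
    · rintro ⟨y, rfl⟩
      exact Subtype.ext (h.apply_apply y)
  · intro y
    obtain ⟨x, hx⟩ := h.surj (j y)
    refine ⟨⟨x, y, hx.symm⟩, hj ?_⟩
    exact (he _).trans hx
  · ext x; rfl
  · ext x
    exact (he ⟨p x.1, x.2⟩).symm
  · intro D q hq
    refine ⟨E.subtype_injective, fun x ↦ ⟨fun hx ↦ ?_, ?_⟩, hq.surj.comp h.surj⟩
    · exact ⟨⟨x, (hq.exact (p x)).1 hx⟩, rfl⟩
    · rintro ⟨⟨y, z, hz⟩, rfl⟩
      change q (p y) = 0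
      rw [← hz, hq.apply_apply]

lemma HasFiltration.of_equiv {l : List Λ} {M N : ModuleCat.{u} S} (h : HasFiltration X l M)
    (e : M ≃ₗ[S] N) : HasFiltration X l N := by
  cases h with
  | nil _ h => exact .nil _ e.symm.toEquiv.subsingleton
  | cons a l K M i p hi hip hp h =>
    have := (IsSES.mk hi hip hp).of_equiv_mid e
    exact .cons a l K N _ _ this.inj this.exact this.surj h

lemma HasFiltration.cons' {a : Λ} {l : List Λ} {N M : ModuleCat.{u} S} {i : N →ₗ[S] M}
    {p : M →ₗ[S] X a} (h : IsSES i p) (hN : HasFiltration X l N) : HasFiltration X (a :: l) M :=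
  .cons a l N M i p h.inj h.exact h.surj hN

lemma HasFiltration.single (a : Λ) : HasFiltration X [a] (X a) :=
  .cons a [] (ModuleCat.of S PUnit) _ 0 LinearMap.id (fun _ _ _ ↦ rfl)
    (fun x ↦ ⟨fun h ↦ ⟨0, h.symm⟩, by rintro ⟨y, rfl⟩; rfl⟩)
    Function.surjective_id (.nil _ inferInstance)

lemma HasFiltration.append {l l' : List Λ} {A B C : ModuleCat.{u} S} {i : A →ₗ[S] B}
    {p : B →ₗ[S] C} (h : IsSES i p) (hA : HasFiltration X l A) (hC : HasFiltration X l' C) :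
    HasFiltration X (l' ++ l) B := by
  induction hC generalizing B with
  | nil C hC =>
    refine hA.of_equiv (LinearEquiv.ofBijective i ⟨h.inj, fun x ↦ ?_⟩)
    exact (h.exact x).1 (hC.elim _ _)
  | cons a l' N C j q hj hjq hq hN ih =>
    obtain ⟨E, f, g, m, hfg, -, -, -, hm⟩ := h.comap j hj
    exact HasFiltration.cons' (hm q ⟨hj, hjq, hq⟩) (ih hfg)

/-- A property of modules that holds for zero modules and passes to extensions holds for a
filtered module if it holds for the sections. -/
lemma HasFiltration.closed {C : ModuleCat.{u} S → Prop} {l : List Λ} {M : ModuleCat.{u} S}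
    (h : HasFiltration X l M) (h0 : ∀ M : ModuleCat.{u} S, Subsingleton M → C M)
    (hext : ∀ {A B Q : ModuleCat.{u} S} (i : A →ₗ[S] B) (p : B →ₗ[S] Q), IsSES i p →
      C A → C Q → C B) (hX : ∀ a ∈ l, C (X a)) : C M := by
  induction h with
  | nil M hM => exact h0 M hM
  | cons a l N M i p hi hip hp h ih =>
    exact hext i p ⟨hi, hip, hp⟩ (ih fun b hb ↦ hX b (List.mem_cons_of_mem _ hb))
      (hX a List.mem_cons_self)

lemma HasFiltration.finite {l : List Λ} {M : ModuleCat.{u} S}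
    (h : HasFiltration X l M) (hX : ∀ a, Module.Finite S (X a)) : Module.Finite S M :=
  h.closed (C := fun M ↦ Module.Finite S M) (fun _ _ ↦ inferInstance)
    (fun _ _ h hA hQ ↦ h.finite hA hQ) (fun a _ ↦ hX a)

lemma HasFiltration.extZero_left {l : List Λ} {M Y : ModuleCat.{u} S} {n : ℕ}
    (h : HasFiltration X l M) (hX : ∀ a ∈ l, ExtZero n (X a) Y) : ExtZero n M Y :=
  h.closed (C := fun M ↦ ExtZero n M Y) (fun _ h ↦ extZero_of_subsingleton_left h)
    (fun _ _ h hA hQ ↦ h.extZero_mid_left hA hQ) hX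

lemma HasFiltration.extZero_right {l : List Λ} {M Y : ModuleCat.{u} S} {n : ℕ}
    (h : HasFiltration X l M) (hX : ∀ a ∈ l, ExtZero n Y (X a)) : ExtZero n Y M :=
  h.closed (C := fun M ↦ ExtZero n Y M) (fun _ h ↦ extZero_of_subsingleton_right h)
    (fun _ _ h hA hQ ↦ h.extZero_mid_right hA hQ) hX

/-- If `Hom(X a, Y) = 0` for all the sections, then `Hom(M, Y) = 0`. -/
lemma HasFiltration.hom_eq_zero_left {l : List Λ} {M Y : ModuleCat.{u} S}
    (h : HasFiltration X l M) (hX : ∀ a ∈ l, ∀ f : X a →ₗ[S] Y, f = 0) (f : M →ₗ[S] Y) : f = 0 := by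
  refine h.closed (C := fun M ↦ ∀ f : M →ₗ[S] Y, f = 0) ?_ ?_ hX f
  · intro M _ f
    exact Subsingleton.elim _ _
  · intro A B Q i p h hA hQ f
    obtain ⟨g, rfl⟩ := h.desc f (hA _)
    rw [hQ g, LinearMap.zero_comp]

/-- If `Hom(Y, X a) = 0` for all the sections, then `Hom(Y, M) = 0`. -/
lemma HasFiltration.hom_eq_zero_right {l : List Λ} {M Y : ModuleCat.{u} S}
    (h : HasFiltration X l M) (hX : ∀ a ∈ l, ∀ f : Y →ₗ[S] X a, f = 0) (f : Y →ₗ[S] M) : f = 0 := by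
  refine h.closed (C := fun M ↦ ∀ f : Y →ₗ[S] M, f = 0) ?_ ?_ hX f
  · intro M _ f
    exact Subsingleton.elim _ _
  · intro A B Q i p h hA hQ f
    obtain ⟨g, rfl⟩ := h.lift_of_comp_eq_zero f (hQ _)
    rw [hA g, LinearMap.comp_zero]

end Filtrations

/-! ### The functor `Hom(T, -)` on maps -/

section HomFunctor

variable {S : Type u} [Ring S]

/-- Composition with `f : M → N` as a map `Hom(T, M) → Hom(T, N)` of `End(T)ᵒᵖ`-modules. -/
def F.map (T : ModuleCat.{u} S) {M N : ModuleCat.{u} S} (f : M →ₗ[S] N) :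
    F T M →ₗ[RingelDual T] F T N where
  toFun g := (f.comp g : T →ₗ[S] N)
  map_add' _ _ := LinearMap.comp_add _ _ _
  map_smul' _ _ := rfl

lemma F.map_apply (T : ModuleCat.{u} S) {M N : ModuleCat.{u} S} (f : M →ₗ[S] N)
    (g : T →ₗ[S] M) : (F.map T f : F T M → F T N) g = f.comp g := rfl

lemma F.map_comp (T : ModuleCat.{u} S) {L M N : ModuleCat.{u} S} (f : M →ₗ[S] N)
    (g : L →ₗ[S] M) : F.map T (f ∘ₗ g) = F.map T f ∘ₗ F.map T g := rfl

lemma F.map_id (T M : ModuleCat.{u} S) :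
    F.map T (LinearMap.id : M →ₗ[S] M) = LinearMap.id := rfl

lemma F.map_zero (T M N : ModuleCat.{u} S) : F.map T (0 : M →ₗ[S] N) = 0 := by
  ext f : 1
  exact LinearMap.zero_comp _

lemma IsSES.map_F {A B C : ModuleCat.{u} S} {i : A →ₗ[S] B} {p : B →ₗ[S] C} (h : IsSES i p)
    {T : ModuleCat.{u} S} (hT : ExtZero 1 T A) : IsSES (F.map T i) (F.map T p) where
  inj f g hfg := LinearMap.ext fun x ↦ h.inj (LinearMap.congr_fun hfg x)
  exact f := by
    constructor
    · exact fun hf ↦ h.lift_of_comp_eq_zero (X := T) f hf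
    · rintro ⟨g, rfl⟩
      exact LinearMap.ext fun x ↦ h.apply_apply _
  surj f := h.lift hT f

end HomFunctor

/-! ### Composition factors -/

namespace Labelling

variable {S : Type u} [Ring S] {Λ : Type w} (D : Labelling S Λ)

/-- `L a` is a composition factor of `M`, expressed as `Hom(P a, M) ≠ 0`. -/
def Occurs (a : Λ) (M : ModuleCat.{u} S) : Prop := ∃ f : D.P a →ₗ[S] M, f ≠ 0

variable {D}

lemma P_projective (a : Λ) : Module.Projective S (D.P a) := (D.isCover a).1

lemma cover_surjective (a : Λ) : Function.Surjective (D.cover a) := (D.isCover a).2.1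

lemma cover_ne_zero (a : Λ) : D.cover a ≠ 0 := by
  intro h
  have := (D.isSimple a).nontrivial
  obtain ⟨x, hx⟩ := exists_ne (0 : D.L a)
  obtain ⟨y, rfl⟩ := D.cover_surjective a x
  exact hx (by rw [h]; rfl)

lemma P_lift (a : Λ) {M N : ModuleCat.{u} S} (p : M →ₗ[S] N) (hp : Function.Surjective p)
    (f : D.P a →ₗ[S] N) : ∃ g : D.P a →ₗ[S] M, p ∘ₗ g = f :=
  have := D.P_projective a
  Module.projective_lifting_property p f hp

lemma isCoatom_ker_cover (a : Λ) : IsCoatom (LinearMap.ker (D.cover a)) := by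
  have := D.isSimple a
  exact LinearMap.isCoatom_ker_of_surjective (D.cover_surjective a)

lemma le_ker_cover {a : Λ} {N : Submodule S (D.P a)} (hN : N ≠ ⊤) :
    N ≤ LinearMap.ker (D.cover a) := by
  by_contra h
  refine hN ((D.isCover a).2.2 N ?_)
  rw [sup_comm]
  exact (D.isCoatom_ker_cover a).2 _ (lt_of_le_of_ne le_sup_left fun h' ↦ h (by
    rw [h']; exact le_sup_right))

/-- A map to `P a` that is nonzero on the top is onto. -/
lemma surjective_of_cover_comp {a : Λ} {X : ModuleCat.{u} S} (f : X →ₗ[S] D.P a)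
    (hf : D.cover a ∘ₗ f ≠ 0) : Function.Surjective f := by
  rw [← LinearMap.range_eq_top]
  by_contra h
  refine hf (LinearMap.ext fun x ↦ ?_)
  exact D.le_ker_cover h (LinearMap.mem_range_self f x)

lemma P_finite (a : Λ) : Module.Finite S (D.P a) := by
  have := (D.isSimple a).nontrivial
  obtain ⟨x, hx⟩ := exists_ne (0 : D.L a)
  obtain ⟨y, rfl⟩ := D.cover_surjective a x
  refine Module.Finite.of_surjective (LinearMap.toSpanSingleton S (D.P a) y)
    (D.surjective_of_cover_comp (X := ModuleCat.of S S) _ fun h ↦ hx ?_)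
  simpa using LinearMap.congr_fun h (1 : S)

lemma L_finite (a : Λ) : Module.Finite S (D.L a) :=
  have := D.P_finite a
  Module.Finite.of_surjective _ (D.cover_surjective a)

lemma nonempty_equiv_of_hom_P {a : Λ} {X : ModuleCat.{u} S} (hX : IsSimpleModule S X)
    (f : D.P a →ₗ[S] X) (hf : f ≠ 0) : Nonempty (D.L a ≃ₗ[S] X) := by
  have hs := LinearMap.surjective_of_ne_zero hf
  have hc : IsCoatom (LinearMap.ker f) := LinearMap.isCoatom_ker_of_surjective hs
  have hk : LinearMap.ker f = LinearMap.ker (D.cover a) :=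
    ((hc.le_iff_eq (D.isCoatom_ker_cover a).1).1 (D.le_ker_cover hc.1)).symm
  exact ⟨(LinearMap.quotKerEquivOfSurjective _ (D.cover_surjective a)).symm ≪≫ₗ
    Submodule.quotEquivOfEq _ _ hk.symm ≪≫ₗ LinearMap.quotKerEquivOfSurjective f hs⟩

lemma eq_of_hom_P_L (h : D.IsFull) {a b : Λ} (f : D.P a →ₗ[S] D.L b) (hf : f ≠ 0) : a = b :=
  h.1 a b (D.nonempty_equiv_of_hom_P (D.isSimple b) f hf)

lemma occurs_L (a : Λ) : D.Occurs a (D.L a) := ⟨D.cover a, D.cover_ne_zero a⟩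

lemma occurs_L_iff (h : D.IsFull) {a b : Λ} : D.Occurs a (D.L b) ↔ a = b :=
  ⟨fun ⟨f, hf⟩ ↦ D.eq_of_hom_P_L h f hf, by rintro rfl; exact D.occurs_L a⟩

lemma Occurs.of_injective {a : Λ} {M N : ModuleCat.{u} S} (h : D.Occurs a M) (i : M →ₗ[S] N)
    (hi : Function.Injective i) : D.Occurs a N := by
  obtain ⟨f, hf⟩ := h
  refine ⟨i ∘ₗ f, fun h0 ↦ hf (LinearMap.ext fun x ↦ hi ?_)⟩
  rw [LinearMap.zero_apply, map_zero]
  exact LinearMap.congr_fun h0 x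

lemma Occurs.of_surjective {a : Λ} {M N : ModuleCat.{u} S} (h : D.Occurs a N) (p : M →ₗ[S] N)
    (hp : Function.Surjective p) : D.Occurs a M := by
  obtain ⟨f, hf⟩ := h
  obtain ⟨g, rfl⟩ := D.P_lift a p hp f
  exact ⟨g, fun h0 ↦ hf (by rw [h0, LinearMap.comp_zero])⟩

lemma Occurs.exists_of_hasFiltration {a : Λ} {X : Λ → ModuleCat.{u} S} {l : List Λ}
    {M : ModuleCat.{u} S} (hM : D.Occurs a M) (h : HasFiltration X l M) :
    ∃ b ∈ l, D.Occurs a (X b) := by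
  by_contra! hl
  obtain ⟨f, hf⟩ := hM
  refine hf (h.hom_eq_zero_right (fun b hb g ↦ ?_) f)
  by_contra hg
  exact hl b hb ⟨g, hg⟩

lemma not_occurs_of_subsingleton {a : Λ} {M : ModuleCat.{u} S} (h : Subsingleton M) :
    ¬ D.Occurs a M := fun ⟨_, hf⟩ ↦ hf (Subsingleton.elim _ _)

lemma not_occurs_iff {a : Λ} {M : ModuleCat.{u} S} :
    ¬ D.Occurs a M ↔ Subsingleton (F (D.P a) M) := by
  simp only [Occurs, not_exists, not_not]
  exact ⟨fun h ↦ subsingleton_of_forall_eq 0 h, fun h f ↦ h.elim _ _⟩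

lemma Occurs.of_mem {a : Λ} {X : Λ → ModuleCat.{u} S} {l : List Λ}
    {M : ModuleCat.{u} S} (h : HasFiltration X l M) {b : Λ} (hb : b ∈ l)
    (ha : D.Occurs a (X b)) : D.Occurs a M := by
  induction h with
  | nil M hM => simp at hb
  | cons c l N M i p hi hip hp h ih =>
    rcases List.mem_cons.1 hb with rfl | hb
    · exact ha.of_surjective p hp
    · exact (ih hb).of_injective i hi

/-- The multiplicity of `L a` as a composition factor: the length of `Hom(P a, M)` over
`End(P a)ᵒᵖ`. -/
def mult (D : Labelling S Λ) (a : Λ) (M : ModuleCat.{u} S) : ℕ∞ :=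
  Module.length (RingelDual (D.P a)) (F (D.P a) M)

lemma mult_ses (a : Λ) {A B C : ModuleCat.{u} S} {i : A →ₗ[S] B} {p : B →ₗ[S] C}
    (h : IsSES i p) : D.mult a B = D.mult a A + D.mult a C := by
  have := h.map_F (extZero_of_projective (D.P_projective a) 0 A)
  exact Module.length_eq_add_of_exact _ _ this.inj this.surj this.exact

lemma mult_eq_zero_iff {a : Λ} {M : ModuleCat.{u} S} : D.mult a M = 0 ↔ ¬ D.Occurs a M := by
  rw [not_occurs_iff]
  exact Module.length_eq_zero_iff

lemma mult_L_self (a : Λ) : D.mult a (D.L a) = 1 := by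
  have := D.isSimple a
  refine Module.length_eq_one_iff.2 (isSimpleModule_iff_toSpanSingleton_surjective.2 ⟨?_, ?_⟩)
  · exact ⟨⟨D.cover a, 0, D.cover_ne_zero a⟩⟩
  · intro f hf g
    have hs : Function.Surjective (show D.P a →ₗ[S] D.L a from f) :=
      LinearMap.surjective_of_ne_zero hf
    obtain ⟨e, he⟩ := D.P_lift a _ hs g
    exact ⟨MulOpposite.op e, he⟩

open Classical in
lemma mult_eq_count (h : D.IsFull) (a : Λ) {l : List Λ} {M : ModuleCat.{u} S}
    (hl : HasFiltration D.L l M) : D.mult a M = l.count a := by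
  induction hl with
  | nil M hM => simpa using mult_eq_zero_iff.2 (not_occurs_of_subsingleton hM)
  | cons b l N M i p hi hip hp _ ih =>
    rw [mult_ses a ⟨hi, hip, hp⟩, ih, List.count_cons, Nat.cast_add]
    congr 1
    split_ifs with hb
    · rw [beq_iff_eq] at hb
      rw [hb, mult_L_self, Nat.cast_one]
    · rw [mult_eq_zero_iff.2 fun ho ↦ hb (by simpa using ((occurs_L_iff h).1 ho).symm),
        Nat.cast_zero]

lemma FactorsLE.finite [PartialOrder Λ] {a : Λ} {M : ModuleCat.{u} S} (hM : D.FactorsLE a M) :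
    Module.Finite S M := by
  obtain ⟨l, hl, -⟩ := hM
  exact hl.finite D.L_finite

lemma exists_top (h : D.IsFull) {M : ModuleCat.{u} S} (hM : Module.Finite S M)
    (hn : Nontrivial M) : ∃ (c : Λ) (f : M →ₗ[S] D.L c), Function.Surjective f := by
  obtain ⟨N, hN⟩ := IsCoatomic.exists_coatom (Submodule S M)
  have : IsSimpleModule S (M ⧸ N) := isSimpleModule_iff_isCoatom.2 hN
  obtain ⟨c, ⟨e⟩⟩ := h.2 (ModuleCat.of S (M ⧸ N)) this
  exact ⟨c, e.toLinearMap ∘ₗ N.mkQ, e.surjective.comp N.mkQ_surjective⟩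

section Finite

variable [IsArtinianRing S]

lemma exists_socle (h : D.IsFull) {M : ModuleCat.{u} S} (hM : Module.Finite S M)
    (hn : Nontrivial M) : ∃ (c : Λ) (f : D.L c →ₗ[S] M), Function.Injective f := by
  have : IsAtomic (Submodule S M) := isAtomic_of_orderBot_wellFounded_lt wellFounded_lt
  obtain ⟨N, hN⟩ := IsAtomic.exists_atom (Submodule S M)
  have : IsSimpleModule S N := isSimpleModule_iff_isAtom.2 hN
  obtain ⟨c, ⟨e⟩⟩ := h.2 (ModuleCat.of S N) this
  exact ⟨c, N.subtype ∘ₗ e.symm.toLinearMap, N.subtype_injective.comp e.symm.injective⟩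

lemma exists_hasFiltration_L (h : D.IsFull) {M : ModuleCat.{u} S} (hM : Module.Finite S M) :
    ∃ l, HasFiltration D.L l M := by
  have hfl : IsFiniteLength S M := isFiniteLength_iff_isNoetherian_isArtinian.2
    ⟨inferInstance, inferInstance⟩
  suffices ∀ (M : Type u) [AddCommGroup M] [Module S M], IsFiniteLength S M →
      ∃ l, HasFiltration D.L l (ModuleCat.of S M) from this M hfl
  intro M _ _ hfl
  induction hfl with
  | of_subsingleton => exact ⟨[], .nil _ ‹_›⟩
  | @of_simple_quotient M _ _ N hN _ ih =>
    obtain ⟨l, hl⟩ := ih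
    obtain ⟨c, ⟨e⟩⟩ := h.2 (ModuleCat.of S (M ⧸ N)) hN
    exact ⟨c :: l, hl.cons' ((IsSES.of_submodule (M := ModuleCat.of S M) N).of_equiv_right e)⟩

lemma finite_occurs (h : D.IsFull) {M : ModuleCat.{u} S} (hM : Module.Finite S M) :
    {a | D.Occurs a M}.Finite := by
  obtain ⟨l, hl⟩ := exists_hasFiltration_L h hM
  refine (List.finite_toSet l).subset fun a ha ↦ ?_
  obtain ⟨b, hb, hab⟩ := ha.exists_of_hasFiltration hl
  rw [occurs_L_iff h] at hab
  exact hab ▸ hb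

variable [PartialOrder Λ]

lemma factorsLE_iff (h : D.IsFull) {a : Λ} {M : ModuleCat.{u} S} :
    D.FactorsLE a M ↔ Module.Finite S M ∧ ∀ b, D.Occurs b M → b ≤ a := by
  constructor
  · intro hM
    refine ⟨hM.finite, fun b hb ↦ ?_⟩
    obtain ⟨l, hl, hla⟩ := hM
    obtain ⟨c, hc, hbc⟩ := hb.exists_of_hasFiltration hl
    rw [occurs_L_iff h] at hbc
    exact hbc ▸ hla c hc
  · rintro ⟨hM, hM'⟩
    obtain ⟨l, hl⟩ := exists_hasFiltration_L h hM
    exact ⟨l, hl, fun b hb ↦ hM' b (Occurs.of_mem hl hb (D.occurs_L b))⟩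

end Finite

end Labelling

/-! ### Standard and costandard modules -/

/-- Every finitely generated module embeds in a finitely generated injective module. -/
class EnoughFiniteInjectives (S : Type u) [Ring S] : Prop where
  exists_embedding (M : ModuleCat.{u} S) (hM : Module.Finite S M) :
    ∃ (J : ModuleCat.{u} S) (i : M →ₗ[S] J), Module.Finite S J ∧ Module.Injective S J ∧
      Function.Injective i

namespace Labelling

variable {S : Type u} [Ring S] {Λ : Type w} {D : Labelling S Λ}

lemma I_injective (a : Λ) : Module.Injective S (D.I a) := (D.isHull a).1

lemma hull_injective (a : Λ) : Function.Injective (D.hull a) := (D.isHull a).2.1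

lemma I_extend (a : Λ) {M N : ModuleCat.{u} S} (i : M →ₗ[S] N) (hi : Function.Injective i)
    (f : M →ₗ[S] D.I a) : ∃ g : N →ₗ[S] D.I a, g ∘ₗ i = f := by
  obtain ⟨g, hg⟩ := (D.I_injective a).out i hi f
  exact ⟨g, LinearMap.ext hg⟩

lemma range_hull_le {a : Λ} {N : Submodule S (D.I a)} (hN : N ≠ ⊥) :
    LinearMap.range (D.hull a) ≤ N := by
  have := D.isSimple a
  rintro _ ⟨x, rfl⟩
  by_contra hx
  refine hN ((D.isHull a).2.2 N (eq_bot_iff.2 ?_))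
  rintro _ ⟨hy, y, rfl⟩
  have hlt : N.comap (D.hull a) ≠ ⊤ := fun h ↦ hx (by
    change x ∈ N.comap (D.hull a)
    rw [h]; trivial)
  have h0 := (eq_bot_or_eq_top (N.comap (D.hull a))).resolve_right hlt
  have : y ∈ N.comap (D.hull a) := hy
  rw [h0, Submodule.mem_bot] at this
  rw [this, map_zero]; exact zero_mem _

lemma I_finite [IsArtinianRing S] [EnoughFiniteInjectives S] (a : Λ) :
    Module.Finite S (D.I a) := by
  obtain ⟨J, i, hJ, hJi, hi⟩ := EnoughFiniteInjectives.exists_embedding (D.L a) (D.L_finite a)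
  obtain ⟨g, hg⟩ := hJi.out (D.hull a) (D.hull_injective a) i
  refine Module.Finite.of_injective g (LinearMap.ker_eq_bot.1 ?_)
  by_contra h0
  have := D.isSimple a
  have := (D.isSimple a).nontrivial
  obtain ⟨x, hx⟩ := exists_ne (0 : D.L a)
  have hk : g (D.hull a x) = 0 := D.range_hull_le h0 ⟨x, rfl⟩
  rw [hg] at hk
  exact hx (hi (by rw [hk, map_zero]))

variable [PartialOrder Λ]

variable (D) in
/-- The projection `P a → Δ(a)`. -/
def toDelta (a : Λ) : D.P a →ₗ[S] D.Delta a :=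
  (sInf {N : Submodule S (D.P a) | D.FactorsLE a (ModuleCat.of S (D.P a ⧸ N))}).mkQ

lemma toDelta_surjective (a : Λ) : Function.Surjective (D.toDelta a) := Submodule.mkQ_surjective _

lemma ker_toDelta (a : Λ) : LinearMap.ker (D.toDelta a) =
    sInf {N : Submodule S (D.P a) | D.FactorsLE a (ModuleCat.of S (D.P a ⧸ N))} :=
  Submodule.ker_mkQ _

lemma Delta_finite (a : Λ) : Module.Finite S (D.Delta a) :=
  have := D.P_finite a
  Module.Finite.of_surjective _ (D.toDelta_surjective a)

variable (D) in
/-- The inclusion `∇(a) → I a`. -/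
def ofNabla (a : Λ) : D.Nabla a →ₗ[S] D.I a :=
  (sSup {N : Submodule S (D.I a) | D.FactorsLE a (ModuleCat.of S N)}).subtype

lemma ofNabla_injective (a : Λ) : Function.Injective (D.ofNabla a) :=
  Submodule.subtype_injective _

lemma range_ofNabla (a : Λ) : LinearMap.range (D.ofNabla a) =
    sSup {N : Submodule S (D.I a) | D.FactorsLE a (ModuleCat.of S N)} :=
  Submodule.range_subtype _

lemma FactorsLE.of_ses {a : Λ} {A B C : ModuleCat.{u} S} {i : A →ₗ[S] B}
    {p : B →ₗ[S] C} (hs : IsSES i p) (hA : D.FactorsLE a A) (hC : D.FactorsLE a C) :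
    D.FactorsLE a B := by
  obtain ⟨l, hl, hl'⟩ := hA
  obtain ⟨m, hm, hm'⟩ := hC
  refine ⟨m ++ l, hl.append hs hm, fun b hb ↦ ?_⟩
  rcases List.mem_append.1 hb with hb | hb
  exacts [hm' b hb, hl' b hb]

lemma factorsLE_L (a : Λ) : D.FactorsLE a (D.L a) := ⟨[a], .single a, by simp⟩

lemma occurs_of_hom_Delta {a : Λ} {X : ModuleCat.{u} S} {f : D.Delta a →ₗ[S] X} (hf : f ≠ 0) :
    D.Occurs a X := by
  refine ⟨f ∘ₗ D.toDelta a, fun h0 ↦ hf ?_⟩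
  rwa [← LinearMap.zero_comp (D.toDelta a), LinearMap.cancel_right (D.toDelta_surjective a)] at h0

/-- A submodule of `I a` with composition factors `≤ a` lies in `∇(a)`. -/
lemma le_range_ofNabla {a : Λ} {N : Submodule S (D.I a)}
    (hN : D.FactorsLE a (ModuleCat.of S N)) : N ≤ LinearMap.range (D.ofNabla a) := by
  rw [range_ofNabla]
  exact le_sSup hN

variable [IsArtinianRing S]

section Delta

lemma FactorsLE.of_surjective (h : D.IsFull) {a : Λ} {M N : ModuleCat.{u} S}
    (hM : D.FactorsLE a M) (p : M →ₗ[S] N) (hp : Function.Surjective p) : D.FactorsLE a N := by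
  rw [factorsLE_iff h] at hM ⊢
  have := hM.1
  exact ⟨Module.Finite.of_surjective p hp, fun b hb ↦ hM.2 b (hb.of_surjective p hp)⟩

lemma FactorsLE.of_injective (h : D.IsFull) {a : Λ} {M N : ModuleCat.{u} S}
    (hM : D.FactorsLE a M) (i : N →ₗ[S] M) (hi : Function.Injective i) : D.FactorsLE a N := by
  rw [factorsLE_iff h] at hM ⊢
  have := hM.1
  exact ⟨Module.Finite.of_injective i hi, fun b hb ↦ hM.2 b (hb.of_injective i hi)⟩

lemma factorsLE_Delta (h : D.IsFull) (a : Λ) : D.FactorsLE a (D.Delta a) := by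
  rw [factorsLE_iff h]
  refine ⟨D.Delta_finite a, fun b ⟨f, hf⟩ ↦ ?_⟩
  obtain ⟨g, rfl⟩ := D.P_lift b _ (D.toDelta_surjective a) f
  have : ∃ x, g x ∉ LinearMap.ker (D.toDelta a) := by
    by_contra! hx
    exact hf (LinearMap.ext hx)
  obtain ⟨x, hx⟩ := this
  rw [ker_toDelta, Submodule.mem_sInf] at hx
  push Not at hx
  obtain ⟨N, hN, hxN⟩ := hx
  refine ((factorsLE_iff h).1 hN).2 b ⟨N.mkQ ∘ₗ g, fun h0 ↦ hxN ?_⟩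
  have := LinearMap.congr_fun h0 x
  simpa using this

/-- Maps from `P a` to a module with composition factors `≤ a` factor through `Δ(a)`. -/
lemma Delta_desc (h : D.IsFull) {a : Λ} {M : ModuleCat.{u} S} (hM : D.FactorsLE a M)
    (f : D.P a →ₗ[S] M) : ∃ g : D.Delta a →ₗ[S] M, g ∘ₗ D.toDelta a = f := by
  refine (IsSES.of_ker (D.toDelta a) (D.toDelta_surjective a)).desc f ?_
  have hk : LinearMap.ker (D.toDelta a) ≤ LinearMap.ker f := by
    rw [ker_toDelta]
    refine sInf_le ?_
    exact (hM.of_injective (N := ModuleCat.of S (LinearMap.range f)) h _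
      (Submodule.subtype_injective _)).of_injective h
      f.quotKerEquivRange.toLinearMap f.quotKerEquivRange.injective
  ext x
  exact hk x.2

/-- `Δ(a)` is projective relative to modules with composition factors `≤ a`. -/
lemma Delta_lift (h : D.IsFull) {a : Λ} {M N : ModuleCat.{u} S} (hM : D.FactorsLE a M)
    (p : M →ₗ[S] N) (hp : Function.Surjective p) (f : D.Delta a →ₗ[S] N) :
    ∃ g : D.Delta a →ₗ[S] M, p ∘ₗ g = f := by
  obtain ⟨g, hg⟩ := D.P_lift a p hp (f ∘ₗ D.toDelta a)
  obtain ⟨g, rfl⟩ := D.Delta_desc h hM g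
  refine ⟨g, ?_⟩
  rwa [← LinearMap.comp_assoc, LinearMap.cancel_right (D.toDelta_surjective a)] at hg

lemma exists_deltaTop (h : D.IsFull) (a : Λ) :
    ∃ g : D.Delta a →ₗ[S] D.L a, g ∘ₗ D.toDelta a = D.cover a :=
  D.Delta_desc h (D.factorsLE_L a) _

/-- The projection `Δ(a) → L a`. -/
def deltaTop (h : D.IsFull) (a : Λ) : D.Delta a →ₗ[S] D.L a := (D.exists_deltaTop h a).choose

lemma deltaTop_comp (h : D.IsFull) (a : Λ) : D.deltaTop h a ∘ₗ D.toDelta a = D.cover a :=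
  (D.exists_deltaTop h a).choose_spec

lemma deltaTop_surjective (h : D.IsFull) (a : Λ) : Function.Surjective (D.deltaTop h a) := by
  have := D.cover_surjective a
  rw [← D.deltaTop_comp h a] at this
  exact Function.Surjective.of_comp this

/-- A map to `Δ(a)` that is nonzero on the top is onto. -/
lemma surjective_of_deltaTop_comp (h : D.IsFull) {a : Λ} {X : ModuleCat.{u} S}
    (f : X →ₗ[S] D.Delta a) (hf : D.deltaTop h a ∘ₗ f ≠ 0) : Function.Surjective f := by
  have hc : (LinearMap.range f).comap (D.toDelta a) = ⊤ := by
    by_contra hc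
    refine hf (LinearMap.ext fun x ↦ ?_)
    obtain ⟨y, hy⟩ := D.toDelta_surjective a (f x)
    have hy' : y ∈ LinearMap.ker (D.cover a) := D.le_ker_cover hc (by
      change D.toDelta a y ∈ LinearMap.range f
      rw [hy]; exact ⟨x, rfl⟩)
    rw [← D.deltaTop_comp h a] at hy'
    rw [LinearMap.comp_apply, ← hy]
    exact hy'
  intro y
  obtain ⟨x, rfl⟩ := D.toDelta_surjective a y
  have : x ∈ (LinearMap.range f).comap (D.toDelta a) := by rw [hc]; trivial
  exact this

lemma occurs_Delta (h : D.IsFull) (a : Λ) : D.Occurs a (D.Delta a) :=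
  (D.occurs_L a).of_surjective _ (D.deltaTop_surjective h a)

lemma eq_of_surjective_P_Delta (h : D.IsFull) {a b : Λ} (f : D.P a →ₗ[S] D.Delta b)
    (hf : Function.Surjective f) : a = b := by
  refine D.eq_of_hom_P_L h (D.deltaTop h b ∘ₗ f) fun h0 ↦ ?_
  have := (D.isSimple b).nontrivial
  obtain ⟨x, hx⟩ := exists_ne (0 : D.L b)
  obtain ⟨y, rfl⟩ := ((D.deltaTop_surjective h b).comp hf) x
  exact hx (LinearMap.congr_fun h0 y)

end Delta

section Nabla

/-- `∇(a)` itself has composition factors `≤ a`: the set of submodules defining it is closed under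
sums and `I a` is Noetherian, so the supremum is attained. -/
lemma factorsLE_Nabla [EnoughFiniteInjectives S] (h : D.IsFull) (a : Λ) :
    D.FactorsLE a (D.Nabla a) := by
  have := D.I_finite a
  set 𝒩 := {N : Submodule S (D.I a) | D.FactorsLE a (ModuleCat.of S N)} with h𝒩
  have hsup : ∀ N ∈ 𝒩, ∀ N' ∈ 𝒩, N ⊔ N' ∈ 𝒩 := by
    intro N hN N' hN'
    have hp : D.FactorsLE a (ModuleCat.of S (N × N')) := FactorsLE.of_ses
      (A := ModuleCat.of S N) (C := ModuleCat.of S N') (i := LinearMap.inl S N N')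
      (p := LinearMap.snd S N N')
      ⟨LinearMap.inl_injective, .inl_snd, LinearMap.snd_surjective⟩ hN hN'
    refine hp.of_surjective (N := ModuleCat.of S ↥(N ⊔ N')) h
      ((N.subtype.coprod N'.subtype).codRestrict _ fun x ↦
        Submodule.add_mem_sup x.1.2 x.2.2) ?_
    rintro ⟨x, hx⟩
    obtain ⟨y, hy, z, hz, rfl⟩ := Submodule.mem_sup.1 hx
    exact ⟨(⟨y, hy⟩, ⟨z, hz⟩), rfl⟩
  have hne : 𝒩.Nonempty := ⟨⊥, [], .nil _ inferInstance, by simp⟩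
  obtain ⟨N, hN, hmax⟩ := WellFounded.has_min (wellFounded_gt (α := Submodule S (D.I a))) 𝒩 hne
  have hs : sSup 𝒩 = N := by
    refine le_antisymm (sSup_le fun N' hN' ↦ ?_) (le_sSup hN)
    by_contra hle
    exact hmax _ (hsup N hN N' hN') (left_lt_sup.2 hle)
  change D.FactorsLE a (ModuleCat.of S ↥(sSup 𝒩))
  rw [hs]
  exact hN

lemma Nabla_finite [EnoughFiniteInjectives S] (h : D.IsFull) (a : Λ) :
    Module.Finite S (D.Nabla a) :=
  (D.factorsLE_Nabla h a).finite

/-- Maps from a module with composition factors `≤ a` to `I a` have image in `∇(a)`. -/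
lemma Nabla_lift (h : D.IsFull) {a : Λ} {M : ModuleCat.{u} S} (hM : D.FactorsLE a M)
    (f : M →ₗ[S] D.I a) : ∃ g : M →ₗ[S] D.Nabla a, D.ofNabla a ∘ₗ g = f := by
  refine (IsSES.of_range (D.ofNabla a) (D.ofNabla_injective a)).lift_of_comp_eq_zero f ?_
  ext x
  refine (Submodule.Quotient.mk_eq_zero _).2 (le_range_ofNabla ?_ (LinearMap.mem_range_self f x))
  exact hM.of_surjective h f.rangeRestrict f.surjective_rangeRestrict

/-- `∇(a)` is injective relative to modules with composition factors `≤ a`. -/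
lemma Nabla_extend (h : D.IsFull) {a : Λ} {M N : ModuleCat.{u} S} (hN : D.FactorsLE a N)
    (i : M →ₗ[S] N) (hi : Function.Injective i) (f : M →ₗ[S] D.Nabla a) :
    ∃ g : N →ₗ[S] D.Nabla a, g ∘ₗ i = f := by
  obtain ⟨g, hg⟩ := D.I_extend a i hi (D.ofNabla a ∘ₗ f)
  obtain ⟨g, rfl⟩ := D.Nabla_lift h hN g
  refine ⟨g, ?_⟩
  rwa [LinearMap.comp_assoc, LinearMap.cancel_left (D.ofNabla_injective a)] at hg

lemma exists_nablaSocle (h : D.IsFull) (a : Λ) :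
    ∃ g : D.L a →ₗ[S] D.Nabla a, D.ofNabla a ∘ₗ g = D.hull a :=
  D.Nabla_lift h (D.factorsLE_L a) _

/-- The embedding `L a → ∇(a)`. -/
def nablaSocle (h : D.IsFull) (a : Λ) : D.L a →ₗ[S] D.Nabla a := (D.exists_nablaSocle h a).choose

lemma nablaSocle_comp (h : D.IsFull) (a : Λ) : D.ofNabla a ∘ₗ D.nablaSocle h a = D.hull a :=
  (D.exists_nablaSocle h a).choose_spec

lemma nablaSocle_injective (h : D.IsFull) (a : Λ) : Function.Injective (D.nablaSocle h a) := by
  have := D.hull_injective a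
  rw [← D.nablaSocle_comp h a, LinearMap.coe_comp] at this
  exact this.of_comp

lemma range_nablaSocle_le (h : D.IsFull) {a : Λ} {N : Submodule S (D.Nabla a)} (hN : N ≠ ⊥) :
    LinearMap.range (D.nablaSocle h a) ≤ N := by
  rintro _ ⟨x, rfl⟩
  have h1 := D.range_hull_le (N := N.map (D.ofNabla a)) (fun h0 ↦ hN
    (Submodule.map_injective_of_injective (D.ofNabla_injective a)
      (h0.trans (Submodule.map_bot _).symm)))
    ⟨x, rfl⟩
  obtain ⟨y, hy, hxy⟩ := h1
  rw [← D.nablaSocle_comp h a] at hxy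
  exact D.ofNabla_injective a hxy ▸ hy

/-- A map from `∇(a)` that is nonzero on the socle is injective. -/
lemma injective_of_comp_nablaSocle (h : D.IsFull) {a : Λ} {X : ModuleCat.{u} S}
    (f : D.Nabla a →ₗ[S] X) (hf : f ∘ₗ D.nablaSocle h a ≠ 0) : Function.Injective f := by
  rw [← LinearMap.ker_eq_bot]
  by_contra h0
  exact hf (LinearMap.ext fun x ↦ D.range_nablaSocle_le h h0 ⟨x, rfl⟩)

lemma occurs_of_hom_Nabla (h : D.IsFull) {a : Λ} {X : ModuleCat.{u} S} {f : X →ₗ[S] D.Nabla a}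
    (hf : f ≠ 0) : D.Occurs a X := by
  have hr : LinearMap.range f ≠ ⊥ := fun h0 ↦ hf (LinearMap.range_eq_bot.1 h0)
  have h1 := D.range_nablaSocle_le h hr
  refine Occurs.of_surjective (N := ModuleCat.of S (LinearMap.range f)) ?_ f.rangeRestrict
    f.surjective_rangeRestrict
  refine (D.occurs_L a).of_injective
    ((D.nablaSocle h a).codRestrict (LinearMap.range f) fun x ↦ h1 ⟨x, rfl⟩) ?_
  intro x y hxy
  exact D.nablaSocle_injective h a (congrArg Subtype.val hxy)

lemma occurs_Nabla (h : D.IsFull) (a : Λ) : D.Occurs a (D.Nabla a) :=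
  (D.occurs_L a).of_injective _ (D.nablaSocle_injective h a)

/-- A module with composition factors `≤ a` has no nonzero map to `I a / ∇(a)`. -/
lemma hom_quotient_Nabla_eq_zero [EnoughFiniteInjectives S] (h : D.IsFull) {a : Λ}
    {X : ModuleCat.{u} S} (hX : D.FactorsLE a X)
    (f : X →ₗ[S] D.I a ⧸ LinearMap.range (D.ofNabla a)) : f = 0 := by
  have hs := IsSES.of_range (D.ofNabla a) (D.ofNabla_injective a)
  have hr : D.FactorsLE a (ModuleCat.of S (LinearMap.range f)) :=
    hX.of_surjective h f.rangeRestrict f.surjective_rangeRestrict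
  obtain ⟨E, i, g, m, hig, hm, hmi, hmg, -⟩ := hs.comap (N := ModuleCat.of S (LinearMap.range f))
    (LinearMap.range f).subtype (Submodule.subtype_injective _)
  have hE : D.FactorsLE a E := FactorsLE.of_ses hig (D.factorsLE_Nabla h a) hr
  obtain ⟨t, rfl⟩ := D.Nabla_lift h hE m
  ext x
  obtain ⟨y, hy⟩ := hig.surj ⟨f x, x, rfl⟩
  have h1 := LinearMap.congr_fun hmg y
  rw [LinearMap.comp_apply, LinearMap.comp_apply, LinearMap.comp_apply, hy] at h1
  exact h1.symm.trans (hs.apply_apply _)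

end Nabla

/-! ### Homomorphisms and extensions between standard and costandard modules -/

variable (hD : D.IsQuasiHereditary)
include hD

/-- `L a` is not a composition factor of the radical of `Δ(a)`. -/
lemma not_occurs_ker_deltaTop (a : Λ) :
    ¬ D.Occurs a (ModuleCat.of S (LinearMap.ker (D.deltaTop hD.full a))) := by
  obtain ⟨l, hl, hc⟩ := hD.delta a
  have h1 := mult_eq_count hD.full a hl
  rw [hc, mult_ses a (IsSES.of_ker _ (D.deltaTop_surjective hD.full a)), mult_L_self,
    Nat.cast_one] at h1
  rw [← mult_eq_zero_iff]
  simpa using h1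

lemma lt_of_occurs_ker_deltaTop {a b : Λ}
    (hb : D.Occurs b (ModuleCat.of S (LinearMap.ker (D.deltaTop hD.full a)))) : b < a := by
  refine lt_of_le_of_ne (((factorsLE_iff hD.full).1 (D.factorsLE_Delta hD.full a)).2 b
    (hb.of_injective _ (Submodule.subtype_injective _))) ?_
  rintro rfl
  exact D.not_occurs_ker_deltaTop hD b hb

/-- Every map `P a → ∇(a)` has image in the socle. -/
lemma exists_nablaSocle_comp [EnoughFiniteInjectives S] {a : Λ} (f : D.P a →ₗ[S] D.Nabla a) :
    ∃ g : D.P a →ₗ[S] D.L a, D.nablaSocle hD.full a ∘ₗ g = f := by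
  have := D.isSimple a
  obtain ⟨g, rfl⟩ := D.Delta_desc hD.full (D.factorsLE_Nabla hD.full a) f
  obtain ⟨g, rfl⟩ := (IsSES.of_ker _ (D.deltaTop_surjective hD.full a)).desc g (by
    by_contra h0
    exact D.not_occurs_ker_deltaTop hD a (D.occurs_of_hom_Nabla hD.full h0))
  obtain ⟨k, rfl⟩ : ∃ k : D.L a →ₗ[S] D.L a, D.nablaSocle hD.full a ∘ₗ k = g := by
    refine (IsSES.of_range _ (D.nablaSocle_injective hD.full a)).lift_of_comp_eq_zero g ?_
    by_cases hg : g = 0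
    · rw [hg, LinearMap.comp_zero]
    have hr : LinearMap.range (D.nablaSocle hD.full a) ≤ LinearMap.range g :=
      D.range_nablaSocle_le hD.full fun h0 ↦ hg (LinearMap.range_eq_bot.1 h0)
    have hc : (LinearMap.range (D.nablaSocle hD.full a)).comap g = ⊤ := by
      refine (eq_bot_or_eq_top _).resolve_left fun h0 ↦ ?_
      have := (D.isSimple a).nontrivial
      obtain ⟨x, hx⟩ := exists_ne (0 : D.L a)
      obtain ⟨y, hy⟩ := hr ⟨x, rfl⟩
      have hy' : y ∈ (LinearMap.range (D.nablaSocle hD.full a)).comap g := ⟨x, hy.symm⟩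
      rw [h0, Submodule.mem_bot] at hy'
      rw [hy', map_zero] at hy
      exact hx (D.nablaSocle_injective hD.full a (by rw [← hy, map_zero]))
    ext x
    refine (Submodule.Quotient.mk_eq_zero _).2 ?_
    have : x ∈ (LinearMap.range (D.nablaSocle hD.full a)).comap g := by rw [hc]; trivial
    exact this
  exact ⟨k ∘ₗ D.deltaTop hD.full a ∘ₗ D.toDelta a, rfl⟩

/-- `L a` is not a composition factor of `∇(a) / L a`. -/
lemma not_occurs_nablaSocle_quotient [EnoughFiniteInjectives S] (a : Λ) :
    ¬ D.Occurs a (ModuleCat.of S (D.Nabla a ⧸ LinearMap.range (D.nablaSocle hD.full a))) := by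
  rintro ⟨f, hf⟩
  obtain ⟨f, rfl⟩ := D.P_lift a (N := ModuleCat.of S _) _ (Submodule.mkQ_surjective _) f
  obtain ⟨g, rfl⟩ := D.exists_nablaSocle_comp hD f
  refine hf ?_
  rw [← LinearMap.comp_assoc,
    (IsSES.of_range _ (D.nablaSocle_injective hD.full a)).comp_eq_zero, LinearMap.zero_comp]

lemma lt_of_occurs_nablaSocle_quotient [EnoughFiniteInjectives S] {a b : Λ}
    (hb : D.Occurs b (ModuleCat.of S (D.Nabla a ⧸ LinearMap.range (D.nablaSocle hD.full a)))) :
    b < a := by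
  refine lt_of_le_of_ne (((factorsLE_iff hD.full).1 (D.factorsLE_Nabla hD.full a)).2 b
    (hb.of_surjective _ (Submodule.mkQ_surjective _))) ?_
  rintro rfl
  exact D.not_occurs_nablaSocle_quotient hD b hb

/-- The kernel of `P a → Δ(a)` is filtered by standard modules `Δ(b)` with `b > a`. -/
lemma exists_proj_ses (a : Λ) : ∃ (N : ModuleCat.{u} S) (l : List Λ) (i : N →ₗ[S] D.P a)
    (p : D.P a →ₗ[S] D.Delta a), IsSES i p ∧ HasFiltration D.Delta l N ∧ ∀ b ∈ l, a < b := by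
  obtain ⟨l, hl, hc, hle⟩ := hD.proj a
  cases hl with
  | nil _ h => simp at hc
  | cons b l N M i p hi hip hp h =>
    obtain rfl := D.eq_of_surjective_P_Delta hD.full p hp
    refine ⟨N, l, i, p, ⟨hi, hip, hp⟩, h, fun b hb ↦
      lt_of_le_of_ne (hle b (List.mem_cons_of_mem _ hb)) ?_⟩
    rintro rfl
    classical
    have h0 : l.count a = 0 := by simpa [List.count_cons] using hc
    exact List.count_eq_zero.1 h0 hb

variable [EnoughFiniteInjectives S]

lemma hom_Delta_Nabla_eq_zero {a b : Λ} (hab : a ≠ b) (f : D.Delta a →ₗ[S] D.Nabla b) :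
    f = 0 := by
  by_contra hf
  exact hab (le_antisymm
    (((factorsLE_iff hD.full).1 (D.factorsLE_Nabla hD.full b)).2 a (D.occurs_of_hom_Delta hf))
    (((factorsLE_iff hD.full).1 (D.factorsLE_Delta hD.full a)).2 b
      (D.occurs_of_hom_Nabla hD.full hf)))

/-- `Extⁿ(Δ(a), ∇(b)) = 0` for `n ≥ 1`. -/
lemma extZero_Delta_Nabla (n : ℕ) (a b : Λ) : ExtZero (n + 1) (D.Delta a) (D.Nabla b) := by
  induction n generalizing a with
  | zero =>
    by_cases hab : a ≤ b
    · refine (IsSES.of_range (D.ofNabla b) (D.ofNabla_injective b)).extZero_one_of_lift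
        (extZero_of_injective (D.I_injective b) 0 _) fun f ↦ ⟨0, ?_⟩
      rw [D.hom_quotient_Nabla_eq_zero hD.full ?_ f, LinearMap.comp_zero]
      obtain ⟨l, hl, hl'⟩ := D.factorsLE_Delta hD.full a
      exact ⟨l, hl, fun c hc ↦ (hl' c hc).trans hab⟩
    · obtain ⟨N, l, i, p, hs, hl, hlt⟩ := D.exists_proj_ses hD a
      refine hs.extZero_one_of_extend (extZero_of_projective (D.P_projective a) 0 _)
        fun f ↦ ⟨0, ?_⟩
      rw [hl.hom_eq_zero_left (fun c hc g ↦ D.hom_Delta_Nabla_eq_zero hD ?_ g) f,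
        LinearMap.zero_comp]
      rintro rfl
      exact hab (hlt _ hc).le
  | succ n ih =>
    obtain ⟨N, l, i, p, hs, hl, -⟩ := D.exists_proj_ses hD a
    exact hs.extZero_quot (hl.extZero_left fun c _ ↦ ih c)
      (extZero_of_projective (D.P_projective a) _ _)

end Labelling

/-! ### Homological characterisation of filtered modules -/

section Length

variable {S : Type u} [Ring S] [IsArtinianRing S] {A B C : ModuleCat.{u} S} {i : A →ₗ[S] B}
  {p : B →ₗ[S] C}

lemma IsSES.length_toNat (h : IsSES i p) (hB : Module.Finite S B) :
    (Module.length S B).toNat = (Module.length S A).toNat + (Module.length S C).toNat := by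
  have := h.finite_left hB
  have := h.finite_right hB
  rw [Module.length_eq_add_of_exact i p h.inj h.surj h.exact,
    ENat.toNat_add Module.length_ne_top Module.length_ne_top]

lemma length_toNat_pos {M : ModuleCat.{u} S} (hM : Module.Finite S M) (hn : Nontrivial M) :
    0 < (Module.length S M).toNat := by
  rw [Nat.pos_iff_ne_zero, Ne, ENat.toNat_eq_zero, not_or]
  exact ⟨Module.length_pos.ne', Module.length_ne_top⟩

end Length

lemma nontrivial_of_ne_zero {S : Type u} [Ring S] {M N : ModuleCat.{u} S} {f : M →ₗ[S] N}
    (hf : f ≠ 0) : Nontrivial N := by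
  by_contra h
  rw [not_nontrivial_iff_subsingleton] at h
  exact hf (Subsingleton.elim _ _)

lemma comp_ne_zero_of_injective {S : Type u} [Ring S] {L M N : ModuleCat.{u} S} {f : L →ₗ[S] M}
    (hf : f ≠ 0) {i : M →ₗ[S] N} (hi : Function.Injective i) : i ∘ₗ f ≠ 0 := by
  intro h0
  exact hf ((LinearMap.cancel_left hi).1 (h0.trans (LinearMap.comp_zero i).symm))

lemma comp_ne_zero_of_surjective {S : Type u} [Ring S] {L M N : ModuleCat.{u} S} {f : M →ₗ[S] N}
    (hf : f ≠ 0) {p : L →ₗ[S] M} (hp : Function.Surjective p) : f ∘ₗ p ≠ 0 := by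
  intro h0
  exact hf ((LinearMap.cancel_right hp).1 (h0.trans (LinearMap.zero_comp p).symm))

lemma ne_zero_of_injective {S : Type u} [Ring S] {M N : ModuleCat.{u} S} {f : M →ₗ[S] N}
    (hM : Nontrivial M) (hf : Function.Injective f) : f ≠ 0 := by
  rintro rfl
  obtain ⟨x, hx⟩ := exists_ne (0 : M)
  exact hx (hf rfl)

lemma ne_zero_of_surjective {S : Type u} [Ring S] {M N : ModuleCat.{u} S} {f : M →ₗ[S] N}
    (hN : Nontrivial N) (hf : Function.Surjective f) : f ≠ 0 := by
  rintro rfl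
  obtain ⟨x, hx⟩ := exists_ne (0 : N)
  obtain ⟨y, rfl⟩ := hf x
  exact hx rfl

lemma exists_finite_projective {S : Type u} [Ring S] {X : ModuleCat.{u} S}
    (hX : Module.Finite S X) : ∃ (P : ModuleCat.{u} S) (p : P →ₗ[S] X), Module.Finite S P ∧
      Module.Projective S P ∧ Function.Surjective p := by
  obtain ⟨n, f, hf⟩ := Module.Finite.exists_fin' S X
  exact ⟨ModuleCat.of S (Fin n → S), f, inferInstanceAs (Module.Finite S (Fin n → S)),
    inferInstanceAs (Module.Projective S (Fin n → S)), hf⟩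

lemma Labelling.Occurs.nontrivial {S : Type u} [Ring S] {Λ : Type w} {D : Labelling S Λ} {a : Λ}
    {M : ModuleCat.{u} S} (h : D.Occurs a M) : Nontrivial M := by
  obtain ⟨f, hf⟩ := h
  exact nontrivial_of_ne_zero hf

namespace Labelling

variable {S : Type u} [Ring S] [IsArtinianRing S] {Λ : Type w} [PartialOrder Λ]
  {D : Labelling S Λ} (hD : D.IsQuasiHereditary) [EnoughFiniteInjectives S]
include hD

omit [EnoughFiniteInjectives S] in
/-- Every homomorphism from a module with composition factors `< a` to `M` is zero if `a` is
minimal with `Hom(Δ(a), M) ≠ 0`. -/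
lemma hom_eq_zero_of_minimal {M : ModuleCat.{u} S} (hM : Module.Finite S M) {a : Λ}
    (ha : ∀ c < a, ∀ f : D.Delta c →ₗ[S] M, f = 0) {X : ModuleCat.{u} S}
    (hX : ∀ b, D.Occurs b X → b < a) (f : X →ₗ[S] M) : f = 0 := by
  by_contra hf
  have hn : Nontrivial (ModuleCat.of S (LinearMap.range f)) :=
    (Submodule.nontrivial_iff_ne_bot).2 fun h0 ↦ hf (LinearMap.range_eq_bot.1 h0)
  obtain ⟨c, g, hg⟩ := exists_socle hD.full (Module.Finite.of_injective
    (LinearMap.range f).subtype (Submodule.subtype_injective _)) hn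
  have hc : c < a := hX c (((D.occurs_L c).of_injective g hg).of_surjective f.rangeRestrict
    f.surjective_rangeRestrict)
  have := (D.isSimple c).nontrivial
  refine comp_ne_zero_of_surjective (ne_zero_of_injective this ?_)
    (D.deltaTop_surjective hD.full c)
    (ha c hc (((LinearMap.range f).subtype ∘ₗ g) ∘ₗ D.deltaTop hD.full c))
  exact (Submodule.subtype_injective _).comp hg

omit [EnoughFiniteInjectives S] in
/-- Dually, every homomorphism from `M` to a module with composition factors `< a` is zero if `a`
is minimal with `Hom(M, ∇(a)) ≠ 0`. -/
lemma hom_eq_zero_of_minimal' {M : ModuleCat.{u} S} (hM : Module.Finite S M) {a : Λ}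
    (ha : ∀ c < a, ∀ f : M →ₗ[S] D.Nabla c, f = 0) {X : ModuleCat.{u} S}
    (hX : ∀ b, D.Occurs b X → b < a) (f : M →ₗ[S] X) : f = 0 := by
  by_contra hf
  have hn : Nontrivial (ModuleCat.of S (LinearMap.range f)) :=
    (Submodule.nontrivial_iff_ne_bot).2 fun h0 ↦ hf (LinearMap.range_eq_bot.1 h0)
  obtain ⟨c, g, hg⟩ := exists_top hD.full (Module.Finite.of_surjective
    f.rangeRestrict f.surjective_rangeRestrict) hn
  have hc : c < a := hX c (((D.occurs_L c).of_surjective g hg).of_injective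
    (LinearMap.range f).subtype (Submodule.subtype_injective _))
  have := (D.isSimple c).nontrivial
  refine comp_ne_zero_of_injective (ne_zero_of_surjective this ?_)
    (D.nablaSocle_injective hD.full c) (ha c hc (D.nablaSocle hD.full c ∘ₗ g ∘ₗ f.rangeRestrict))
  exact hg.comp f.surjective_rangeRestrict

/-- A finitely generated `M` with `Ext¹(Δ(a), M) = 0` for all `a` has a `∇`-filtration. -/
theorem filtered_Nabla_of_extZero {M : ModuleCat.{u} S} (hM : Module.Finite S M)
    (hE : ∀ a, ExtZero 1 (D.Delta a) M) : Filtered D.Nabla M := by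
  induction hn : (Module.length S M).toNat using Nat.strong_induction_on generalizing M with
  | _ n ih =>
  by_cases hs : Subsingleton M
  · exact ⟨[], .nil M hs⟩
  rw [not_subsingleton_iff_nontrivial] at hs
  have hne : {a | ∃ f : D.Delta a →ₗ[S] M, f ≠ 0}.Nonempty := by
    obtain ⟨c, f, hf⟩ := exists_socle hD.full hM hs
    have := (D.isSimple c).nontrivial
    exact ⟨c, f ∘ₗ D.deltaTop hD.full c, comp_ne_zero_of_surjective
      (ne_zero_of_injective this hf) (D.deltaTop_surjective hD.full c)⟩
  have hfin : {a | ∃ f : D.Delta a →ₗ[S] M, f ≠ 0}.Finite :=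
    (finite_occurs hD.full hM).subset fun a ⟨_, hf⟩ ↦ D.occurs_of_hom_Delta hf
  obtain ⟨a, ⟨f, hf⟩, hmin⟩ := hfin.exists_minimal hne
  replace hmin : ∀ c < a, ∀ f : D.Delta c →ₗ[S] M, f = 0 := fun c hc f ↦ by
    by_contra hf
    exact hc.not_ge (hmin ⟨f, hf⟩ hc.le)
  have hZ := fun (X : ModuleCat.{u} S) ↦ D.hom_eq_zero_of_minimal hD hM hmin (X := X)
  obtain ⟨g, rfl⟩ := (IsSES.of_ker _ (D.deltaTop_surjective hD.full a)).desc f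
    (hZ _ (fun b hb ↦ D.lt_of_occurs_ker_deltaTop hD hb) _)
  have hg : g ≠ 0 := fun h0 ↦ hf (by rw [h0, LinearMap.zero_comp])
  have hgi : Function.Injective g := by
    have := D.isSimple a
    exact LinearMap.injective_of_ne_zero hg
  have hsoc := IsSES.of_range _ (D.nablaSocle_injective hD.full a)
  -- `g : L a → M` extends to `∇(a)`, since `Ext¹(L c, M) = 0` for the factors `L c` of `∇(a)/L a`
  have hQ := hsoc.finite_right (D.Nabla_finite hD.full a)
  obtain ⟨l, hl⟩ := exists_hasFiltration_L hD.full hQ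
  obtain ⟨k, rfl⟩ := hsoc.extend (hl.extZero_left fun c hc ↦ by
    have hca : c < a := D.lt_of_occurs_nablaSocle_quotient hD
      (Occurs.of_mem hl hc (D.occurs_L c))
    refine (IsSES.of_ker _ (D.deltaTop_surjective hD.full c)).extZero_one_of_extend (hE c)
      fun f ↦ ⟨0, ?_⟩
    rw [hZ _ (fun b hb ↦ (D.lt_of_occurs_ker_deltaTop hD hb).trans hca) f,
      LinearMap.zero_comp]) g
  have hk := D.injective_of_comp_nablaSocle hD.full k hg
  have hses := IsSES.of_range k hk
  obtain ⟨l', hl'⟩ := ih _ (by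
    rw [← hn, hses.length_toNat hM]
    exact Nat.lt_add_of_pos_left (length_toNat_pos (D.Nabla_finite hD.full a)
      (D.occurs_Nabla hD.full a).nontrivial))
    (hses.finite_right hM)
    (fun c ↦ hses.extZero_coker (hE c) (D.extZero_Delta_Nabla hD 1 c a)) rfl
  exact ⟨_, (HasFiltration.single a).append hses hl'⟩

/-- A finitely generated `M` with `Ext¹(M, ∇(a)) = 0` for all `a` has a `Δ`-filtration. -/
theorem filtered_Delta_of_extZero {M : ModuleCat.{u} S} (hM : Module.Finite S M)
    (hE : ∀ a, ExtZero 1 M (D.Nabla a)) : Filtered D.Delta M := by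
  induction hn : (Module.length S M).toNat using Nat.strong_induction_on generalizing M with
  | _ n ih =>
  by_cases hs : Subsingleton M
  · exact ⟨[], .nil M hs⟩
  rw [not_subsingleton_iff_nontrivial] at hs
  have hne : {a | ∃ f : M →ₗ[S] D.Nabla a, f ≠ 0}.Nonempty := by
    obtain ⟨c, f, hf⟩ := exists_top hD.full hM hs
    have := (D.isSimple c).nontrivial
    exact ⟨c, D.nablaSocle hD.full c ∘ₗ f, comp_ne_zero_of_injective
      (ne_zero_of_surjective this hf) (D.nablaSocle_injective hD.full c)⟩
  have hfin : {a | ∃ f : M →ₗ[S] D.Nabla a, f ≠ 0}.Finite :=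
    (finite_occurs hD.full hM).subset fun a ⟨_, hf⟩ ↦ D.occurs_of_hom_Nabla hD.full hf
  obtain ⟨a, ⟨f, hf⟩, hmin⟩ := hfin.exists_minimal hne
  replace hmin : ∀ c < a, ∀ f : M →ₗ[S] D.Nabla c, f = 0 := fun c hc f ↦ by
    by_contra hf
    exact hc.not_ge (hmin ⟨f, hf⟩ hc.le)
  have hZ := fun (X : ModuleCat.{u} S) ↦ D.hom_eq_zero_of_minimal' hD hM hmin (X := X)
  obtain ⟨g, rfl⟩ := (IsSES.of_range _ (D.nablaSocle_injective hD.full a)).lift_of_comp_eq_zero f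
    (hZ _ (fun b hb ↦ D.lt_of_occurs_nablaSocle_quotient hD hb) _)
  have hg : g ≠ 0 := fun h0 ↦ hf (by rw [h0, LinearMap.comp_zero])
  have htop := IsSES.of_ker _ (D.deltaTop_surjective hD.full a)
  -- `g : M → L a` lifts to `Δ(a)`, since `Ext¹(M, L c) = 0` for the factors `L c` of the radical
  obtain ⟨l, hl⟩ := exists_hasFiltration_L hD.full (htop.finite_left (D.Delta_finite a))
  obtain ⟨k, rfl⟩ := htop.lift (hl.extZero_right fun c hc ↦ by
    have hca : c < a := D.lt_of_occurs_ker_deltaTop hD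
      (Occurs.of_mem hl hc (D.occurs_L c))
    refine (IsSES.of_range _ (D.nablaSocle_injective hD.full c)).extZero_one_of_lift (hE c)
      fun f ↦ ⟨0, ?_⟩
    rw [hZ _ (fun b hb ↦ (D.lt_of_occurs_nablaSocle_quotient hD hb).trans hca) f,
      LinearMap.comp_zero]) g
  have hk := D.surjective_of_deltaTop_comp hD.full k hg
  have hses := IsSES.of_ker k hk
  obtain ⟨l', hl'⟩ := ih _ (by
    rw [← hn, hses.length_toNat hM]
    exact Nat.lt_add_of_pos_right (length_toNat_pos (D.Delta_finite a)
      (D.occurs_Delta hD.full a).nontrivial))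
    (hses.finite_left hM)
    (fun c ↦ hses.extZero_ker (hE c) (D.extZero_Delta_Nabla hD 1 a c)) rfl
  exact ⟨_, hl'.cons' hses⟩

lemma extZero_of_filtered {M N : ModuleCat.{u} S} (hM : Filtered D.Delta M)
    (hN : Filtered D.Nabla N) (n : ℕ) : ExtZero (n + 1) M N := by
  obtain ⟨l, hl⟩ := hM
  obtain ⟨m, hm⟩ := hN
  exact hl.extZero_left fun a _ ↦ hm.extZero_right fun b _ ↦ D.extZero_Delta_Nabla hD n a b

omit hD [IsArtinianRing S] [EnoughFiniteInjectives S] in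
lemma filtered_Delta_self (a : Λ) : Filtered D.Delta (D.Delta a) := ⟨_, .single a⟩

omit hD [IsArtinianRing S] [EnoughFiniteInjectives S] in
lemma filtered_Nabla_self (a : Λ) : Filtered D.Nabla (D.Nabla a) := ⟨_, .single a⟩

omit hD [IsArtinianRing S] [EnoughFiniteInjectives S] in
lemma finite_of_filtered_Delta {M : ModuleCat.{u} S} (hM : Filtered D.Delta M) :
    Module.Finite S M := by
  obtain ⟨l, hl⟩ := hM
  exact hl.finite D.Delta_finite

lemma finite_of_filtered_Nabla {M : ModuleCat.{u} S} (hM : Filtered D.Nabla M) :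
    Module.Finite S M := by
  obtain ⟨l, hl⟩ := hM
  exact hl.finite (D.Nabla_finite hD.full)

lemma filtered_Delta_of_projective {P : ModuleCat.{u} S} (hf : Module.Finite S P)
    (hP : Module.Projective S P) : Filtered D.Delta P :=
  D.filtered_Delta_of_extZero hD hf fun _ ↦ extZero_of_projective hP 0 _

lemma filtered_Nabla_of_injective {J : ModuleCat.{u} S} (hf : Module.Finite S J)
    (hJ : Module.Injective S J) : Filtered D.Nabla J :=
  D.filtered_Nabla_of_extZero hD hf fun _ ↦ extZero_of_injective hJ 0 _

/-- Kernels of surjections between `Δ`-filtered modules are `Δ`-filtered. -/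
lemma filtered_Delta_of_ses {A B C : ModuleCat.{u} S} {i : A →ₗ[S] B} {p : B →ₗ[S] C}
    (h : IsSES i p) (hB : Filtered D.Delta B) (hC : Filtered D.Delta C) : Filtered D.Delta A :=
  D.filtered_Delta_of_extZero hD (h.finite_left (D.finite_of_filtered_Delta hB)) fun a ↦
    h.extZero_ker (D.extZero_of_filtered hD hB (D.filtered_Nabla_self a) 0)
      (D.extZero_of_filtered hD hC (D.filtered_Nabla_self a) 1)

/-- Cokernels of injections between `∇`-filtered modules are `∇`-filtered. -/
lemma filtered_Nabla_of_ses {A B C : ModuleCat.{u} S} {i : A →ₗ[S] B} {p : B →ₗ[S] C}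
    (h : IsSES i p) (hA : Filtered D.Nabla A) (hB : Filtered D.Nabla B) : Filtered D.Nabla C :=
  D.filtered_Nabla_of_extZero hD (h.finite_right (D.finite_of_filtered_Nabla hD hB)) fun a ↦
    h.extZero_coker (D.extZero_of_filtered hD (D.filtered_Delta_self a) hB 0)
      (D.extZero_of_filtered hD (D.filtered_Delta_self a) hA 1)

/-! ### Homological characterisation of the dimensions -/

/-- Standard filtration dimension is detected by Ext groups into the costandard modules. -/
lemma hasResolution_iff {X : ModuleCat.{u} S} (hX : Module.Finite S X) (d : ℕ) :
    HasResolution (Filtered D.Delta) d X ↔ ∀ b, ExtZero (d + 1) X (D.Nabla b) := by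
  constructor
  · intro h b
    clear hX
    induction h with
    | zero X h => exact D.extZero_of_filtered hD h (D.filtered_Nabla_self b) 0
    | succ d K M X i p hi hip hp hM h ih =>
      exact (IsSES.mk hi hip hp).extZero_quot ih
        (D.extZero_of_filtered hD hM (D.filtered_Nabla_self b) _)
  · intro h
    induction d generalizing X with
    | zero => exact .zero _ (D.filtered_Delta_of_extZero hD hX h)
    | succ d ih =>
      obtain ⟨P, p, hPf, hP, hp⟩ := exists_finite_projective hX
      have hs := IsSES.of_ker p hp
      exact .succ d _ P X _ p hs.inj hs.exact hp (D.filtered_Delta_of_projective hD hPf hP)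
        (ih (hs.finite_left hPf) fun b ↦ hs.extZero_ker (extZero_of_projective hP _ _) (h b))

/-- Costandard filtration dimension is detected by Ext groups out of the standard modules. -/
lemma hasCoresolution_iff {X : ModuleCat.{u} S} (hX : Module.Finite S X) (d : ℕ) :
    HasCoresolution (Filtered D.Nabla) d X ↔ ∀ b, ExtZero (d + 1) (D.Delta b) X := by
  constructor
  · intro h b
    clear hX
    induction h with
    | zero X h => exact D.extZero_of_filtered hD (D.filtered_Delta_self b) h 0
    | succ d X M Q i p hi hip hp hM h ih =>
      exact (IsSES.mk hi hip hp).extZero_sub ih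
        (D.extZero_of_filtered hD (D.filtered_Delta_self b) hM _)
  · intro h
    induction d generalizing X with
    | zero => exact .zero _ (D.filtered_Nabla_of_extZero hD hX h)
    | succ d ih =>
      obtain ⟨J, i, hJf, hJ, hi⟩ := EnoughFiniteInjectives.exists_embedding X hX
      have hs := IsSES.of_range i hi
      exact .succ d X J _ i _ hi hs.exact hs.surj (D.filtered_Nabla_of_injective hD hJf hJ)
        (ih (hs.finite_right hJf) fun b ↦ hs.extZero_coker (extZero_of_injective hJ _ _) (h b))

/-- The projective dimension of a `Δ`-filtered module is detected by the standard modules. -/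
lemma hasProjectiveDimensionLE_iff {X : ModuleCat.{u} S} (hX : Filtered D.Delta X) (d : ℕ) :
    HasProjectiveDimensionLE X d ↔ ∀ b, ExtZero (d + 1) X (D.Delta b) := by
  constructor
  · intro h b
    exact h.subsingleton X (d + 1) (d + 1) le_rfl _
  · intro h
    induction d generalizing X with
    | zero =>
      obtain ⟨P, p, hPf, hP, hp⟩ := exists_finite_projective (D.finite_of_filtered_Delta hX)
      have hs := IsSES.of_ker p hp
      -- the kernel of `p` is `Δ`-filtered, so the sequence splits
      obtain ⟨l, hl⟩ := D.filtered_Delta_of_ses hD hs (D.filtered_Delta_of_projective hD hPf hP) hX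
      obtain ⟨s, hs'⟩ := hs.exists_section (hl.extZero_right fun b _ ↦ h b)
      have : Projective X := (IsProjective.iff_projective X).1 (Module.Projective.of_split s p hs')
      exact inferInstanceAs (HasProjectiveDimensionLT X 1)
    | succ d ih =>
      obtain ⟨P, p, hPf, hP, hp⟩ := exists_finite_projective (D.finite_of_filtered_Delta hX)
      have hs := IsSES.of_ker p hp
      have := (IsProjective.iff_projective P).1 hP
      refine (hs.shortExact.hasProjectiveDimensionLT_X₃_iff d this).2 (ih ?_ fun b ↦
        hs.extZero_ker (extZero_of_projective hP _ _) (h b))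
      exact D.filtered_Delta_of_ses hD hs (D.filtered_Delta_of_projective hD hPf hP) hX

/-- The injective dimension of a `∇`-filtered module is detected by the costandard modules. -/
lemma hasInjectiveDimensionLE_iff {X : ModuleCat.{u} S} (hX : Filtered D.Nabla X) (d : ℕ) :
    HasInjectiveDimensionLE X d ↔ ∀ b, ExtZero (d + 1) (D.Nabla b) X := by
  constructor
  · intro h b
    exact h.subsingleton X (d + 1) (d + 1) le_rfl _
  · intro h
    induction d generalizing X with
    | zero =>
      obtain ⟨J, i, hJf, hJ, hi⟩ :=
        EnoughFiniteInjectives.exists_embedding X (D.finite_of_filtered_Nabla hD hX)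
      have hs := IsSES.of_range i hi
      -- the cokernel of `i` is `∇`-filtered, so the sequence splits
      obtain ⟨l, hl⟩ := D.filtered_Nabla_of_ses hD hs hX (D.filtered_Nabla_of_injective hD hJf hJ)
      obtain ⟨r, hr⟩ := hs.exists_retraction (hl.extZero_left fun b _ ↦ h b)
      have : Injective X := by
        have := (Module.injective_iff_injective_object S J).1 hJ
        exact Retract.injective (X := X) (Y := J)
          ⟨ModuleCat.ofHom i, ModuleCat.ofHom r, by rw [← ModuleCat.ofHom_comp, hr]; rfl⟩
      exact inferInstanceAs (HasInjectiveDimensionLT X 1)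
    | succ d ih =>
      obtain ⟨J, i, hJf, hJ, hi⟩ :=
        EnoughFiniteInjectives.exists_embedding X (D.finite_of_filtered_Nabla hD hX)
      have hs := IsSES.of_range i hi
      have := (Module.injective_iff_injective_object S J).1 hJ
      refine (hs.shortExact.hasInjectiveDimensionLT_X₃_iff d this).1 (ih ?_ fun b ↦
        hs.extZero_coker (extZero_of_injective hJ _ _) (h b))
      exact D.filtered_Nabla_of_ses hD hs hX (D.filtered_Nabla_of_injective hD hJf hJ)

end Labelling

/-! ### Tilting modules -/

namespace Labelling

variable {S : Type u} [Ring S] [IsArtinianRing S] {Λ : Type w} [PartialOrder Λ]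
  {D : Labelling S Λ}

/-- In a `∇`-filtered module with composition factors `≤ a`, a section `∇(a)` can be moved to the
top of the filtration, because `∇(a)` is injective among such modules. -/
lemma exists_Nabla_top (hf : D.IsFull) {a : Λ} {M : ModuleCat.{u} S} {l : List Λ}
    (h : HasFiltration D.Nabla l M) (hM : D.FactorsLE a M) (ha : a ∈ l) :
    ∃ (N : ModuleCat.{u} S) (l' : List Λ) (i : N →ₗ[S] M) (p : M →ₗ[S] D.Nabla a),
      IsSES i p ∧ HasFiltration D.Nabla l' N := by
  induction h with
  | nil M h => simp at ha
  | cons c l N M i p hi hip hp h ih =>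
    by_cases hc : a = c
    · subst hc
      exact ⟨N, l, i, p, ⟨hi, hip, hp⟩, h⟩
    obtain ⟨N', l', i', p', hs, h'⟩ := ih (hM.of_injective hf i hi)
      ((List.mem_cons.1 ha).resolve_left hc)
    obtain ⟨q, rfl⟩ := D.Nabla_extend hf hM i hi p'
    have hq : Function.Surjective q := Function.Surjective.of_comp (g := i) hs.surj
    have hmem : ∀ x, (i ∘ₗ i') x ∈ LinearMap.ker q := fun x ↦ hs.apply_apply x
    have hses : IsSES (B := ModuleCat.of S (LinearMap.ker q))
        ((i ∘ₗ i').codRestrict (LinearMap.ker q) hmem) (p ∘ₗ (LinearMap.ker q).subtype) := by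
      refine ⟨fun x y hxy ↦ hs.inj (hi (congrArg Subtype.val hxy)), fun x ↦ ⟨fun hx ↦ ?_, ?_⟩,
        fun y ↦ ?_⟩
      · obtain ⟨n, hn⟩ := (hip x.1).1 hx
        obtain ⟨n', rfl⟩ := (hs.exact n).1 (by
          change q (i n) = 0
          rw [hn]; exact x.2)
        exact ⟨n', Subtype.ext hn⟩
      · rintro ⟨n, rfl⟩
        exact hip.apply_apply_eq_zero _
      · obtain ⟨m, rfl⟩ := hp y
        obtain ⟨n, hn⟩ := hs.surj (q m)
        refine ⟨⟨m - i n, ?_⟩, ?_⟩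
        · rw [LinearMap.mem_ker, map_sub, ← hn]
          exact sub_self _
        · change p (m - i n) = p m
          rw [map_sub, hip.apply_apply_eq_zero, sub_zero]
    exact ⟨_, c :: l', _, q, IsSES.of_ker q hq, h'.cons' hses⟩

/-- In a `Δ`-filtered module with composition factors `≤ a`, a section `Δ(a)` can be moved to the
bottom of the filtration, because `Δ(a)` is projective among such modules. -/
lemma exists_Delta_bot (hf : D.IsFull) {a : Λ} {M : ModuleCat.{u} S} {l : List Λ}
    (h : HasFiltration D.Delta l M) (hM : D.FactorsLE a M) (ha : a ∈ l) :
    ∃ (N : ModuleCat.{u} S) (l' : List Λ) (i : D.Delta a →ₗ[S] M) (p : M →ₗ[S] N),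
      IsSES i p ∧ HasFiltration D.Delta l' N := by
  induction h with
  | nil M h => simp at ha
  | cons c l N M i p hi hip hp h ih =>
    by_cases hc : a = c
    · subst hc
      obtain ⟨s, hs⟩ := D.Delta_lift hf hM p hp LinearMap.id
      have hps : ∀ x, p (s x) = x := LinearMap.congr_fun hs
      refine ⟨_, l, s, _, IsSES.of_range s (Function.LeftInverse.injective hps), ?_⟩
      refine h.of_equiv (LinearEquiv.ofBijective ((LinearMap.range s).mkQ ∘ₗ i) ⟨?_, fun y ↦ ?_⟩)
      · rw [← LinearMap.ker_eq_bot, eq_bot_iff]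
        intro x hx
        obtain ⟨y, hy⟩ := (Submodule.Quotient.mk_eq_zero _).1 hx
        have : y = 0 := by rw [← hps y, hy, hip.apply_apply_eq_zero]
        rw [this, map_zero] at hy
        exact hi (hy.symm.trans (map_zero i).symm)
      · obtain ⟨m, rfl⟩ := Submodule.mkQ_surjective _ y
        obtain ⟨n, hn⟩ := (hip (m - s (p m))).1 (by rw [map_sub, hps, sub_self])
        refine ⟨n, (Submodule.Quotient.eq _).2 ⟨-p m, ?_⟩⟩
        rw [hn, map_neg]; abel
    obtain ⟨N', l', i', p', hs, h'⟩ := ih (hM.of_injective hf i hi)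
      ((List.mem_cons.1 ha).resolve_left hc)
    have hr := IsSES.of_range (i ∘ₗ i') (hi.comp hs.inj)
    obtain ⟨j, hj⟩ := hs.desc ((LinearMap.range (i ∘ₗ i')).mkQ ∘ₗ i)
      (Y := ModuleCat.of S (M ⧸ LinearMap.range (i ∘ₗ i'))) hr.comp_eq_zero
    obtain ⟨q, hq⟩ := hr.desc p (by
      rw [← LinearMap.comp_assoc, hip.linearMap_comp_eq_zero, LinearMap.zero_comp])
    have hses : IsSES j q := by
      refine ⟨?_, fun y ↦ ⟨fun hy ↦ ?_, ?_⟩, ?_⟩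
      · rw [← LinearMap.ker_eq_bot, eq_bot_iff]
        intro x hx
        obtain ⟨n, rfl⟩ := hs.surj x
        have h1 := (LinearMap.congr_fun hj n).symm.trans hx
        obtain ⟨z, hz⟩ := (Submodule.Quotient.mk_eq_zero _).1 h1
        rw [← hi hz]
        exact hs.apply_apply z
      · obtain ⟨m, rfl⟩ := Submodule.mkQ_surjective _ y
        obtain ⟨n, rfl⟩ := (hip m).1 ((LinearMap.congr_fun hq m).symm.trans hy)
        exact ⟨p' n, LinearMap.congr_fun hj n⟩
      · rintro ⟨x, rfl⟩
        obtain ⟨n, rfl⟩ := hs.surj x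
        have h1 : j (p' n) = (LinearMap.range (i ∘ₗ i')).mkQ (i n) := LinearMap.congr_fun hj n
        rw [h1]
        exact (LinearMap.congr_fun hq (i n)).trans (hip.apply_apply_eq_zero n)
      · intro y
        obtain ⟨m, rfl⟩ := hp y
        exact ⟨_, LinearMap.congr_fun hq m⟩
    exact ⟨_, c :: l', _, _, hr, h'.cons' hses⟩

omit [IsArtinianRing S] in
lemma IsIndecomposableTilting.factorsLE {a : Λ} {U : ModuleCat.{u} S}
    (hU : D.IsIndecomposableTilting a U) : D.FactorsLE a U := by
  obtain ⟨-, -, l, hl, -, hlt⟩ := hU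
  refine ⟨l, hl, fun b hb ↦ ?_⟩
  by_cases h : b = a
  exacts [h.le, (hlt b hb h).le]

omit [IsArtinianRing S] in
lemma IsIndecomposableTilting.mult_eq_one (hf : D.IsFull) {a : Λ} {U : ModuleCat.{u} S}
    (hU : D.IsIndecomposableTilting a U) : D.mult a U = 1 := by
  obtain ⟨-, -, l, hl, hc, -⟩ := hU
  rw [mult_eq_count hf a hl, hc, Nat.cast_one]

omit [IsArtinianRing S] in
lemma IsIndecomposableTilting.occurs (hf : D.IsFull) {a : Λ} {U : ModuleCat.{u} S}
    (hU : D.IsIndecomposableTilting a U) : D.Occurs a U := by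
  by_contra h
  rw [← mult_eq_zero_iff, hU.mult_eq_one hf] at h
  exact one_ne_zero h

/-- If `M` has composition factors `≤ a` and `L a` is one of them, then it can only come from a
section `X a`. -/
lemma mem_of_occurs (hf : D.IsFull) {X : Λ → ModuleCat.{u} S} (hX : ∀ b, D.Occurs b (X b))
    (hX' : ∀ b, D.FactorsLE b (X b)) {a : Λ} {M : ModuleCat.{u} S} {l : List Λ}
    (h : HasFiltration X l M) (hM : D.FactorsLE a M) (ha : D.Occurs a M) : a ∈ l := by
  obtain ⟨c, hc, hac⟩ := ha.exists_of_hasFiltration h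
  have h1 := ((factorsLE_iff hf).1 (hX' c)).2 a hac
  have h2 := ((factorsLE_iff hf).1 hM).2 c (Occurs.of_mem h hc (hX c))
  rwa [le_antisymm h1 h2]

/-- If `L a` occurs only once in `M`, all other factors of `M` being `< a`, and it occurs in the
quotient `B`, then the sections of the kernel `A` have labels `< a`. -/
lemma forall_lt_of_mult_eq_one (hf : D.IsFull) {X : Λ → ModuleCat.{u} S}
    (hX : ∀ b, D.Occurs b (X b)) {a : Λ} {M A B : ModuleCat.{u} S} {l : List Λ}
    {i : A →ₗ[S] M} {p : M →ₗ[S] B} (hs : IsSES i p) (hM : D.FactorsLE a M)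
    (hone : D.mult a M = 1) (h : HasFiltration X l A) (hB : D.Occurs a B) : ∀ b ∈ l, b < a := by
  intro b hb
  have hbA : D.Occurs b A := Occurs.of_mem h hb (hX b)
  have hna : ¬ D.Occurs a A := by
    rw [← mult_eq_zero_iff]
    by_contra hA
    have h1 : 1 ≤ D.mult a A := Order.one_le_iff_pos.2 (pos_iff_ne_zero.2 hA)
    have h2 : 1 ≤ D.mult a B := Order.one_le_iff_pos.2 (pos_iff_ne_zero.2 fun h0 ↦
      mult_eq_zero_iff.1 h0 hB)
    have h3 := add_le_add h1 h2
    rw [← mult_ses a hs, hone] at h3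
    exact absurd h3 (by decide)
  refine lt_of_le_of_ne (((factorsLE_iff hf).1 hM).2 b (hbA.of_injective i hs.inj)) ?_
  rintro rfl
  exact hna hbA

variable (hD : D.IsQuasiHereditary) [EnoughFiniteInjectives S]
include hD

/-- `T(a)` maps onto `∇(a)` with a kernel filtered by `∇(b)`, `b < a`. -/
lemma IsIndecomposableTilting.exists_ses_Nabla {a : Λ} {U : ModuleCat.{u} S}
    (hU : D.IsIndecomposableTilting a U) :
    ∃ (K : ModuleCat.{u} S) (l : List Λ) (i : K →ₗ[S] U) (p : U →ₗ[S] D.Nabla a),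
      IsSES i p ∧ HasFiltration D.Nabla l K ∧ ∀ b ∈ l, b < a := by
  obtain ⟨l, hl⟩ := hU.1.2
  obtain ⟨K, l', i, p, hs, hK⟩ := D.exists_Nabla_top hD.full hl hU.factorsLE
    (mem_of_occurs hD.full (D.occurs_Nabla hD.full) (D.factorsLE_Nabla hD.full) hl hU.factorsLE
      (hU.occurs hD.full))
  exact ⟨K, l', i, p, hs, hK, forall_lt_of_mult_eq_one hD.full (D.occurs_Nabla hD.full) hs
    hU.factorsLE (hU.mult_eq_one hD.full) hK (D.occurs_Nabla hD.full a)⟩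

omit [EnoughFiniteInjectives S] in
/-- `Δ(a)` embeds in `T(a)` with a `Δ`-filtered cokernel. -/
lemma IsIndecomposableTilting.exists_ses_Delta {a : Λ} {U : ModuleCat.{u} S}
    (hU : D.IsIndecomposableTilting a U) :
    ∃ (Q : ModuleCat.{u} S) (i : D.Delta a →ₗ[S] U) (p : U →ₗ[S] Q),
      IsSES i p ∧ Filtered D.Delta Q := by
  obtain ⟨l, hl⟩ := hU.1.1
  obtain ⟨Q, l', i, p, hs, hQ⟩ := D.exists_Delta_bot hD.full hl hU.factorsLE
    (mem_of_occurs hD.full (D.occurs_Delta hD.full) (D.factorsLE_Delta hD.full) hl hU.factorsLE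
      (hU.occurs hD.full))
  exact ⟨Q, i, p, hs, l', hQ⟩

end Labelling

/-! ### Approximation by tilting modules -/

/-- `X` is a direct summand of a finite direct sum of modules `Z b`: the identity of `X` is a sum
of maps that factor through modules `Z b`. (With `Z` constantly `T` this is `add T`.) -/
def InAdd {S : Type u} [Ring S] {Λ : Type w} (Z : Λ → ModuleCat.{u} S)
    (X : ModuleCat.{u} S) : Prop :=
  ∃ (ι : Type) (_ : Fintype ι) (b : ι → Λ) (s : ∀ i, Z (b i) →ₗ[S] X) (r : ∀ i, X →ₗ[S] Z (b i)),
    ∀ x, ∑ i, s i (r i x) = x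

namespace InAdd

variable {S : Type u} [Ring S] {Λ : Type w} {Z : Λ → ModuleCat.{u} S} {X Y : ModuleCat.{u} S}

lemma of_retract_self (b : Λ) (s : Z b →ₗ[S] X) (r : X →ₗ[S] Z b) (h : ∀ x, s (r x) = x) :
    InAdd Z X := ⟨Unit, inferInstance, fun _ ↦ b, fun _ ↦ s, fun _ ↦ r, by simpa using h⟩

lemma of_retract (hX : InAdd Z X) (s : X →ₗ[S] Y) (r : Y →ₗ[S] X) (h : ∀ y, s (r y) = y) :
    InAdd Z Y := by
  obtain ⟨ι, hι, b, s', r', h'⟩ := hX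
  refine ⟨ι, hι, b, fun i ↦ s ∘ₗ s' i, fun i ↦ r' i ∘ₗ r, fun y ↦ ?_⟩
  change ∑ i, s (s' i (r' i (r y))) = y
  rw [← map_sum, h', h]

lemma of_subsingleton (h : Subsingleton X) : InAdd Z X :=
  ⟨Empty, inferInstance, Empty.elim, fun i ↦ i.elim, fun i ↦ i.elim, fun _ ↦ h.elim _ _⟩

lemma prod (hX : InAdd Z X) (b : Λ) : InAdd Z (ModuleCat.of S (X × Z b)) := by
  obtain ⟨ι, hι, c, s, r, h⟩ := hX
  refine ⟨ι ⊕ Unit, inferInstance, Sum.elim c fun _ ↦ b,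
    fun | .inl i => LinearMap.inl S X (Z b) ∘ₗ s i | .inr _ => LinearMap.inr S X (Z b),
    fun | .inl i => r i ∘ₗ LinearMap.fst S X (Z b) | .inr _ => LinearMap.snd S X (Z b),
    fun x ↦ (Fintype.sum_sum_type _).trans ?_⟩
  change ∑ i, LinearMap.inl S X (Z b) (s i (r i x.1)) +
    ∑ _ : Unit, LinearMap.inr S X (Z b) x.2 = x
  rw [← map_sum, h]
  ext <;> simp

end InAdd

namespace Labelling

variable {S : Type u} [Ring S] [IsArtinianRing S] {Λ : Type w} [PartialOrder Λ]
  {D : Labelling S Λ} (hD : D.IsQuasiHereditary) [EnoughFiniteInjectives S]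
include hD

/-- If each `Z a` is tilting and maps onto `∇(a)` with a `∇`-filtered kernel, then every
`∇`-filtered module is a quotient of a module in `add Z` by a `∇`-filtered submodule. -/
lemma exists_tilting_cover {Z : Λ → ModuleCat.{u} S} (hZ : ∀ a, D.IsTilting (Z a))
    (hN : ∀ a, ∃ (K : ModuleCat.{u} S) (i : K →ₗ[S] Z a) (p : Z a →ₗ[S] D.Nabla a),
      IsSES i p ∧ Filtered D.Nabla K) {M : ModuleCat.{u} S} (hM : Filtered D.Nabla M) :
    ∃ (K X : ModuleCat.{u} S) (i : K →ₗ[S] X) (p : X →ₗ[S] M),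
      IsSES i p ∧ InAdd Z X ∧ D.IsTilting X ∧ Filtered D.Nabla K := by
  obtain ⟨l, hl⟩ := hM
  induction hl with
  | nil M h =>
    refine ⟨M, M, LinearMap.id, 0, ⟨Function.injective_id, fun x ↦ ?_, fun x ↦ ⟨0, h.elim _ _⟩⟩,
      .of_subsingleton h, ⟨⟨[], .nil M h⟩, [], .nil M h⟩, [], .nil M h⟩
    exact ⟨fun _ ↦ ⟨x, rfl⟩, fun _ ↦ rfl⟩
  | cons a l N M i p hi hip hp h ih =>
    have hs : IsSES i p := ⟨hi, hip, hp⟩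
    obtain ⟨K, X, j, q, hjq, hX, hXt, hK⟩ := ih
    obtain ⟨Ka, ja, qa, hja, hKa⟩ := hN a
    obtain ⟨t, ht⟩ := hs.lift (D.extZero_of_filtered hD (hZ a).1 ⟨l, h⟩ 0) qa
    have hprod : IsSES (B := ModuleCat.of S (X × Z a)) (LinearMap.inl S X (Z a))
      (LinearMap.snd S X (Z a)) := ⟨LinearMap.inl_injective, .inl_snd, LinearMap.snd_surjective⟩
    have hXt' : D.IsTilting (ModuleCat.of S (X × Z a)) := by
      obtain ⟨⟨l₁, h₁⟩, l₂, h₂⟩ := hXt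
      obtain ⟨⟨l₃, h₃⟩, l₄, h₄⟩ := hZ a
      exact ⟨⟨_, h₁.append hprod h₃⟩, _, h₂.append hprod h₄⟩
    have hsurj : Function.Surjective ((i ∘ₗ q).coprod t) := by
      intro m
      obtain ⟨z, hz⟩ := hja.surj (p m)
      have h1 : p (t z) = qa z := LinearMap.congr_fun ht z
      obtain ⟨n, hn⟩ := (hip (m - t z)).1 (by rw [map_sub, h1, hz, sub_self])
      obtain ⟨x, rfl⟩ := hjq.surj n
      exact ⟨(x, z), by simp [hn]⟩
    have hses := IsSES.of_ker (M := ModuleCat.of S (X × Z a)) ((i ∘ₗ q).coprod t) hsurj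
    refine ⟨_, _, _, _, hses, hX.prod a, hXt', D.filtered_Nabla_of_extZero hD
      (hses.finite_left (D.finite_of_filtered_Delta hXt'.1)) fun c ↦ ?_⟩
    refine hses.extZero_one_of_lift
      (D.extZero_of_filtered hD (D.filtered_Delta_self c) hXt'.2 0) fun f ↦ ?_
    obtain ⟨g, hg⟩ := hja.lift (D.extZero_of_filtered hD (D.filtered_Delta_self c) hKa 0) (p ∘ₗ f)
    obtain ⟨f', hf'⟩ := hs.lift_of_comp_eq_zero (f - t ∘ₗ g) (by
      rw [LinearMap.comp_sub, ← LinearMap.comp_assoc, ht, hg, sub_self])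
    obtain ⟨g', rfl⟩ := hjq.lift (D.extZero_of_filtered hD (D.filtered_Delta_self c) hK 0) f'
    refine ⟨g'.prod g, ?_⟩
    rw [LinearMap.coprod_comp_prod, LinearMap.comp_assoc, hf', sub_add_cancel]

/-- If `Δ(a)` embeds in the tilting module `Z a` with a `Δ`-filtered cokernel for each `a`, then
every `Δ`-filtered module embeds in a module in `add Z` with a `Δ`-filtered cokernel. -/
lemma exists_tilting_hull {Z : Λ → ModuleCat.{u} S} (hZ : ∀ a, D.IsTilting (Z a))
    (hN : ∀ a, ∃ (Q : ModuleCat.{u} S) (i : D.Delta a →ₗ[S] Z a) (p : Z a →ₗ[S] Q),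
      IsSES i p ∧ Filtered D.Delta Q) {M : ModuleCat.{u} S} (hM : Filtered D.Delta M) :
    ∃ (X Q : ModuleCat.{u} S) (i : M →ₗ[S] X) (p : X →ₗ[S] Q),
      IsSES i p ∧ InAdd Z X ∧ D.IsTilting X ∧ Filtered D.Delta Q := by
  obtain ⟨l, hl⟩ := hM
  induction hl with
  | nil M h =>
    refine ⟨M, M, 0, LinearMap.id, ⟨fun x y _ ↦ h.elim _ _, fun x ↦ ?_, Function.surjective_id⟩,
      .of_subsingleton h, ⟨⟨[], .nil M h⟩, [], .nil M h⟩, [], .nil M h⟩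
    exact ⟨fun _ ↦ ⟨0, h.elim _ _⟩, fun _ ↦ h.elim _ _⟩
  | cons a l N M i p hi hip hp h ih =>
    have hs : IsSES i p := ⟨hi, hip, hp⟩
    obtain ⟨X, Q, j, q, hjq, hX, hXt, hQ⟩ := ih
    obtain ⟨Qa, ja, qa, hja, hQa⟩ := hN a
    obtain ⟨t, ht⟩ := hs.extend (D.extZero_of_filtered hD (D.filtered_Delta_self a) hXt.2 0) j
    have hprod : IsSES (B := ModuleCat.of S (X × Z a)) (LinearMap.inl S X (Z a))
      (LinearMap.snd S X (Z a)) := ⟨LinearMap.inl_injective, .inl_snd, LinearMap.snd_surjective⟩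
    have hXt' : D.IsTilting (ModuleCat.of S (X × Z a)) := by
      obtain ⟨⟨l₁, h₁⟩, l₂, h₂⟩ := hXt
      obtain ⟨⟨l₃, h₃⟩, l₄, h₄⟩ := hZ a
      exact ⟨⟨_, h₁.append hprod h₃⟩, _, h₂.append hprod h₄⟩
    have hinj : Function.Injective (t.prod (ja ∘ₗ p)) := by
      rw [← LinearMap.ker_eq_bot, eq_bot_iff]
      intro m hm
      have h1 : t m = 0 := congrArg Prod.fst hm
      have h2 : ja (p m) = 0 := congrArg Prod.snd hm
      obtain ⟨n, rfl⟩ := (hip m).1 (hja.inj (h2.trans (map_zero ja).symm))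
      have h3 : j n = 0 := (LinearMap.congr_fun ht n).symm.trans h1
      rw [hjq.inj (h3.trans (map_zero j).symm), map_zero]
      exact zero_mem _
    have hses := IsSES.of_range (N := ModuleCat.of S (X × Z a)) (t.prod (ja ∘ₗ p)) hinj
    refine ⟨_, _, _, _, hses, hX.prod a, hXt', D.filtered_Delta_of_extZero hD
      (hses.finite_right (D.finite_of_filtered_Delta hXt'.1)) fun c ↦ ?_⟩
    refine hses.extZero_one_of_extend
      (D.extZero_of_filtered hD hXt'.1 (D.filtered_Nabla_self c) 0) fun f ↦ ?_
    obtain ⟨g, hg⟩ := hjq.extend (D.extZero_of_filtered hD hQ (D.filtered_Nabla_self c) 0) (f ∘ₗ i)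
    obtain ⟨f', hf'⟩ := hs.desc (f - g ∘ₗ t) (by
      rw [LinearMap.sub_comp, LinearMap.comp_assoc, ht, hg, sub_self])
    obtain ⟨g', rfl⟩ :=
      hja.extend (D.extZero_of_filtered hD hQa (D.filtered_Nabla_self c) 0) f'
    refine ⟨g.coprod g', ?_⟩
    rw [LinearMap.coprod_comp_prod, ← LinearMap.comp_assoc, hf', add_sub_cancel]

variable {U : Λ → ModuleCat.{u} S} {T : ModuleCat.{u} S}

/-- The `∇`-filtered modules have covers in `add T`, for a full tilting module `T`. -/
lemma exists_cover_of_isFullTilting (hU : ∀ a, D.IsIndecomposableTilting a (U a))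
    (hT : D.IsFullTilting U T) {M : ModuleCat.{u} S} (hM : Filtered D.Nabla M) :
    ∃ (K X : ModuleCat.{u} S) (i : K →ₗ[S] X) (p : X →ₗ[S] M),
      IsSES i p ∧ InAdd (fun _ : Λ ↦ T) X ∧ D.IsTilting X ∧ Filtered D.Nabla K := by
  refine D.exists_tilting_cover hD (fun _ ↦ hT.1) (fun a ↦ ?_) hM
  obtain ⟨K, l, i, p, hs, hK, -⟩ := (hU a).exists_ses_Nabla hD
  obtain ⟨N, N', hN, ⟨e⟩⟩ := hT.2 a
  have hr : Function.Surjective (N.projectionOnto N' hN) :=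
    LinearMap.range_eq_top.1 (Submodule.range_projectionOnto hN)
  have hsurj : Function.Surjective (p ∘ₗ e.toLinearMap ∘ₗ N.projectionOnto N' hN) :=
    hs.surj.comp (e.surjective.comp hr)
  have hses := IsSES.of_ker (M := T) (p ∘ₗ e.toLinearMap ∘ₗ N.projectionOnto N' hN) hsurj
  refine ⟨_, _, _, hses, D.filtered_Nabla_of_extZero hD
    (hses.finite_left (D.finite_of_filtered_Delta hT.1.1)) fun c ↦ ?_⟩
  refine hses.extZero_one_of_lift
    (D.extZero_of_filtered hD (D.filtered_Delta_self c) hT.1.2 0) fun f ↦ ?_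
  obtain ⟨g, rfl⟩ :=
    hs.lift (D.extZero_of_filtered hD (D.filtered_Delta_self c) ⟨l, hK⟩ 0) f
  refine ⟨N.subtype ∘ₗ e.symm.toLinearMap ∘ₗ g, ?_⟩
  ext x
  simp

/-- The `Δ`-filtered modules have hulls in `add T`, for a full tilting module `T`. -/
lemma exists_hull_of_isFullTilting (hU : ∀ a, D.IsIndecomposableTilting a (U a))
    (hT : D.IsFullTilting U T) {M : ModuleCat.{u} S} (hM : Filtered D.Delta M) :
    ∃ (X Q : ModuleCat.{u} S) (i : M →ₗ[S] X) (p : X →ₗ[S] Q),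
      IsSES i p ∧ InAdd (fun _ : Λ ↦ T) X ∧ D.IsTilting X ∧ Filtered D.Delta Q := by
  refine D.exists_tilting_hull hD (fun _ ↦ hT.1) (fun a ↦ ?_) hM
  obtain ⟨Q, i, p, hs, hQ⟩ := (hU a).exists_ses_Delta hD
  obtain ⟨N, N', hN, ⟨e⟩⟩ := hT.2 a
  have hses := IsSES.of_range (N := T) (N.subtype ∘ₗ e.symm.toLinearMap ∘ₗ i)
    (N.subtype_injective.comp (e.symm.injective.comp hs.inj))
  refine ⟨_, _, _, hses, D.filtered_Delta_of_extZero hD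
    (hses.finite_right (D.finite_of_filtered_Delta hT.1.1)) fun c ↦ ?_⟩
  refine hses.extZero_one_of_extend
    (D.extZero_of_filtered hD hT.1.1 (D.filtered_Nabla_self c) 0) fun f ↦ ?_
  obtain ⟨g, rfl⟩ := hs.extend (D.extZero_of_filtered hD hQ (D.filtered_Nabla_self c) 0) f
  refine ⟨g ∘ₗ e.toLinearMap ∘ₗ N.projectionOnto N' hN, ?_⟩
  ext x
  simp

/-- A tilting module lies in `add U`. -/
lemma inAdd_of_isTilting (hU : ∀ a, D.IsIndecomposableTilting a (U a))
    (hT : D.IsTilting T) : InAdd U T := by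
  obtain ⟨K, X, i, p, hs, hX, -, hK⟩ := D.exists_tilting_cover hD (fun a ↦ (hU a).1) (fun a ↦ by
    obtain ⟨K, l, i, p, hs, hK, -⟩ := (hU a).exists_ses_Nabla hD
    exact ⟨K, i, p, hs, l, hK⟩) hT.2
  obtain ⟨s, hs'⟩ := hs.exists_section (D.extZero_of_filtered hD hT.1 hK 0)
  exact hX.of_retract p s (LinearMap.congr_fun hs')

omit hD [IsArtinianRing S] [EnoughFiniteInjectives S] in
lemma IsFullTilting.inAdd (hT : D.IsFullTilting U T) (a : Λ) : InAdd (fun _ : Λ ↦ T) (U a) := by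
  obtain ⟨N, N', hN, ⟨e⟩⟩ := hT.2 a
  refine .of_retract_self a (e.toLinearMap ∘ₗ N.projectionOnto N' hN)
    (N.subtype ∘ₗ e.symm.toLinearMap) fun x ↦ ?_
  simp

end Labelling

/-! ### The functor `Hom(T, -)` on modules covered by `add T` -/

section FullyFaithful

variable {S : Type u} [Ring S] {Λ : Type w} {T X M N : ModuleCat.{u} S}

/-- `Hom(T, -)` takes `add T` to projective modules. -/
lemma InAdd.projective_F (hX : InAdd (fun _ : Λ ↦ T) X) :
    Module.Projective (RingelDual T) (F T X) := by
  obtain ⟨ι, hι, b, s, r, h⟩ := hX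
  let i : F T X →ₗ[RingelDual T] (ι → RingelDual T) :=
    { toFun := fun f j ↦ MulOpposite.op ((r j).comp f : T →ₗ[S] T)
      map_add' := fun f g ↦ funext fun j ↦
        congrArg MulOpposite.op (LinearMap.comp_add (M := T) _ _ (r j))
      map_smul' := fun _ _ ↦ rfl }
  let s' : ι → F T X := s
  refine Module.Projective.of_split i (Fintype.linearCombination (RingelDual T) s') ?_
  ext f : 1
  change ∑ j, i f j • s' j = f
  refine LinearMap.ext (f := (∑ j, i f j • s' j : T →ₗ[S] X)) (g := f) fun x ↦ ?_
  have := LinearMap.sum_apply (M := T) (M₂ := X) Finset.univ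
    (fun j ↦ (i f j • s' j : T →ₗ[S] X)) x
  exact this.trans (h ((show T →ₗ[S] X from f) x))

/-- `Hom(T, -)` is faithful on modules generated by `T`. -/
lemma F.map_injective {p : X →ₗ[S] M} (hp : Function.Surjective p)
    (hX : InAdd (fun _ : Λ ↦ T) X) {f g : M →ₗ[S] N} (h : F.map T f = F.map T g) : f = g := by
  obtain ⟨ι, hι, b, s, r, hsr⟩ := hX
  ext y
  obtain ⟨x, rfl⟩ := hp y
  rw [← hsr x, map_sum, map_sum, map_sum]
  refine Finset.sum_congr rfl fun j _ ↦ ?_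
  exact LinearMap.congr_fun (LinearMap.congr_fun h (p ∘ₗ s j)) (r j x)

/-- `Hom(T, -)` is full on modules with a presentation by modules in `add T` that stays exact
under `Hom(T, -)`. -/
lemma F.exists_map_eq {K Y : ModuleCat.{u} S} {i : K →ₗ[S] X} {p : X →ₗ[S] M} (hs : IsSES i p)
    (hX : InAdd (fun _ : Λ ↦ T) X) {q : Y →ₗ[S] K} (hq : Function.Surjective q)
    (hY : InAdd (fun _ : Λ ↦ T) Y) (hp : ∀ f : T →ₗ[S] M, ∃ g : T →ₗ[S] X, p ∘ₗ g = f)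
    (φ : F T M →ₗ[RingelDual T] F T N) : ∃ f : M →ₗ[S] N, F.map T f = φ := by
  obtain ⟨ι, hι, -, s, r, hsr⟩ : ∃ (ι : Type) (_ : Fintype ι) (_ : ι → Λ) (s : ι → (T →ₗ[S] X))
    (r : ι → (X →ₗ[S] T)), ∀ x, ∑ i, s i (r i x) = x := hX
  obtain ⟨κ, hκ, -, s', r', hsr'⟩ : ∃ (ι : Type) (_ : Fintype ι) (_ : ι → Λ)
    (s : ι → (T →ₗ[S] Y)) (r : ι → (Y →ₗ[S] T)), ∀ x, ∑ i, s i (r i x) = x := hY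
  let φ' : (T →ₗ[S] M) → (T →ₗ[S] N) := fun f ↦ φ f
  have hφ_comp : ∀ (f : T →ₗ[S] M) (e : T →ₗ[S] T), φ' (f ∘ₗ e) = φ' f ∘ₗ e :=
    fun f e ↦ φ.map_smul (MulOpposite.op e) f
  have hφ_sum : ∀ f : ι → (T →ₗ[S] M), φ' (∑ j, f j) = ∑ j, φ' (f j) := fun f ↦ map_sum φ f _
  -- `φ` is induced on `X` by a map `g`, which vanishes on the kernel of `p`
  let g : X →ₗ[S] N := ∑ j, φ' (p ∘ₗ s j) ∘ₗ r j
  have hg : ∀ h : T →ₗ[S] X, g ∘ₗ h = φ' (p ∘ₗ h) := by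
    intro h
    have h1 : p ∘ₗ h = ∑ j, (p ∘ₗ s j) ∘ₗ (r j ∘ₗ h) := by
      ext x
      rw [LinearMap.sum_apply, LinearMap.comp_apply, ← hsr (h x), map_sum]
      simp
    rw [h1, hφ_sum]
    ext x
    rw [LinearMap.comp_apply, LinearMap.sum_apply, LinearMap.sum_apply]
    exact Finset.sum_congr rfl fun j _ ↦
      (LinearMap.congr_fun (hφ_comp (p ∘ₗ s j) (r j ∘ₗ h)) x).symm
  obtain ⟨f, hf⟩ := hs.desc g (by
    ext y
    obtain ⟨x, rfl⟩ := hq y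
    rw [← hsr' x, map_sum, map_sum]
    refine Finset.sum_eq_zero fun j _ ↦ ?_
    have h1 := hg (i ∘ₗ q ∘ₗ s' j)
    rw [← LinearMap.comp_assoc (q ∘ₗ s' j) i p, hs.comp_eq_zero, LinearMap.zero_comp,
      show φ' 0 = 0 from _root_.map_zero φ] at h1
    exact LinearMap.congr_fun h1 (r' j x))
  refine ⟨f, ?_⟩
  ext h : 1
  obtain ⟨h', rfl⟩ := hp h
  change f ∘ₗ p ∘ₗ h' = φ' (p ∘ₗ h')
  rw [← LinearMap.comp_assoc, hf, hg]

end FullyFaithful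

/-- An endomorphism of an indecomposable module of finite length is nilpotent or bijective. -/
lemma bijective_or_pow_eq_zero {S : Type u} [Ring S] [IsArtinianRing S] {U : ModuleCat.{u} S}
    (hU : Indecomposable U) (hf : Module.Finite S U) (φ : U →ₗ[S] U) :
    Function.Bijective φ ∨ ∃ n, (show Module.End S U from φ) ^ n = 0 := by
  let ψ : Module.End S U := φ
  obtain ⟨n, hn⟩ := ((LinearMap.eventually_isCompl_ker_pow_range_pow ψ).and
    (Filter.eventually_ge_atTop 1)).exists
  have e : U ≅ ModuleCat.of S (LinearMap.ker (ψ ^ n)) ⊞ ModuleCat.of S (LinearMap.range (ψ ^ n)) :=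
    (LinearEquiv.toModuleIso (Submodule.prodEquivOfIsCompl _ _ hn.1)).symm ≪≫
      (ModuleCat.biprodIsoProd (ModuleCat.of S (LinearMap.ker (ψ ^ n)))
        (ModuleCat.of S (LinearMap.range (ψ ^ n)))).symm
  rcases hU.2 _ _ e with h | h
  · left
    have hs := ModuleCat.subsingleton_of_isZero h
    have h0 : LinearMap.ker (ψ ^ n) = ⊥ := Submodule.subsingleton_iff_eq_bot.1 hs
    refine IsArtinian.bijective_of_injective_endomorphism φ (LinearMap.ker_eq_bot.1 ?_)
    rw [eq_bot_iff, ← h0]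
    intro x hx
    obtain ⟨m, rfl⟩ := Nat.exists_eq_add_of_le' hn.2
    rw [LinearMap.mem_ker, pow_succ, Module.End.mul_apply, show ψ x = 0 from hx, map_zero]
  · right
    have hs := ModuleCat.subsingleton_of_isZero h
    exact ⟨n, LinearMap.range_eq_bot.1 (Submodule.subsingleton_iff_eq_bot.1 hs)⟩

/-- Projective covers are unique. -/
lemma IsProjectiveCover.nonempty_equiv {S : Type u} [Ring S] {P Q M : ModuleCat.{u} S}
    {p : P →ₗ[S] M} {q : Q →ₗ[S] M} (hp : IsProjectiveCover p) (hq : IsProjectiveCover q) :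
    Nonempty (P ≃ₗ[S] Q) := by
  obtain ⟨hP, hps, hpk⟩ := hp
  obtain ⟨hQ, hqs, hqk⟩ := hq
  -- a map between two covers of `M` is onto
  have key : ∀ {P Q : ModuleCat.{u} S} {p : P →ₗ[S] M} {q : Q →ₗ[S] M}, Function.Surjective p →
      (∀ N : Submodule S Q, N ⊔ LinearMap.ker q = ⊤ → N = ⊤) →
      ∀ g : P →ₗ[S] Q, q ∘ₗ g = p → Function.Surjective g := by
    intro P Q p q hp hk g hg
    refine LinearMap.range_eq_top.1 (hk _ (eq_top_iff.2 fun y _ ↦ ?_))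
    obtain ⟨x, hx⟩ := hp (q y)
    refine Submodule.mem_sup.2 ⟨g x, ⟨x, rfl⟩, y - g x, ?_, by abel⟩
    rw [LinearMap.mem_ker, map_sub, ← hx, ← hg]
    exact sub_self _
  obtain ⟨g, hg⟩ := Module.projective_lifting_property q p hqs
  have hgs := key hps hqk g hg
  obtain ⟨s, hs⟩ := Module.projective_lifting_property g LinearMap.id hgs
  have hss := key hqs hpk s (by rw [← hg, LinearMap.comp_assoc, hs, LinearMap.comp_id])
  refine ⟨LinearEquiv.ofBijective g ⟨fun x y hxy ↦ ?_, hgs⟩⟩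
  obtain ⟨x, rfl⟩ := hss x
  obtain ⟨y, rfl⟩ := hss y
  have h1 : ∀ z, g (s z) = z := LinearMap.congr_fun hs
  rw [h1, h1] at hxy
  rw [hxy]

namespace Labelling

variable {S : Type u} [Ring S] [IsArtinianRing S] [EnoughFiniteInjectives S]
  {Λ : Type w} [PartialOrder Λ] {D : Labelling S Λ} (hD : D.IsQuasiHereditary)
  {U : Λ → ModuleCat.{u} S} (hU : ∀ a, D.IsIndecomposableTilting a (U a))
  {T : ModuleCat.{u} S} (hT : D.IsFullTilting U T)

include hD hU hT

lemma F_map_injective {M N : ModuleCat.{u} S} (hM : Filtered D.Nabla M) {f g : M →ₗ[S] N}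
    (h : F.map T f = F.map T g) : f = g := by
  obtain ⟨K, X, i, p, hs, hX, -, -⟩ := D.exists_cover_of_isFullTilting hD hU hT hM
  exact F.map_injective hs.surj hX h

lemma exists_F_map_eq {M N : ModuleCat.{u} S} (hM : Filtered D.Nabla M)
    (φ : F T M →ₗ[RingelDual T] F T N) : ∃ f : M →ₗ[S] N, F.map T f = φ := by
  obtain ⟨K, X, i, p, hs, hX, -, hK⟩ := D.exists_cover_of_isFullTilting hD hU hT hM
  obtain ⟨K', Y, j, q, hq, hY, -, -⟩ := D.exists_cover_of_isFullTilting hD hU hT hK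
  exact F.exists_map_eq hs hX hq.surj hY
    (fun f ↦ hs.lift (D.extZero_of_filtered hD hT.1.1 hK 0) f) φ

/-- `Hom(T, -)` preserves and reflects the vanishing of Ext groups between `∇`-filtered
modules. -/
lemma extZero_F_iff (n : ℕ) {M N : ModuleCat.{u} S} (hM : Filtered D.Nabla M)
    (hN : Filtered D.Nabla N) :
    ExtZero (n + 1) (F T M) (F T N) ↔ ExtZero (n + 1) M N := by
  induction n generalizing M with
  | zero =>
    obtain ⟨K, X, i, p, hs, hX, hXt, hK⟩ := D.exists_cover_of_isFullTilting hD hU hT hM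
    have hFs := hs.map_F (D.extZero_of_filtered hD hT.1.1 hK 0)
    constructor
    · intro h
      refine hs.extZero_one_of_extend (D.extZero_of_filtered hD hXt.1 hN 0) fun f ↦ ?_
      obtain ⟨g, hg⟩ := hFs.extend h (F.map T f)
      obtain ⟨g, rfl⟩ := D.exists_F_map_eq hD hU hT hXt.2 g
      exact ⟨g, D.F_map_injective hD hU hT hK hg⟩
    · intro h
      refine hFs.extZero_one_of_extend (extZero_of_projective hX.projective_F 0 _) fun f ↦ ?_
      obtain ⟨f, rfl⟩ := D.exists_F_map_eq hD hU hT hK f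
      obtain ⟨g, rfl⟩ := hs.extend h f
      exact ⟨F.map T g, rfl⟩
  | succ n ih =>
    obtain ⟨K, X, i, p, hs, hX, hXt, hK⟩ := D.exists_cover_of_isFullTilting hD hU hT hM
    have hFs := hs.map_F (D.extZero_of_filtered hD hT.1.1 hK 0)
    have h1 := fun n ↦ D.extZero_of_filtered hD hXt.1 hN n
    have h2 := fun n ↦ extZero_of_projective hX.projective_F n (F T N)
    constructor
    · intro h
      exact hs.extZero_quot ((ih hK).1 (hFs.extZero_ker (h2 _) h)) (h1 _)
    · intro h
      exact hFs.extZero_quot ((ih hK).2 (hs.extZero_ker (h1 _) h)) (h2 _)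

/-! ### The Ringel dual is quasi-hereditary -/

variable {E : Labelling (RingelDual T) Λᵒᵈ}
  (hE : ∀ a : Λ, ∃ f : F T (U a) →ₗ[RingelDual T] E.L (OrderDual.toDual a), Function.Surjective f)
include hE

/-- `Hom(T, T(a))` is a projective cover of `L'(a)`. -/
lemma exists_isProjectiveCover_F (a : Λ) :
    ∃ f : F T (U a) →ₗ[RingelDual T] E.L (OrderDual.toDual a), IsProjectiveCover f := by
  obtain ⟨f, hf⟩ := hE a
  have hproj := (hT.inAdd a).projective_F
  refine ⟨f, hproj, hf, fun N hN ↦ ?_⟩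
  have hsurj : Function.Surjective (f ∘ₗ N.subtype) := by
    intro y
    obtain ⟨x, rfl⟩ := hf y
    obtain ⟨n, hn, z, hz, rfl⟩ := Submodule.mem_sup.1 (show x ∈ N ⊔ LinearMap.ker f by
      rw [hN]; trivial)
    exact ⟨⟨n, hn⟩, by rw [map_add, LinearMap.mem_ker.1 hz, add_zero]; rfl⟩
  obtain ⟨θ, hθ⟩ := Module.projective_lifting_property (f ∘ₗ N.subtype) f hsurj
  obtain ⟨φ, hφ⟩ := D.exists_F_map_eq hD hU hT (hU a).1.2 (N.subtype ∘ₗ θ)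
  -- `φ` is nilpotent or bijective; it lifts the identity of the head `L'(a)`, so it is bijective
  rcases bijective_or_pow_eq_zero (hU a).2.1 (D.finite_of_filtered_Delta (hU a).1.1) φ with
    hb | ⟨n, hn⟩
  · rw [eq_top_iff]
    intro x _
    obtain ⟨y, hy⟩ : ∃ y : T →ₗ[S] U a, φ ∘ₗ y = x :=
      ⟨(LinearEquiv.ofBijective φ hb).symm.toLinearMap ∘ₗ (x : T →ₗ[S] U a), by
        ext z
        exact (LinearEquiv.ofBijective φ hb).apply_symm_apply _⟩
    have := LinearMap.congr_fun hφ y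
    rw [F.map_apply, hy] at this
    rw [this]
    exact (θ y).2
  · exfalso
    have hfφ : f ∘ₗ F.map T φ = f := by rw [hφ, ← LinearMap.comp_assoc, hθ]
    have hpow : ∀ m : ℕ, f ∘ₗ F.map T ((show Module.End S (U a) from φ) ^ m) = f := by
      intro m
      induction m with
      | zero => rfl
      | succ m ih => rw [pow_succ', Module.End.mul_eq_comp, F.map_comp, ← LinearMap.comp_assoc,
          hfφ, ih]
    have h0 := hpow n
    rw [hn, F.map_zero, LinearMap.comp_zero] at h0
    have := (E.isSimple (OrderDual.toDual a)).nontrivial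
    exact ne_zero_of_surjective this hf h0.symm

lemma nonempty_P_equiv_F (a : Λ) :
    Nonempty (E.P (OrderDual.toDual a) ≃ₗ[RingelDual T] F T (U a)) := by
  obtain ⟨f, hf⟩ := D.exists_isProjectiveCover_F hD hU hT hE a
  exact (E.isCover _).nonempty_equiv hf

end Labelling

namespace Labelling

variable {S : Type u} [Ring S] [IsArtinianRing S] [EnoughFiniteInjectives S]
  {Λ : Type w} [PartialOrder Λ] {D : Labelling S Λ} (hD : D.IsQuasiHereditary)
  {U : Λ → ModuleCat.{u} S} (hU : ∀ a, D.IsIndecomposableTilting a (U a))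
  {T : ModuleCat.{u} S} (hT : D.IsFullTilting U T)
  {E : Labelling (RingelDual T) Λᵒᵈ}
  (hE : ∀ a : Λ, ∃ f : F T (U a) →ₗ[RingelDual T] E.L (OrderDual.toDual a), Function.Surjective f)
include hD hU hT hE

/-- A composition factor `L'(a)` of `Hom(T, M)` gives a nonzero map `T(a) → M`. -/
lemma exists_ne_zero_of_occurs_F {a : Λ} {M : ModuleCat.{u} S}
    (h : E.Occurs (OrderDual.toDual a) (F T M)) : ∃ f : U a →ₗ[S] M, f ≠ 0 := by
  obtain ⟨f, hf⟩ := h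
  obtain ⟨e⟩ := D.nonempty_P_equiv_F hD hU hT hE a
  obtain ⟨g, hg⟩ := D.exists_F_map_eq hD hU hT (hU a).1.2 (f ∘ₗ e.symm.toLinearMap)
  refine ⟨g, ?_⟩
  rintro rfl
  refine hf (LinearMap.ext fun x ↦ ?_)
  have := LinearMap.congr_fun hg (e x)
  rw [F.map_zero, LinearMap.comp_apply] at this
  simpa using this.symm

/-- The simple modules of the Ringel dual are the heads of the modules `Hom(T, T(a))`. -/
lemma isFull_of_ringelDual : E.IsFull := by
  constructor
  · -- `a` is determined by `T(a)`, since `L a` is its largest composition factor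
    intro a b ⟨e⟩
    obtain ⟨ea⟩ := D.nonempty_P_equiv_F hD hU hT hE (OrderDual.ofDual a)
    obtain ⟨eb⟩ := D.nonempty_P_equiv_F hD hU hT hE (OrderDual.ofDual b)
    have hcov : IsProjectiveCover (e.toLinearMap ∘ₗ E.cover a) := by
      obtain ⟨h1, h2, h3⟩ := E.isCover a
      refine ⟨h1, e.surjective.comp h2, ?_⟩
      rwa [LinearMap.ker_comp_of_ker_eq_bot _ (LinearMap.ker_eq_bot.2 e.injective)]
    obtain ⟨e'⟩ := hcov.nonempty_equiv (E.isCover b)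
    let e₂ := ea.symm ≪≫ₗ e' ≪≫ₗ eb
    obtain ⟨f, hf⟩ := D.exists_F_map_eq hD hU hT (hU (OrderDual.ofDual a)).1.2 e₂.toLinearMap
    obtain ⟨g, hg⟩ := D.exists_F_map_eq hD hU hT (hU (OrderDual.ofDual b)).1.2 e₂.symm.toLinearMap
    have hfg : f ∘ₗ g = LinearMap.id := D.F_map_injective hD hU hT (hU _).1.2 (by
      rw [F.map_comp, F.map_id, hf, hg]; ext x : 1; simp)
    have hgf : g ∘ₗ f = LinearMap.id := D.F_map_injective hD hU hT (hU _).1.2 (by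
      rw [F.map_comp, F.map_id, hf, hg]; ext x : 1; simp)
    have hgi : Function.Injective g := Function.LeftInverse.injective (LinearMap.congr_fun hfg)
    have hfi : Function.Injective f := Function.LeftInverse.injective (LinearMap.congr_fun hgf)
    have h1 := ((factorsLE_iff hD.full).1 (hU (OrderDual.ofDual b)).factorsLE).2 _
      (((hU (OrderDual.ofDual a)).occurs hD.full).of_injective f hfi)
    have h2 := ((factorsLE_iff hD.full).1 (hU (OrderDual.ofDual a)).factorsLE).2 _
      (((hU (OrderDual.ofDual b)).occurs hD.full).of_injective g hgi)
    exact le_antisymm h2 h1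
  · -- a simple module is a quotient of `Hom(T, T)`, hence of some `Hom(T, T(b))`
    intro X hX
    obtain ⟨ι, hι, b, s, r, hsr⟩ := D.inAdd_of_isTilting hD hU hT.1
    have := hX.nontrivial
    obtain ⟨y, hy⟩ := exists_ne (0 : X)
    let φ : F T T →ₗ[RingelDual T] X :=
      { toFun := fun f ↦ (MulOpposite.op (show Module.End S T from f) : RingelDual T) • y
        map_add' := fun f g ↦ add_smul (MulOpposite.op (show Module.End S T from f))
          (MulOpposite.op (show Module.End S T from g)) y
        map_smul' := fun c f ↦ mul_smul c (MulOpposite.op (show Module.End S T from f)) y }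
    have hφ : φ (LinearMap.id : T →ₗ[S] T) = y := one_smul (RingelDual T) y
    have hex : ∃ j, φ ∘ₗ F.map T (s j) ≠ 0 := by
      by_contra! h0
      refine hy ?_
      have hid : (LinearMap.id : T →ₗ[S] T) = ∑ j, s j ∘ₗ r j := by
        ext x
        rw [LinearMap.sum_apply]
        exact (hsr x).symm
      have hsum : φ (∑ j, s j ∘ₗ r j : T →ₗ[S] T) = ∑ j, φ (s j ∘ₗ r j : T →ₗ[S] T) :=
        map_sum φ (fun j ↦ (s j ∘ₗ r j : T →ₗ[S] T)) Finset.univ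
      rw [← hφ, hid, hsum]
      exact Finset.sum_eq_zero fun j _ ↦ LinearMap.congr_fun (h0 j) (r j)
    obtain ⟨j, hj⟩ := hex
    obtain ⟨e⟩ := D.nonempty_P_equiv_F hD hU hT hE (b j)
    obtain ⟨e'⟩ := E.nonempty_equiv_of_hom_P hX ((φ ∘ₗ F.map T (s j)) ∘ₗ e.toLinearMap)
      (comp_ne_zero_of_surjective hj e.surjective)
    exact ⟨_, ⟨e'.symm⟩⟩

/-- If `K` has a filtration with sections `∇(c)`, then a map from `Hom(T, K)` to `Y` is zero as soon
as no `L'(c)` occurs in `Y`, since `Hom(T, ∇(c))` is a quotient of `P'(c)`. -/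
lemma hom_F_eq_zero {K : ModuleCat.{u} S} {l : List Λ} (hK : HasFiltration D.Nabla l K)
    {Y : ModuleCat.{u} (RingelDual T)} (hY : ∀ c ∈ l, ¬ E.Occurs (OrderDual.toDual c) Y)
    (f : F T K →ₗ[RingelDual T] Y) : f = 0 := by
  induction hK with
  | nil M h =>
    have : Subsingleton (F T M) := inferInstanceAs (Subsingleton (T →ₗ[S] M))
    exact Subsingleton.elim _ _
  | cons c l N M i p hi hip hp h ih =>
    have hs := (IsSES.mk hi hip hp).map_F (D.extZero_of_filtered hD hT.1.1 ⟨l, h⟩ 0)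
    obtain ⟨g, rfl⟩ := hs.desc f (ih (fun c hc ↦ hY c (List.mem_cons_of_mem _ hc)) _)
    by_contra hg
    have hg0 : g ≠ 0 := fun h0 ↦ hg (by rw [h0, LinearMap.zero_comp])
    obtain ⟨K, l', j, q, hq, hK, -⟩ := (hU c).exists_ses_Nabla hD
    obtain ⟨e⟩ := D.nonempty_P_equiv_F hD hU hT hE c
    have hqs := (hq.map_F (D.extZero_of_filtered hD hT.1.1 ⟨l', hK⟩ 0)).surj
    exact hY c List.mem_cons_self ⟨(g ∘ₗ F.map T q) ∘ₗ e.toLinearMap,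
      comp_ne_zero_of_surjective (comp_ne_zero_of_surjective hg0 hqs) e.surjective⟩

variable [IsArtinianRing (RingelDual T)]

/-- The composition factors `L'(b)` of `Hom(T, ∇(a))` satisfy `a ≤ b`, as `Hom(T(b), ∇(a)) ≠ 0`. -/
lemma factorsLE_F_Nabla (a : Λ) : E.FactorsLE (OrderDual.toDual a) (F T (D.Nabla a)) := by
  rw [factorsLE_iff (D.isFull_of_ringelDual hD hU hT hE)]
  obtain ⟨K, l, i, p, hs, hK, hlt⟩ := (hU a).exists_ses_Nabla hD
  obtain ⟨e⟩ := D.nonempty_P_equiv_F hD hU hT hE a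
  have hFs := hs.map_F (D.extZero_of_filtered hD hT.1.1 ⟨l, hK⟩ 0)
  have := E.P_finite (OrderDual.toDual a)
  refine ⟨Module.Finite.of_surjective (F.map T p ∘ₗ e.toLinearMap)
    (hFs.surj.comp e.surjective), fun b hb ↦ ?_⟩
  obtain ⟨f, hf⟩ := D.exists_ne_zero_of_occurs_F hD hU hT hE (a := OrderDual.ofDual b) hb
  exact ((factorsLE_iff hD.full).1 (hU (OrderDual.ofDual b)).factorsLE).2 a
    (D.occurs_of_hom_Nabla hD.full hf)

/-- `Hom(T, ∇(a))` is the standard module `Δ'(a)`. -/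
lemma nonempty_Delta_equiv_F (a : Λ) :
    Nonempty (E.Delta (OrderDual.toDual a) ≃ₗ[RingelDual T] F T (D.Nabla a)) := by
  have hfull := D.isFull_of_ringelDual hD hU hT hE
  obtain ⟨K, l, i, p, hs, hK, hlt⟩ := (hU a).exists_ses_Nabla hD
  obtain ⟨e⟩ := D.nonempty_P_equiv_F hD hU hT hE a
  have hFs := hs.map_F (D.extZero_of_filtered hD hT.1.1 ⟨l, hK⟩ 0)
  obtain ⟨g, hg⟩ := E.Delta_desc hfull (D.factorsLE_F_Nabla hD hU hT hE a)
    (F.map T p ∘ₗ e.toLinearMap)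
  obtain ⟨h, hh⟩ := hFs.desc (E.toDelta (OrderDual.toDual a) ∘ₗ e.symm.toLinearMap) (by
    refine D.hom_F_eq_zero hD hU hT hE hK (fun c hc ho ↦ ?_) _
    have h1 : OrderDual.toDual c ≤ OrderDual.toDual a :=
      ((factorsLE_iff hfull).1 (E.factorsLE_Delta hfull _)).2 _ ho
    exact (hlt c hc).not_ge h1)
  have hgx : ∀ x, g (E.toDelta _ x) = F.map T p (e x) := LinearMap.congr_fun hg
  have hhx : ∀ x, h (F.map T p x) = E.toDelta _ (e.symm x) := LinearMap.congr_fun hh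
  refine ⟨LinearEquiv.ofLinearMap g h ?_ ?_⟩
  · ext y : 1
    obtain ⟨x, rfl⟩ := hFs.surj y
    rw [LinearMap.comp_apply, hhx, hgx, e.apply_symm_apply, LinearMap.id_apply]
  · ext y : 1
    obtain ⟨x, rfl⟩ := E.toDelta_surjective _ y
    rw [LinearMap.comp_apply, hgx, hhx, e.symm_apply_apply, LinearMap.id_apply]

omit hE [IsArtinianRing (RingelDual T)] in
/-- Every nonzero map `T(a) → ∇(a)` is onto on `Hom(T, -)`. -/
lemma surjective_F_map_of_ne_zero {a : Λ} {g : U a →ₗ[S] D.Nabla a} (hg : g ≠ 0) :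
    Function.Surjective (F.map T g) := by
  obtain ⟨K, l, i, p, hs, hK, hlt⟩ := (hU a).exists_ses_Nabla hD
  have hFs := hs.map_F (D.extZero_of_filtered hD hT.1.1 ⟨l, hK⟩ 0)
  obtain ⟨φ, rfl⟩ := hs.lift (D.extZero_of_filtered hD (hU a).1.1 ⟨l, hK⟩ 0) g
  rcases bijective_or_pow_eq_zero (hU a).2.1 (D.finite_of_filtered_Delta (hU a).1.1) φ with
    hb | ⟨n, hn⟩
  · have hφs : Function.Surjective (F.map T φ) := fun x ↦
      ⟨((LinearEquiv.ofBijective φ hb).symm.toLinearMap ∘ₗ (show T →ₗ[S] U a from x) :),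
        LinearMap.ext fun z ↦ (LinearEquiv.ofBijective φ hb).apply_symm_apply _⟩
    rw [F.map_comp]
    exact hFs.surj.comp hφs
  · exfalso
    -- `Hom(P a, T(a))` is simple over `End(P a)`, so the nilpotent `φ` acts on it by zero
    have hsimple : IsSimpleModule (RingelDual (D.P a)) (F (D.P a) (U a)) :=
      Module.length_eq_one_iff.1 ((hU a).mult_eq_one hD.full)
    have h0 : F.map (D.P a) φ = 0 := by
      refine (LinearMap.injective_or_eq_zero (F.map (D.P a) φ)).resolve_left fun hinj ↦ ?_
      have hpow : ∀ m : ℕ, Function.Injective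
          (F.map (D.P a) ((show Module.End S (U a) from φ) ^ m)) := by
        intro m
        induction m with
        | zero => exact fun _ _ h ↦ h
        | succ m ih =>
          rw [pow_succ', Module.End.mul_eq_comp, F.map_comp]
          exact hinj.comp ih
      obtain ⟨f, hf⟩ := (hU a).occurs hD.full
      have := hpow n
      rw [hn, F.map_zero] at this
      exact hf (this (a₁ := f) (a₂ := 0) rfl)
    have hr : D.Occurs a (ModuleCat.of S (LinearMap.range φ)) := by
      refine D.occurs_of_hom_Nabla hD.full (f := p ∘ₗ (LinearMap.range φ).subtype) fun h1 ↦ ?_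
      exact hg (LinearMap.ext fun x ↦ LinearMap.congr_fun h1 ⟨φ x, x, rfl⟩)
    obtain ⟨f, hf⟩ := hr
    obtain ⟨f, rfl⟩ := D.P_lift a (M := U a) φ.rangeRestrict φ.surjective_rangeRestrict f
    refine hf (LinearMap.ext fun x ↦ Subtype.ext ?_)
    exact LinearMap.congr_fun (LinearMap.congr_fun h0 f) x

/-- The Ringel dual is quasi-hereditary for the opposite order. -/
theorem isQuasiHereditary_ringelDual : E.IsQuasiHereditary := by
  have hfull := D.isFull_of_ringelDual hD hU hT hE
  refine ⟨hfull, fun a ↦ ?_, fun a ↦ ?_⟩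
  · have hs := IsSES.of_ker _ (E.deltaTop_surjective hfull a)
    obtain ⟨l, hl⟩ := exists_hasFiltration_L hfull (hs.finite_left (E.Delta_finite a))
    refine ⟨a :: l, hl.cons' hs, ?_⟩
    classical
    rw [List.count_cons_self, List.count_eq_zero.2, zero_add]
    -- a second factor `L'(a)` gives a nonzero map `T(a) → ∇(a)` that is not onto after `Hom(T, -)`
    intro hal
    obtain ⟨f, hf⟩ := Occurs.of_mem hl hal (E.occurs_L a)
    obtain ⟨e⟩ := D.nonempty_P_equiv_F hD hU hT hE (OrderDual.ofDual a)
    obtain ⟨e'⟩ := D.nonempty_Delta_equiv_F hD hU hT hE (OrderDual.ofDual a)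
    obtain ⟨g, hg⟩ := D.exists_F_map_eq hD hU hT (hU (OrderDual.ofDual a)).1.2
      (e'.toLinearMap ∘ₗ ((LinearMap.ker (E.deltaTop hfull a)).subtype ∘ₗ f) ∘ₗ
        e.symm.toLinearMap)
    have hne : F.map T g ≠ 0 := by
      rw [hg]
      refine comp_ne_zero_of_injective (comp_ne_zero_of_surjective (comp_ne_zero_of_injective hf
        (Submodule.subtype_injective _)) e.symm.surjective) e'.injective
    have hsurj := D.surjective_F_map_of_ne_zero hD hU hT (g := g) (by
      rintro rfl
      exact hne (F.map_zero _ _ _))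
    rw [hg] at hsurj
    have := (E.isSimple a).nontrivial
    obtain ⟨y, hy⟩ := exists_ne (0 : E.L a)
    obtain ⟨y, rfl⟩ := E.deltaTop_surjective hfull a y
    obtain ⟨x, hx⟩ := hsurj (e' y)
    have h1 := e'.injective hx
    refine hy ?_
    rw [← h1]
    exact (f (e.symm x)).2
  · obtain ⟨e⟩ := D.nonempty_P_equiv_F hD hU hT hE (OrderDual.ofDual a)
    obtain ⟨K, l, i, p, hs, hK, hlt⟩ := (hU (OrderDual.ofDual a)).exists_ses_Nabla hD
    have hFs := hs.map_F (D.extZero_of_filtered hD hT.1.1 ⟨l, hK⟩ 0)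
    have hfilt : ∀ {l : List Λ} {N : ModuleCat.{u} S}, HasFiltration D.Nabla l N →
        HasFiltration E.Delta (l.map OrderDual.toDual) (F T N) := by
      intro l N h
      induction h with
      | nil N h => exact .nil _ (inferInstanceAs (Subsingleton (T →ₗ[S] N)))
      | cons c l N M i p hi hip hp h ih =>
        obtain ⟨e⟩ := D.nonempty_Delta_equiv_F hD hU hT hE c
        exact ih.cons' (((IsSES.mk hi hip hp).map_F
          (D.extZero_of_filtered hD hT.1.1 ⟨l, h⟩ 0)).of_equiv_right e.symm)
    refine ⟨_, (hfilt (hK.cons' hs)).of_equiv e.symm, ?_, ?_⟩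
    · classical
      rw [List.map_cons, List.count_cons, List.count_eq_zero.2, zero_add]
      · simp
      · intro hal
        obtain ⟨b, hb, hba⟩ := List.mem_map.1 hal
        exact (hlt b hb).ne (congrArg OrderDual.ofDual hba)
    · intro b hb
      rw [List.map_cons, List.mem_cons] at hb
      rcases hb with rfl | hb
      · exact le_rfl
      · obtain ⟨c, hc, rfl⟩ := List.mem_map.1 hb
        exact (hlt c hc).le

end Labelling

/-! ### Finite-dimensional algebras have enough finite-dimensional injective modules -/

open scoped ModuleCat

section Coinduced

variable (k : Type u) [Field k] (S : Type u) [Ring S] [Algebra k S] (V : Type u) [AddCommGroup V]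
  [Module k V]

/-- The coinduced module `Hom_k(S, V)`, on which `S` acts by `(s • f) t = f (t * s)`. -/
def Coind : Type u := S →ₗ[k] V

instance : AddCommGroup (Coind k S V) := inferInstanceAs (AddCommGroup (S →ₗ[k] V))

instance : Module k (Coind k S V) := inferInstanceAs (Module k (S →ₗ[k] V))

instance : Module S (Coind k S V) where
  smul s f := LinearMap.comp (show S →ₗ[k] V from f) (LinearMap.mulRight k s)
  one_smul f := LinearMap.ext fun t ↦ congrArg (show S →ₗ[k] V from f) (mul_one t)
  mul_smul s s' f := LinearMap.ext fun t ↦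
    congrArg (show S →ₗ[k] V from f) (mul_assoc t s s').symm
  smul_zero _ := LinearMap.zero_comp _
  smul_add _ _ _ := LinearMap.add_comp _ _ _
  add_smul s s' f := LinearMap.ext fun t ↦
    (congrArg (show S →ₗ[k] V from f) (mul_add t s s')).trans (map_add (M := S) (N := V) _ _ _)
  zero_smul f := LinearMap.ext fun t ↦
    (congrArg (show S →ₗ[k] V from f) (mul_zero t)).trans (map_zero (M := S) (N := V) _)

instance : IsScalarTower k S (Coind k S V) where
  smul_assoc c s f := LinearMap.ext fun t ↦
    (congrArg (show S →ₗ[k] V from f) (mul_smul_comm c t s)).trans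
      (LinearMap.map_smul (show S →ₗ[k] V from f) _ _)

instance [Module.Finite k S] [Module.Finite k V] : Module.Finite S (Coind k S V) :=
  have : Module.Finite k (Coind k S V) := inferInstanceAs (Module.Finite k (S →ₗ[k] V))
  Module.Finite.of_restrictScalars_finite k S _

/-- Over a field, `k`-linear maps extend along injections of `S`-modules. -/
lemma exists_linearMap_extend {S : Type u} [Ring S] [Algebra k S] {Y Z : ModuleCat.{u} S}
    (i : Y →ₗ[S] Z) (hi : Function.Injective i) (μ : Y →ₗ[k] V) :
    ∃ μ' : Z →ₗ[k] V, ∀ y, μ' (i y) = μ y := by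
  obtain ⟨r, hr⟩ := LinearMap.exists_leftInverse_of_injective (i.restrictScalars k)
    (LinearMap.ker_eq_bot.2 hi)
  exact ⟨μ ∘ₗ r, fun y ↦ congrArg μ (LinearMap.congr_fun hr y)⟩

/-- Coinduced modules are injective: a map to `Hom_k(S, V)` is the same as a `k`-linear map to
`V`. -/
lemma Coind.injective : Module.Injective S (Coind k S V) := by
  suffices ∀ (Y Z : ModuleCat.{u} S) (i : Y →ₗ[S] Z) (_ : Function.Injective i)
      (φ : Y →ₗ[S] Coind k S V), ∃ ψ : Z →ₗ[S] Coind k S V, ∀ y, ψ (i y) = φ y from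
    ⟨fun Y Z _ _ _ _ i hi φ ↦ this (ModuleCat.of S Y) (ModuleCat.of S Z) i hi φ⟩
  intro Y Z i hi φ
  let φ' : Y → (S →ₗ[k] V) := φ
  have hφ : ∀ (s : S) (y : Y) (t : S), φ' (s • y) t = φ' y (t * s) := fun s y t ↦
    LinearMap.congr_fun (φ.map_smul s y) t
  obtain ⟨μ, hμ⟩ := exists_linearMap_extend k V i hi
    { toFun := fun y ↦ φ' y 1
      map_add' := fun y y' ↦ LinearMap.congr_fun (φ.map_add y y') (1 : S)
      map_smul' := fun c y ↦ by
        rw [← algebraMap_smul S c y, hφ, one_mul, Algebra.algebraMap_eq_smul_one, map_smul]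
        rfl }
  refine ⟨{ toFun := fun z ↦ ((μ ∘ₗ (LinearMap.toSpanSingleton S Z z).restrictScalars k :
              S →ₗ[k] V) : Coind k S V)
            map_add' := fun z z' ↦ LinearMap.ext fun t ↦
              (congrArg μ (smul_add t z z')).trans (map_add μ _ _)
            map_smul' := fun s z ↦ LinearMap.ext fun t ↦ congrArg μ (smul_smul t s z) }, ?_⟩
  intro y
  refine LinearMap.ext fun t ↦ ?_
  change μ (t • i y) = φ' y t
  rw [← map_smul, hμ]
  change φ' (t • y) 1 = φ' y t
  rw [hφ, one_mul]

end Coinduced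

lemma isArtinianRing_of_finiteDimensional (k : Type u) [Field k] (S : Type u) [Ring S]
    [Algebra k S] [Module.Finite k S] : IsArtinianRing S := IsArtinianRing.of_finite k S

lemma finite_of_finite_module (k : Type u) [Field k] {S : Type u} [Ring S] [Algebra k S]
    [Module.Finite k S] {M : ModuleCat.{u} S} (hM : Module.Finite S M) : Module.Finite k M :=
  Module.Finite.trans S M

/-- Every `M` embeds in `Hom_k(S, M)` by `m ↦ (s ↦ s • m)`. -/
lemma enoughFiniteInjectives_of_finiteDimensional (k : Type u) [Field k] (S : Type u) [Ring S]
    [Algebra k S] [Module.Finite k S] : EnoughFiniteInjectives S where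
  exists_embedding M hM := by
    have := finite_of_finite_module k hM
    refine ⟨ModuleCat.of S (Coind k S M), ?_, inferInstanceAs (Module.Finite S (Coind k S M)),
      Coind.injective k S M, ?_⟩
    · exact
        { toFun := fun m ↦ ((LinearMap.toSpanSingleton S M m).restrictScalars k : S →ₗ[k] M)
          map_add' := fun m m' ↦ LinearMap.ext fun t ↦ smul_add t m m'
          map_smul' := fun s m ↦ LinearMap.ext fun t ↦ smul_smul t s m }
    · intro m m' h
      have h1 : (1 : S) • m = (1 : S) • m' := LinearMap.congr_fun h (1 : S)
      rwa [one_smul, one_smul] at h1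

/-! ### The functor `D Hom(-, T)` -/

section DualHom

variable (k : Type u) [Field k] {S : Type u} [Ring S] [Algebra k S] (T N : ModuleCat.{u} S)

/-- The `k`-dual of `Hom(N, T)`, a left module over `End(T)ᵒᵖ`. -/
def DualHom : Type u := (N →ₗ[S] T) →ₗ[k] k

instance : AddCommGroup (DualHom k T N) := inferInstanceAs (AddCommGroup ((N →ₗ[S] T) →ₗ[k] k))

instance : Module k (DualHom k T N) := inferInstanceAs (Module k ((N →ₗ[S] T) →ₗ[k] k))

variable {T} in
/-- Composition with `e : T → T'`, as a `k`-linear map `Hom(N, T) → Hom(N, T')`. -/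
def postcomp {T' : ModuleCat.{u} S} (e : T →ₗ[S] T') : (N →ₗ[S] T) →ₗ[k] (N →ₗ[S] T') where
  toFun f := e ∘ₗ f
  map_add' f g := LinearMap.comp_add f g e
  map_smul' c f := LinearMap.ext fun x ↦ by
    change e (c • f x) = c • e (f x)
    rw [← algebraMap_smul S c, map_smul, algebraMap_smul]

instance : Module (RingelDual T) (DualHom k T N) where
  smul c l := LinearMap.comp (show (N →ₗ[S] T) →ₗ[k] k from l) (postcomp k N c.unop)
  one_smul _ := rfl
  mul_smul _ _ _ := rfl
  smul_zero _ := LinearMap.zero_comp _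
  smul_add _ _ _ := LinearMap.add_comp _ _ _
  add_smul c c' l := LinearMap.ext fun f ↦
    (congrArg (show (N →ₗ[S] T) →ₗ[k] k from l) (LinearMap.add_comp f c'.unop c.unop)).trans
      (map_add (M := N →ₗ[S] T) (N := k) _ _ _)
  zero_smul l := LinearMap.ext fun f ↦
    (congrArg (show (N →ₗ[S] T) →ₗ[k] k from l) (LinearMap.zero_comp f)).trans
      (map_zero (M := N →ₗ[S] T) (N := k) _)

instance : IsScalarTower k (RingelDual T) (DualHom k T N) where
  smul_assoc c s l := LinearMap.ext fun f ↦ by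
    change (show (N →ₗ[S] T) →ₗ[k] k from l) (c • (s.unop ∘ₗ f)) = _
    rw [map_smul]
    rfl

/-- `G N = D Hom_S(N, T)` as an `End_S(T)ᵒᵖ`-module. -/
def G : ModuleCat.{u} (RingelDual T) := ModuleCat.of (RingelDual T) (DualHom k T N)

variable {k T N}

/-- An element of `G N` as a functional on `Hom(N, T)`. -/
def G.eval (l : G k T N) : (N →ₗ[S] T) →ₗ[k] k := l

lemma G.ext {l l' : G k T N} (h : ∀ f, G.eval l f = G.eval l' f) : l = l' := LinearMap.ext h

lemma G.eval_smul (c : RingelDual T) (l : G k T N) (f : N →ₗ[S] T) :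
    G.eval (c • l) f = G.eval l (c.unop ∘ₗ f) := rfl

lemma G.eval_add (l l' : G k T N) (f : N →ₗ[S] T) :
    G.eval (l + l') f = G.eval l f + G.eval l' f := rfl

/-- Composition with `f : N → Q`, as a `k`-linear map `Hom(Q, T) → Hom(N, T)`. -/
def precomp (k : Type u) [Field k] [Algebra k S] {N Q : ModuleCat.{u} S} (T : ModuleCat.{u} S)
    (f : N →ₗ[S] Q) : (Q →ₗ[S] T) →ₗ[k] (N →ₗ[S] T) where
  toFun g := g ∘ₗ f
  map_add' _ _ := LinearMap.add_comp _ _ _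
  map_smul' _ _ := rfl

/-- The functor `G` on maps. -/
def G.map (k : Type u) [Field k] [Algebra k S] {N Q : ModuleCat.{u} S} (T : ModuleCat.{u} S)
    (f : N →ₗ[S] Q) : G k T N →ₗ[RingelDual T] G k T Q where
  toFun l := (G.eval l ∘ₗ precomp k T f : (Q →ₗ[S] T) →ₗ[k] k)
  map_add' _ _ := rfl
  map_smul' _ _ := rfl

lemma G.eval_map {N Q : ModuleCat.{u} S} (f : N →ₗ[S] Q) (l : G k T N) (g : Q →ₗ[S] T) :
    G.eval (G.map k T f l) g = G.eval l (g ∘ₗ f) := rfl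

lemma G.map_comp {N Q R : ModuleCat.{u} S} (g : Q →ₗ[S] R) (f : N →ₗ[S] Q) :
    G.map k T (g ∘ₗ f) = G.map k T g ∘ₗ G.map k T f := rfl

lemma G.map_id : G.map k T (LinearMap.id : N →ₗ[S] N) = LinearMap.id := rfl

/-- A functional that vanishes on the kernel of a surjection factors through it. -/
lemma exists_factor {V W : Type u} [AddCommGroup V] [AddCommGroup W] [Module k V] [Module k W]
    (q : V →ₗ[k] W) (hq : Function.Surjective q) (l : V →ₗ[k] k) (hl : ∀ x, q x = 0 → l x = 0) :
    ∃ m : W →ₗ[k] k, ∀ x, m (q x) = l x := by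
  obtain ⟨s, hs⟩ := LinearMap.exists_rightInverse_of_surjective q (LinearMap.range_eq_top.2 hq)
  refine ⟨l ∘ₗ s, fun x ↦ ?_⟩
  have h1 : q (s (q x) - x) = 0 := by
    rw [map_sub, sub_eq_zero]
    exact LinearMap.congr_fun hs (q x)
  have h2 := hl _ h1
  rwa [map_sub, sub_eq_zero] at h2

lemma exists_extend {V W : Type u} [AddCommGroup V] [AddCommGroup W] [Module k V] [Module k W]
    (i : V →ₗ[k] W) (hi : Function.Injective i) (l : V →ₗ[k] k) :
    ∃ m : W →ₗ[k] k, ∀ x, m (i x) = l x := by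
  obtain ⟨r, hr⟩ := LinearMap.exists_leftInverse_of_injective i (LinearMap.ker_eq_bot.2 hi)
  exact ⟨l ∘ₗ r, fun y ↦ congrArg l (LinearMap.congr_fun hr y)⟩

/-- `G` is exact on short exact sequences whose quotient `C` satisfies `Ext¹(C, T) = 0`. -/
lemma IsSES.map_G {A B C : ModuleCat.{u} S} {i : A →ₗ[S] B} {p : B →ₗ[S] C} (h : IsSES i p)
    (hT : ExtZero 1 C T) : IsSES (G.map k T i) (G.map k T p) where
  inj l l' hll' := G.ext fun f ↦ by
    obtain ⟨g, rfl⟩ := h.extend hT f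
    exact LinearMap.congr_fun hll' g
  exact l := by
    constructor
    · intro hl
      obtain ⟨m, hm⟩ := exists_factor (precomp k T i) (fun f ↦ h.extend hT f) (G.eval l)
        (fun f hf ↦ by
          obtain ⟨g, rfl⟩ := h.desc f hf
          exact LinearMap.congr_fun hl g)
      exact ⟨m, G.ext hm⟩
    · rintro ⟨m, rfl⟩
      refine G.ext fun f ↦ ?_
      rw [G.eval_map, G.eval_map, LinearMap.comp_assoc, h.comp_eq_zero, LinearMap.comp_zero,
        map_zero]
      rfl
  surj l := by
    obtain ⟨m, hm⟩ := exists_extend (precomp k T p)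
      (fun f g hfg ↦ (LinearMap.cancel_right h.surj).1 hfg) (G.eval l)
    exact ⟨m, G.ext hm⟩

section FiniteDimensional

variable [Module.Finite k S]

lemma finite_hom (hN : Module.Finite S N) (hT : Module.Finite S T) :
    Module.Finite k (N →ₗ[S] T) := by
  have := finite_of_finite_module k hN
  have := finite_of_finite_module k hT
  exact Module.Finite.of_injective (LinearMap.restrictScalarsₗ k S N T k)
    (LinearMap.restrictScalars_injective k)

lemma finite_ringelDual (hT : Module.Finite S T) : Module.Finite k (RingelDual T) :=
  have : Module.Finite k (Module.End S T) := finite_hom hT hT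
  Module.Finite.equiv (MulOpposite.opLinearEquiv k)

lemma finite_G (hN : Module.Finite S N) (hT : Module.Finite S T) :
    Module.Finite (RingelDual T) (G k T N) := by
  have := finite_hom (k := k) hN hT
  have : Module.Finite k (DualHom k T N) := inferInstanceAs (Module.Finite k ((N →ₗ[S] T) →ₗ[k] k))
  exact Module.Finite.of_restrictScalars_finite k (RingelDual T) (DualHom k T N)

end FiniteDimensional

end DualHom

/-! ### Full faithfulness of `D Hom(-, T)` on `Δ`-filtered modules -/

section FullyFaithful

variable {k : Type u} [Field k] {S : Type u} [Ring S] [Algebra k S] {Λ : Type w}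
  {T N Q X : ModuleCat.{u} S}

lemma G.eval_algebraMap_smul (c : k) (l : G k T N) (f : N →ₗ[S] T) :
    G.eval (algebraMap k (RingelDual T) c • l) f = c * G.eval l f := by
  rw [G.eval_smul, ← smul_eq_mul, ← map_smul]
  rfl

/-- `G` takes `add T` to injective modules. -/
lemma InAdd.injective_G (hX : InAdd (fun _ : Λ ↦ T) X) :
    Module.Injective (RingelDual T) (G k T X) := by
  suffices ∀ (Y Z : ModuleCat.{u} (RingelDual T)) (i : Y →ₗ[RingelDual T] Z)
      (_ : Function.Injective i) (φ : Y →ₗ[RingelDual T] G k T X),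
      ∃ ψ : Z →ₗ[RingelDual T] G k T X, ∀ y, ψ (i y) = φ y from
    ⟨fun Y Z _ _ _ _ i hi φ ↦
      this (ModuleCat.of (RingelDual T) Y) (ModuleCat.of (RingelDual T) Z) i hi φ⟩
  intro Y Z i hi φ
  obtain ⟨ι, hι, -, s, r, hsr⟩ : ∃ (ι : Type) (_ : Fintype ι) (_ : ι → Λ) (s : ι → (T →ₗ[S] X))
    (r : ι → (X →ₗ[S] T)), ∀ x, ∑ i, s i (r i x) = x := hX
  have hμ : ∀ j, ∃ μ : Z →ₗ[k] k, ∀ y, μ (i y) = G.eval (φ y) (r j) := fun j ↦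
    exists_linearMap_extend k k i hi
      { toFun := fun y ↦ G.eval (φ y) (r j)
        map_add' := fun y y' ↦ by rw [map_add, G.eval_add]
        map_smul' := fun c y ↦ by
          rw [← algebraMap_smul (RingelDual T) c y, map_smul, G.eval_algebraMap_smul]
          rfl }
  choose μ hμ using hμ
  -- the extension of `φ`, reconstructed from its values on the maps `r j`
  let ψ (z : Z) : (X →ₗ[S] T) →ₗ[k] k :=
    { toFun := fun h ↦ ∑ j, μ j ((MulOpposite.op (h ∘ₗ s j) : RingelDual T) • z)
      map_add' := fun h h' ↦ by
        rw [← Finset.sum_add_distrib]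
        refine Finset.sum_congr rfl fun j _ ↦ ?_
        rw [← map_add, ← add_smul, LinearMap.add_comp]
        rfl
      map_smul' := fun c h ↦ by
        rw [RingHom.id_apply, Finset.smul_sum]
        refine Finset.sum_congr rfl fun j _ ↦ ?_
        rw [← map_smul, ← algebraMap_smul (RingelDual T) c
          ((MulOpposite.op (h ∘ₗ s j) : RingelDual T) • z), ← mul_smul]
        congr 2
        refine MulOpposite.unop_injective (LinearMap.ext fun x ↦ ?_)
        change c • h (s j x) = h (s j (c • x))
        rw [← algebraMap_smul S c x, map_smul, map_smul, algebraMap_smul] }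
  refine ⟨{ toFun := fun z ↦ (show G k T X from ψ z)
            map_add' := fun z z' ↦ G.ext fun h ↦ ?_
            map_smul' := fun c z ↦ G.ext fun h ↦ ?_ }, fun y ↦ G.ext fun h ↦ ?_⟩
  · rw [G.eval_add]
    change ∑ j, μ j (_ • (z + z')) = ∑ j, μ j _ + ∑ j, μ j _
    rw [← Finset.sum_add_distrib]
    exact Finset.sum_congr rfl fun j _ ↦ by rw [← map_add, smul_add]
  · rw [RingHom.id_apply, G.eval_smul]
    change ∑ j, μ j (_ • c • z) = ∑ j, μ j (_ • z)
    exact Finset.sum_congr rfl fun j _ ↦ by rw [← mul_smul]; rfl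
  · change ∑ j, μ j ((MulOpposite.op (h ∘ₗ s j) : RingelDual T) • i y) = G.eval (φ y) h
    have h1 : h = ∑ j, (h ∘ₗ s j) ∘ₗ r j := by
      ext x
      rw [LinearMap.sum_apply]
      conv_lhs => rw [← hsr x, map_sum]
      rfl
    conv_rhs => rw [h1, map_sum]
    refine Finset.sum_congr rfl fun j _ ↦ ?_
    rw [← map_smul, hμ, map_smul, G.eval_smul]
    rfl

/-- Functionals separate the points of `Hom(N, T)`. -/
lemma G.eq_of_eval_eq {f g : N →ₗ[S] T} (h : ∀ l : G k T N, G.eval l f = G.eval l g) : f = g := by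
  rw [← sub_eq_zero, ← Module.forall_dual_apply_eq_zero_iff k]
  intro l
  rw [map_sub, sub_eq_zero]
  exact h l

/-- `G` is faithful on modules cogenerated by `T`. -/
lemma G.map_injective {i : Q →ₗ[S] X} (hi : Function.Injective i)
    (hX : InAdd (fun _ : Λ ↦ T) X) {f g : N →ₗ[S] Q} (h : G.map k T f = G.map k T g) : f = g := by
  obtain ⟨ι, hι, b, s, r, hsr⟩ := hX
  ext x
  refine hi ?_
  rw [← hsr (i (f x)), ← hsr (i (g x))]
  refine Finset.sum_congr rfl fun j _ ↦ ?_
  have : (r j ∘ₗ i) ∘ₗ f = (r j ∘ₗ i) ∘ₗ g := G.eq_of_eval_eq (k := k) fun l ↦ by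
    have := LinearMap.congr_fun h l
    exact congrArg (fun l ↦ G.eval l (r j ∘ₗ i)) this
  exact congrArg (s j) (LinearMap.congr_fun this x)

/-- `G` is full on modules with a copresentation by modules in `add T` that stays exact
under `Hom(-, T)`. -/
lemma G.exists_map_eq [Module.Finite k S] (hNf : Module.Finite S N) (hTf : Module.Finite S T)
    {Q' X' : ModuleCat.{u} S} {i : Q →ₗ[S] X} {p : X →ₗ[S] Q'} (hs : IsSES i p)
    (hX : InAdd (fun _ : Λ ↦ T) X) {q : Q' →ₗ[S] X'} (hq : Function.Injective q)
    (hX' : InAdd (fun _ : Λ ↦ T) X') (hp : ∀ f : Q →ₗ[S] T, ∃ g : X →ₗ[S] T, g ∘ₗ i = f)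
    (φ : G k T N →ₗ[RingelDual T] G k T Q) : ∃ f : N →ₗ[S] Q, G.map k T f = φ := by
  obtain ⟨ι, hι, -, s, r, hsr⟩ : ∃ (ι : Type) (_ : Fintype ι) (_ : ι → Λ) (s : ι → (T →ₗ[S] X))
    (r : ι → (X →ₗ[S] T)), ∀ x, ∑ i, s i (r i x) = x := hX
  obtain ⟨κ, hκ, -, s', r', hsr'⟩ : ∃ (ι : Type) (_ : Fintype ι) (_ : ι → Λ)
    (s : ι → (T →ₗ[S] X')) (r : ι → (X' →ₗ[S] T)), ∀ x, ∑ i, s i (r i x) = x := hX'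
  have := finite_hom (k := k) hNf hTf
  -- `φ` is the transpose of a map `ψ : Hom(Q, T) → Hom(N, T)`, by finite dimensionality
  have hψ : ∀ h : Q →ₗ[S] T, ∃ g : N →ₗ[S] T, ∀ l : G k T N, G.eval l g = G.eval (φ l) h := by
    intro h
    let α : Module.Dual k (Module.Dual k (N →ₗ[S] T)) :=
      { toFun := fun l ↦ G.eval (φ (show G k T N from l)) h
        map_add' := fun l l' ↦ congrArg (fun l ↦ G.eval l h) (φ.map_add l l')
        map_smul' := fun c l ↦ by
          have h1 : (show G k T N from (c • l :)) =
              algebraMap k (RingelDual T) c • (show G k T N from l) := G.ext fun f ↦ by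
            rw [G.eval_algebraMap_smul]
            rfl
          rw [h1, _root_.map_smul, G.eval_algebraMap_smul]
          rfl }
    refine ⟨(Module.evalEquiv k (N →ₗ[S] T)).symm α, fun l ↦ ?_⟩
    exact Module.apply_evalEquiv_symm_apply k _ l α
  choose ψ hψ using hψ
  have hψ_comp : ∀ (e : T →ₗ[S] T) (h : Q →ₗ[S] T), ψ (e ∘ₗ h) = e ∘ₗ ψ h := fun e h ↦
    G.eq_of_eval_eq (k := k) fun l ↦ by
      have h1 := hψ h ((MulOpposite.op e : RingelDual T) • l)
      rw [_root_.map_smul, G.eval_smul, G.eval_smul] at h1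
      exact (hψ _ l).trans h1.symm
  have hψ_sum : ∀ h : ι → (Q →ₗ[S] T), ψ (∑ j, h j) = ∑ j, ψ (h j) := fun h ↦
    G.eq_of_eval_eq (k := k) fun l ↦ by
      rw [hψ, _root_.map_sum, _root_.map_sum]
      exact Finset.sum_congr rfl fun j _ ↦ (hψ _ l).symm
  have hψ_zero : ψ 0 = 0 := G.eq_of_eval_eq (k := k) fun l ↦ by
    rw [hψ, _root_.map_zero, _root_.map_zero]
  -- `ψ` is composition with a map `g` to `X`, which is killed by `p`
  let g : N →ₗ[S] X := ∑ j, s j ∘ₗ ψ (r j ∘ₗ i)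
  have hg : ∀ h : X →ₗ[S] T, h ∘ₗ g = ψ (h ∘ₗ i) := by
    intro h
    have h1 : h ∘ₗ i = ∑ j, (h ∘ₗ s j) ∘ₗ (r j ∘ₗ i) := by
      ext x
      rw [LinearMap.sum_apply, LinearMap.comp_apply, ← hsr (i x), _root_.map_sum]
      simp
    rw [h1, hψ_sum]
    ext x
    rw [LinearMap.comp_apply, LinearMap.sum_apply, LinearMap.sum_apply, _root_.map_sum]
    exact Finset.sum_congr rfl fun j _ ↦
      (LinearMap.congr_fun (hψ_comp (h ∘ₗ s j) (r j ∘ₗ i)) x).symm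
  obtain ⟨f, hf⟩ := hs.lift_of_comp_eq_zero g (by
    ext x
    refine hq ?_
    rw [LinearMap.zero_apply, _root_.map_zero, ← hsr' (q _)]
    refine Finset.sum_eq_zero fun j _ ↦ ?_
    have h1 := hg (r' j ∘ₗ q ∘ₗ p)
    rw [LinearMap.comp_assoc, LinearMap.comp_assoc, LinearMap.comp_assoc, LinearMap.comp_assoc,
      hs.comp_eq_zero, LinearMap.comp_zero, LinearMap.comp_zero, hψ_zero] at h1
    exact (congrArg (s' j) (LinearMap.congr_fun h1 x)).trans (_root_.map_zero _))
  refine ⟨f, LinearMap.ext fun l ↦ G.ext fun h ↦ ?_⟩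
  obtain ⟨h', rfl⟩ := hp h
  rw [G.eval_map, LinearMap.comp_assoc, hf, hg, hψ]

end FullyFaithful

namespace Labelling

variable {k : Type u} [Field k] {S : Type u} [Ring S] [Algebra k S] [Module.Finite k S]
  [IsArtinianRing S] [EnoughFiniteInjectives S]
  {Λ : Type w} [PartialOrder Λ] {D : Labelling S Λ} (hD : D.IsQuasiHereditary)
  {U : Λ → ModuleCat.{u} S} (hU : ∀ a, D.IsIndecomposableTilting a (U a))
  {T : ModuleCat.{u} S} (hT : D.IsFullTilting U T)

include hD hU hT

omit [Module.Finite k S] in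
lemma G_map_injective {N Q : ModuleCat.{u} S} (hQ : Filtered D.Delta Q) {f g : N →ₗ[S] Q}
    (h : G.map k T f = G.map k T g) : f = g := by
  obtain ⟨X, Q', i, p, hs, hX, -, -⟩ := D.exists_hull_of_isFullTilting hD hU hT hQ
  exact G.map_injective hs.inj hX h

lemma exists_G_map_eq {N Q : ModuleCat.{u} S} (hN : Filtered D.Delta N)
    (hQ : Filtered D.Delta Q) (φ : G k T N →ₗ[RingelDual T] G k T Q) :
    ∃ f : N →ₗ[S] Q, G.map k T f = φ := by
  obtain ⟨X, Q', i, p, hs, hX, -, hQ'⟩ := D.exists_hull_of_isFullTilting hD hU hT hQ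
  obtain ⟨X', Q'', j, q, hq, hX', -, -⟩ := D.exists_hull_of_isFullTilting hD hU hT hQ'
  exact G.exists_map_eq (D.finite_of_filtered_Delta hN) (D.finite_of_filtered_Delta hT.1.1)
    hs hX hq.inj hX' (fun f ↦ hs.extend (D.extZero_of_filtered hD hQ' hT.1.2 0) f) φ

/-- `G` preserves and reflects the vanishing of Ext groups between `Δ`-filtered modules. -/
lemma extZero_G_iff (n : ℕ) {N Q : ModuleCat.{u} S} (hN : Filtered D.Delta N)
    (hQ : Filtered D.Delta Q) :
    ExtZero (n + 1) (G k T N) (G k T Q) ↔ ExtZero (n + 1) N Q := by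
  induction n generalizing Q with
  | zero =>
    obtain ⟨X, Q', i, p, hs, hX, hXt, hQ'⟩ := D.exists_hull_of_isFullTilting hD hU hT hQ
    have hGs := hs.map_G (k := k) (D.extZero_of_filtered hD hQ' hT.1.2 0)
    constructor
    · intro h
      refine hs.extZero_one_of_lift (D.extZero_of_filtered hD hN hXt.2 0) fun f ↦ ?_
      obtain ⟨g, hg⟩ := hGs.lift h (G.map k T f)
      obtain ⟨g, rfl⟩ := D.exists_G_map_eq hD hU hT hN hXt.1 g
      exact ⟨g, D.G_map_injective hD hU hT (k := k) hQ' hg⟩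
    · intro h
      refine hGs.extZero_one_of_lift (extZero_of_injective hX.injective_G 0 _) fun f ↦ ?_
      obtain ⟨f, rfl⟩ := D.exists_G_map_eq hD hU hT hN hQ' f
      obtain ⟨g, rfl⟩ := hs.lift h f
      exact ⟨G.map k T g, rfl⟩
  | succ n ih =>
    obtain ⟨X, Q', i, p, hs, hX, hXt, hQ'⟩ := D.exists_hull_of_isFullTilting hD hU hT hQ
    have hGs := hs.map_G (k := k) (D.extZero_of_filtered hD hQ' hT.1.2 0)
    have h1 := fun n ↦ D.extZero_of_filtered hD hN hXt.2 n
    have h2 := fun n ↦ extZero_of_injective (hX.injective_G (k := k)) n (G k T N)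
    constructor
    · intro h
      exact hs.extZero_sub ((ih hQ').1 (hGs.extZero_coker (h2 _) h)) (h1 _)
    · intro h
      exact hGs.extZero_sub ((ih hQ').2 (hs.extZero_coker (h1 _) h)) (h2 _)

end Labelling

/-! ### The costandard modules of the Ringel dual -/

section Pairing

variable {k : Type u} [Field k] {S : Type u} [Ring S] [Algebra k S] {T M N : ModuleCat.{u} S}

/-- The map `Hom(T, M) → D Hom(N, T)` induced by a functional `l` on `Hom(N, M)`. -/
def pairing (l : (N →ₗ[S] M) →ₗ[k] k) : F T M →ₗ[RingelDual T] G k T N where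
  toFun h := (l ∘ₗ postcomp k N (show T →ₗ[S] M from h) : (N →ₗ[S] T) →ₗ[k] k)
  map_add' h h' := LinearMap.ext fun f ↦
    (congrArg l (LinearMap.add_comp f (show T →ₗ[S] M from h') (show T →ₗ[S] M from h))).trans
      (map_add l _ _)
  map_smul' _ _ := rfl

end Pairing

namespace Labelling

/-- `∇(a)` is injective among the modules whose composition factors are `≤ a`. -/
lemma extZero_one_Nabla {S : Type u} [Ring S] [IsArtinianRing S] [EnoughFiniteInjectives S]
    {Λ : Type w} [PartialOrder Λ] {D : Labelling S Λ} (h : D.IsFull) {a : Λ} {X : ModuleCat.{u} S}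
    (hX : D.FactorsLE a X) : ExtZero 1 X (D.Nabla a) :=
  (IsSES.of_range (D.ofNabla a) (D.ofNabla_injective a)).extZero_one_of_lift
    (extZero_of_injective (I_injective a) 0 X) fun f ↦
    ⟨0, by rw [LinearMap.comp_zero, D.hom_quotient_Nabla_eq_zero h hX f]⟩

/-- A section `∇(b)` of `M` gives a nonzero map `Δ(b) → M`. -/
lemma exists_ne_zero_of_mem_Nabla {S : Type u} [Ring S] [IsArtinianRing S]
    [EnoughFiniteInjectives S] {Λ : Type w} [PartialOrder Λ] {D : Labelling S Λ}
    (hD : D.IsQuasiHereditary) {l : List Λ} {M : ModuleCat.{u} S}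
    (h : HasFiltration D.Nabla l M) {b : Λ} (hb : b ∈ l) :
    ∃ f : D.Delta b →ₗ[S] M, f ≠ 0 := by
  induction h with
  | nil M h => simp at hb
  | cons c l N M i p hi hip hp h ih =>
    by_cases hbl : b ∈ l
    · obtain ⟨f, hf⟩ := ih hbl
      exact ⟨i ∘ₗ f, comp_ne_zero_of_injective hf hi⟩
    · obtain rfl : b = c := (List.mem_cons.1 hb).resolve_right hbl
      have := (D.isSimple b).nontrivial
      have hne : D.nablaSocle hD.full b ∘ₗ D.deltaTop hD.full b ≠ 0 :=
        comp_ne_zero_of_injective (ne_zero_of_surjective this (D.deltaTop_surjective hD.full b))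
          (D.nablaSocle_injective hD.full b)
      obtain ⟨f, hf⟩ := (IsSES.mk hi hip hp).lift
        (D.extZero_of_filtered hD (D.filtered_Delta_self b) ⟨l, h⟩ 0)
        (D.nablaSocle hD.full b ∘ₗ D.deltaTop hD.full b)
      refine ⟨f, ?_⟩
      rintro rfl
      exact hne (by rw [← hf, LinearMap.comp_zero])

/-- An endomorphism `e` of `Δ(a)` with `e² = e` is `0` or `1`. -/
lemma eq_zero_or_eq_id_of_idempotent {S : Type u} [Ring S] [IsArtinianRing S]
    {Λ : Type w} [PartialOrder Λ] {D : Labelling S Λ} (h : D.IsFull) {a : Λ}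
    {e : D.Delta a →ₗ[S] D.Delta a} (he : e ∘ₗ e = e) : e = 0 ∨ e = LinearMap.id := by
  by_cases h0 : D.deltaTop h a ∘ₗ e = 0
  · left
    have hs := D.surjective_of_deltaTop_comp h (LinearMap.id - e) (by
      rw [LinearMap.comp_sub, h0, sub_zero, LinearMap.comp_id]
      exact ne_zero_of_surjective (D.isSimple a).nontrivial (D.deltaTop_surjective h a))
    refine (LinearMap.cancel_right hs).1 ?_
    rw [LinearMap.comp_sub, he, LinearMap.comp_id, sub_self, LinearMap.zero_comp]
  · right
    refine (LinearMap.cancel_right (D.surjective_of_deltaTop_comp h e h0)).1 ?_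
    rw [he, LinearMap.id_comp]

variable {k : Type u} [Field k] {S : Type u} [Ring S] [Algebra k S]
  [IsArtinianRing S] [EnoughFiniteInjectives S]
  {Λ : Type w} [PartialOrder Λ] {D : Labelling S Λ} (hD : D.IsQuasiHereditary)
  {U : Λ → ModuleCat.{u} S} (hU : ∀ a, D.IsIndecomposableTilting a (U a))
  {T : ModuleCat.{u} S} (hT : D.IsFullTilting U T)

include hD hU hT

/-- Every map `Hom(T, M) → D Hom(N, T)`, with `M` filtered by costandard and `N` by standard
modules, comes from a functional on `Hom(N, M)`. -/
lemma exists_pairing_eq {M N : ModuleCat.{u} S} (hM : Filtered D.Nabla M)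
    (hN : Filtered D.Delta N) (φ : F T M →ₗ[RingelDual T] G k T N) :
    ∃ l : (N →ₗ[S] M) →ₗ[k] k, pairing l = φ := by
  obtain ⟨K, X, i, p, hs, hX, -, hK⟩ := D.exists_cover_of_isFullTilting hD hU hT hM
  obtain ⟨K', Y, j, q, hq, hY, -, hK'⟩ := D.exists_cover_of_isFullTilting hD hU hT hK
  obtain ⟨ι, hι, -, s, r, hsr⟩ : ∃ (ι : Type) (_ : Fintype ι) (_ : ι → Λ) (s : ι → (T →ₗ[S] X))
    (r : ι → (X →ₗ[S] T)), ∀ x, ∑ i, s i (r i x) = x := hX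
  obtain ⟨κ, hκ, -, s', r', hsr'⟩ : ∃ (ι : Type) (_ : Fintype ι) (_ : ι → Λ)
    (s : ι → (T →ₗ[S] Y)) (r : ι → (Y →ₗ[S] T)), ∀ x, ∑ i, s i (r i x) = x := hY
  let φ' : (T →ₗ[S] M) → G k T N := fun h ↦ φ h
  have hφ_comp : ∀ (h : T →ₗ[S] M) (e : T →ₗ[S] T) (f : N →ₗ[S] T),
      G.eval (φ' (h ∘ₗ e)) f = G.eval (φ' h) (e ∘ₗ f) := fun h e f ↦
    congrArg (fun l ↦ G.eval l f) (φ.map_smul (MulOpposite.op e) h)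
  have hφ_sum : ∀ (h : ι → (T →ₗ[S] M)) (f : N →ₗ[S] T),
      G.eval (φ' (∑ j, h j)) f = ∑ j, G.eval (φ' (h j)) f := fun h f ↦
    (congrArg (fun l ↦ G.eval l f) (map_sum φ (fun j ↦ (h j : T →ₗ[S] M)) Finset.univ)).trans
      (LinearMap.sum_apply _ (fun j ↦ G.eval (φ' (h j))) f)
  -- the functional on `Hom(N, X)`; it vanishes on the maps with image in `K`
  let l₀ : (N →ₗ[S] X) →ₗ[k] k := ∑ j, G.eval (φ' (p ∘ₗ s j)) ∘ₗ postcomp k N (r j)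
  have hl₀ : ∀ u, l₀ u = ∑ j, G.eval (φ' (p ∘ₗ s j)) (r j ∘ₗ u) := fun u ↦
    LinearMap.sum_apply _ _ _
  have hl₀_comp : ∀ (h : T →ₗ[S] X) (f : N →ₗ[S] T),
      l₀ (h ∘ₗ f) = G.eval (φ' (p ∘ₗ h)) f := by
    intro h f
    have h1 : p ∘ₗ h = ∑ j, (p ∘ₗ s j) ∘ₗ (r j ∘ₗ h) := by
      ext x
      rw [LinearMap.sum_apply, LinearMap.comp_apply, ← hsr (h x), map_sum]
      simp
    rw [hl₀, h1, hφ_sum]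
    exact Finset.sum_congr rfl fun j _ ↦ by rw [hφ_comp, LinearMap.comp_assoc]
  obtain ⟨l, hl⟩ := exists_factor (postcomp k N p)
    (fun f ↦ hs.lift (D.extZero_of_filtered hD hN hK 0) f) l₀ (fun u hu ↦ by
      obtain ⟨v, rfl⟩ := hs.lift_of_comp_eq_zero u hu
      obtain ⟨w, rfl⟩ := hq.lift (D.extZero_of_filtered hD hN hK' 0) v
      have h1 : i ∘ₗ q ∘ₗ w = ∑ j, (i ∘ₗ q ∘ₗ s' j) ∘ₗ (r' j ∘ₗ w) := by
        ext x
        rw [LinearMap.sum_apply, LinearMap.comp_apply, LinearMap.comp_apply, ← hsr' (w x),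
          map_sum, map_sum]
        simp
      rw [h1, map_sum]
      refine Finset.sum_eq_zero fun j _ ↦ ?_
      rw [hl₀_comp, ← LinearMap.comp_assoc, hs.comp_eq_zero, LinearMap.zero_comp]
      exact congrArg (fun l ↦ G.eval l (r' j ∘ₗ w)) (map_zero φ))
  refine ⟨l, LinearMap.ext fun h ↦ G.ext fun f ↦ ?_⟩
  obtain ⟨h', hh'⟩ := hs.lift (D.extZero_of_filtered hD hT.1.1 hK 0) h
  subst hh'
  have h2 := hl (h' ∘ₗ f)
  rw [hl₀_comp] at h2
  exact h2

/-- `Ext¹(Hom(T, M), D Hom(N, T)) = 0` for `M` filtered by costandard and `N` by standard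
modules. -/
lemma extZero_F_G {M N : ModuleCat.{u} S} (hM : Filtered D.Nabla M) (hN : Filtered D.Delta N) :
    ExtZero 1 (F T M) (G k T N) := by
  obtain ⟨K, X, i, p, hs, hX, -, hK⟩ := D.exists_cover_of_isFullTilting hD hU hT hM
  refine (hs.map_F (D.extZero_of_filtered hD hT.1.1 hK 0)).extZero_one_of_extend
    (extZero_of_projective hX.projective_F 0 _) fun φ ↦ ?_
  obtain ⟨l, rfl⟩ := D.exists_pairing_eq hD hU hT hK hN φ
  obtain ⟨m, hm⟩ := exists_extend (postcomp k N i)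
    (fun f g hfg ↦ (LinearMap.cancel_left hs.inj).1 hfg) l
  exact ⟨pairing m, LinearMap.ext fun h ↦ G.ext fun f ↦ hm ((show T →ₗ[S] K from h) ∘ₗ f)⟩

variable [Module.Finite k S] [IsArtinianRing (RingelDual T)]
  [EnoughFiniteInjectives (RingelDual T)] {E : Labelling (RingelDual T) Λᵒᵈ}
  (hE : ∀ a : Λ, ∃ f : F T (U a) →ₗ[RingelDual T] E.L (OrderDual.toDual a), Function.Surjective f)
include hE

variable (k) in
/-- `D Hom(Δ(a), T)` is the costandard module `∇'(a)`. -/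
lemma nonempty_Nabla_equiv_G (a : Λ) :
    Nonempty (E.Nabla (OrderDual.toDual a) ≃ₗ[RingelDual T] G k T (D.Delta a)) := by
  have hD' := D.isQuasiHereditary_ringelDual hD hU hT hE
  have hΔ := D.filtered_Delta_self a
  have hTf := D.finite_of_filtered_Delta hT.1.1
  have hzero : ∀ b : Λ, b ≠ a →
      ∀ f : E.Delta (OrderDual.toDual b) →ₗ[RingelDual T] G k T (D.Delta a), f = 0 := by
    intro b hba f
    obtain ⟨e⟩ := D.nonempty_Delta_equiv_F hD hU hT hE b
    obtain ⟨l, hl⟩ := D.exists_pairing_eq hD hU hT (D.filtered_Nabla_self b) hΔ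
      (f ∘ₗ e.symm.toLinearMap)
    refine LinearMap.ext fun x ↦ ?_
    have h1 := LinearMap.congr_fun hl (e x)
    rw [LinearMap.comp_apply, LinearEquiv.coe_coe, e.symm_apply_apply] at h1
    rw [← h1]
    refine G.ext fun g ↦ (congrArg l ?_).trans (map_zero l)
    exact D.hom_Delta_Nabla_eq_zero hD hba.symm _
  have hne : Nontrivial (G k T (D.Delta a)) := by
    rw [← not_subsingleton_iff_nontrivial]
    intro hsub
    have h0 : (LinearMap.id : D.Delta a →ₗ[S] D.Delta a) = 0 :=
      D.G_map_injective hD hU hT hΔ (k := k) (LinearMap.ext fun l ↦ hsub.elim _ _)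
    have := (D.occurs_Delta hD.full a).nontrivial
    obtain ⟨y, hy⟩ := exists_ne (0 : D.Delta a)
    exact hy (LinearMap.congr_fun h0 y)
  obtain ⟨l, hl⟩ := E.filtered_Nabla_of_extZero hD'
    (finite_G (k := k) (D.finite_of_filtered_Delta hΔ) hTf) fun b ↦ by
      obtain ⟨e⟩ := D.nonempty_Delta_equiv_F hD hU hT hE (OrderDual.ofDual b)
      exact (extZero_equiv_left e).2 (D.extZero_F_G hD hU hT (D.filtered_Nabla_self _) hΔ)
  have hla : ∀ b ∈ l, b = OrderDual.toDual a := by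
    intro b hb
    by_contra hba
    obtain ⟨f, hf⟩ := E.exists_ne_zero_of_mem_Nabla hD' hl hb
    exact hf (hzero (OrderDual.ofDual b) (fun h ↦ hba (congrArg OrderDual.toDual h)) f)
  -- the filtration has a section `∇'(a)` at the top, which splits off
  cases hl with
  | nil M h => exact absurd h (not_subsingleton_iff_nontrivial.2 hne)
  | cons c l N M i p hi hip hp h =>
    obtain rfl := (hla c List.mem_cons_self).symm
    obtain ⟨s, hs⟩ := (IsSES.mk hi hip hp).exists_section (h.extZero_right fun b hb ↦ by
      rw [hla b (List.mem_cons_of_mem _ hb)]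
      exact E.extZero_one_Nabla hD'.full (E.factorsLE_Nabla hD'.full _))
    obtain ⟨e, he⟩ := D.exists_G_map_eq hD hU hT hΔ hΔ (s ∘ₗ p)
    have hee : e ∘ₗ e = e := D.G_map_injective hD hU hT hΔ (k := k) (by
      rw [G.map_comp, he, LinearMap.comp_assoc, ← LinearMap.comp_assoc p s p, hs,
        LinearMap.id_comp])
    rcases D.eq_zero_or_eq_id_of_idempotent hD.full hee with rfl | rfl
    · exfalso
      have := (E.occurs_Nabla hD'.full (OrderDual.toDual a)).nontrivial
      obtain ⟨y, hy⟩ := exists_ne (0 : E.Nabla (OrderDual.toDual a))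
      obtain ⟨x, rfl⟩ := hp y
      refine hy ?_
      have h1 : s (p x) = 0 := by
        rw [← LinearMap.comp_apply, ← he]
        refine G.ext fun g ↦ ?_
        rw [G.eval_map, LinearMap.comp_zero, map_zero]
        rfl
      rw [← LinearMap.id_apply (R := RingelDual T) (p x), ← hs, LinearMap.comp_apply, h1,
        map_zero]
    · rw [G.map_id] at he
      exact ⟨(LinearEquiv.ofBijective p
        ⟨Function.LeftInverse.injective (LinearMap.congr_fun he.symm), hp⟩).symm⟩

end Labelling

/-! ### Comparison of the dimensions -/

section Dimension

lemma HasResolution.succ_of_self {S : Type u} [Ring S] {C : ModuleCat.{u} S → Prop}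
    (hC : ∀ M : ModuleCat.{u} S, Subsingleton M → C M) {d : ℕ} {X : ModuleCat.{u} S}
    (h : HasResolution C d X) : HasResolution C (d + 1) X := by
  induction h with
  | zero X h =>
    exact .succ 0 (ModuleCat.of S PUnit) X X 0 LinearMap.id (Function.injective_of_subsingleton _)
      (fun x ↦ ⟨fun hx ↦ ⟨0, hx.symm⟩, fun ⟨_, hy⟩ ↦ hy.symm⟩) Function.surjective_id h
      (.zero _ (hC _ (inferInstanceAs (Subsingleton PUnit))))
  | succ d K M X i p hi hip hp hM h ih => exact .succ _ K M X i p hi hip hp hM ih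

lemma HasCoresolution.succ_of_self {S : Type u} [Ring S] {C : ModuleCat.{u} S → Prop}
    (hC : ∀ M : ModuleCat.{u} S, Subsingleton M → C M) {d : ℕ} {X : ModuleCat.{u} S}
    (h : HasCoresolution C d X) : HasCoresolution C (d + 1) X := by
  induction h with
  | zero X h =>
    have hP : Subsingleton (ModuleCat.of S PUnit.{u + 1}) := inferInstanceAs (Subsingleton PUnit)
    exact .succ 0 X X (ModuleCat.of S PUnit) LinearMap.id 0 Function.injective_id
      (fun x ↦ ⟨fun _ ↦ ⟨x, rfl⟩, fun _ ↦ rfl⟩) (fun y ↦ ⟨0, hP.elim _ _⟩) h (.zero _ (hC _ hP))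
  | succ d X M Q i p hi hip hp hM h ih => exact .succ _ X M Q i p hi hip hp hM ih

lemma iInf_natCast_le_iff {p : ℕ → Prop} (hp : ∀ d, p d → p (d + 1)) (n : ℕ) :
    (⨅ (d : ℕ) (_ : p d), (d : ℕ∞)) ≤ n ↔ p n := by
  refine ⟨fun h ↦ ?_, fun h ↦ iInf₂_le n h⟩
  by_contra hn
  have h1 : ((n + 1 : ℕ) : ℕ∞) ≤ ⨅ (d : ℕ) (_ : p d), (d : ℕ∞) := le_iInf₂ fun d hd ↦ by
    refine Nat.cast_le.2 (Nat.succ_le_of_lt (not_le.1 fun hdn ↦ hn ?_))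
    exact Nat.le_induction hd (fun m _ hm ↦ hp m hm) n hdn
  have h2 : n + 1 ≤ n := by exact_mod_cast h1.trans h
  omega

lemma natCast_eq_of_forall_le_iff {x : ℕ∞} {y : WithBot ℕ∞} (hy : y ≠ ⊥)
    (h : ∀ d : ℕ, x ≤ d ↔ y ≤ d) : (x : WithBot ℕ∞) = y := by
  obtain ⟨y, rfl⟩ := WithBot.ne_bot_iff_exists.1 hy
  have h' : ∀ d : ℕ, x ≤ d ↔ y ≤ d := fun d ↦ (h d).trans WithBot.coe_le_coe
  congr 1
  refine le_antisymm ?_ ?_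
  · induction y with
    | top => exact le_top
    | coe n => exact (h' n).2 le_rfl
  · induction x with
    | top => exact le_top
    | coe n => exact (h' n).1 le_rfl

namespace Labelling

variable {S : Type u} [Ring S] {Λ : Type w} [PartialOrder Λ] (D : Labelling S Λ)
  (X : ModuleCat.{u} S) (d : ℕ)

lemma wfd_le_iff : D.wfd X ≤ d ↔ HasResolution (Filtered D.Delta) d X :=
  iInf_natCast_le_iff (fun _ h ↦ h.succ_of_self fun M hM ↦ ⟨[], .nil M hM⟩) d

lemma gfd_le_iff : D.gfd X ≤ d ↔ HasCoresolution (Filtered D.Nabla) d X :=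
  iInf_natCast_le_iff (fun _ h ↦ h.succ_of_self fun M hM ↦ ⟨[], .nil M hM⟩) d

end Labelling

end Dimension

/-! ### The four equalities -/

lemma projectiveDimension_ne_bot {S : Type u} [Ring S] {X : ModuleCat.{u} S} (h : Nontrivial X) :
    projectiveDimension X ≠ ⊥ := by
  rw [Ne, projectiveDimension_eq_bot_iff]
  exact fun h0 ↦ not_subsingleton_iff_nontrivial.2 h (ModuleCat.subsingleton_of_isZero h0)

lemma injectiveDimension_ne_bot {S : Type u} [Ring S] {X : ModuleCat.{u} S} (h : Nontrivial X) :
    injectiveDimension X ≠ ⊥ := by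
  rw [Ne, injectiveDimension_eq_bot_iff]
  exact fun h0 ↦ not_subsingleton_iff_nontrivial.2 h (ModuleCat.subsingleton_of_isZero h0)

/-- The four equalities, for a ground field in the same universe as the algebra. -/
theorem dimensions_ringelDual (k : Type u) [Field k] {S : Type u} [Ring S] [Algebra k S]
    [Module.Finite k S] {Λ : Type w} [PartialOrder Λ] {D : Labelling S Λ}
    (hD : D.IsQuasiHereditary) {U : Λ → ModuleCat.{u} S}
    (hU : ∀ a : Λ, D.IsIndecomposableTilting a (U a)) {T : ModuleCat.{u} S}
    (hT : D.IsFullTilting U T) {E : Labelling (RingelDual T) Λᵒᵈ}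
    (hE : ∀ a : Λ, ∃ f : F T (U a) →ₗ[RingelDual T] E.L (OrderDual.toDual a),
      Function.Surjective f) (a : Λ) :
    (D.wfd (D.Nabla a) : WithBot ℕ∞) = projectiveDimension (E.Delta (OrderDual.toDual a)) ∧
      injectiveDimension (D.Nabla a) = (E.gfd (E.Delta (OrderDual.toDual a)) : WithBot ℕ∞) ∧
      projectiveDimension (D.Delta a) = (E.wfd (E.Nabla (OrderDual.toDual a)) : WithBot ℕ∞) ∧
      (D.gfd (D.Delta a) : WithBot ℕ∞) =
        injectiveDimension (E.Nabla (OrderDual.toDual a)) := by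
  have := isArtinianRing_of_finiteDimensional k S
  have := enoughFiniteInjectives_of_finiteDimensional k S
  have : Module.Finite k (RingelDual T) := finite_ringelDual (D.finite_of_filtered_Delta hT.1.1)
  have := isArtinianRing_of_finiteDimensional k (RingelDual T)
  have := enoughFiniteInjectives_of_finiteDimensional k (RingelDual T)
  have hD' := D.isQuasiHereditary_ringelDual hD hU hT hE
  have hext_F (n : ℕ) (b c : Λ) : ExtZero (n + 1) (E.Delta (OrderDual.toDual b))
      (E.Delta (OrderDual.toDual c)) ↔ ExtZero (n + 1) (D.Nabla b) (D.Nabla c) := by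
    obtain ⟨e⟩ := D.nonempty_Delta_equiv_F hD hU hT hE b
    obtain ⟨e'⟩ := D.nonempty_Delta_equiv_F hD hU hT hE c
    rw [extZero_equiv_left e, extZero_equiv_right e']
    exact D.extZero_F_iff hD hU hT n (D.filtered_Nabla_self b) (D.filtered_Nabla_self c)
  have hext_G (n : ℕ) (b c : Λ) : ExtZero (n + 1) (E.Nabla (OrderDual.toDual b))
      (E.Nabla (OrderDual.toDual c)) ↔ ExtZero (n + 1) (D.Delta b) (D.Delta c) := by
    obtain ⟨e⟩ := D.nonempty_Nabla_equiv_G k hD hU hT hE b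
    obtain ⟨e'⟩ := D.nonempty_Nabla_equiv_G k hD hU hT hE c
    rw [extZero_equiv_left e, extZero_equiv_right e']
    exact D.extZero_G_iff hD hU hT n (D.filtered_Delta_self b) (D.filtered_Delta_self c)
  refine ⟨natCast_eq_of_forall_le_iff
      (projectiveDimension_ne_bot (E.occurs_Delta hD'.full _).nontrivial) fun d ↦ ?_,
    (natCast_eq_of_forall_le_iff
      (injectiveDimension_ne_bot (D.occurs_Nabla hD.full _).nontrivial) fun d ↦ ?_).symm,
    (natCast_eq_of_forall_le_iff
      (projectiveDimension_ne_bot (D.occurs_Delta hD.full _).nontrivial) fun d ↦ ?_).symm,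
    natCast_eq_of_forall_le_iff
      (injectiveDimension_ne_bot (E.occurs_Nabla hD'.full _).nontrivial) fun d ↦ ?_⟩
  · rw [D.wfd_le_iff, D.hasResolution_iff hD (D.Nabla_finite hD.full a),
      projectiveDimension_le_iff, E.hasProjectiveDimensionLE_iff hD' (E.filtered_Delta_self _)]
    exact forall_congr' fun b ↦ (hext_F d a b).symm
  · rw [E.gfd_le_iff, E.hasCoresolution_iff hD' (E.Delta_finite _),
      injectiveDimension_le_iff, D.hasInjectiveDimensionLE_iff hD (D.filtered_Nabla_self _)]
    exact forall_congr' fun b ↦ hext_F d b a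
  · rw [E.wfd_le_iff, E.hasResolution_iff hD' (E.Nabla_finite hD'.full _),
      projectiveDimension_le_iff, D.hasProjectiveDimensionLE_iff hD (D.filtered_Delta_self _)]
    exact forall_congr' fun b ↦ hext_G d a b
  · rw [D.gfd_le_iff, D.hasCoresolution_iff hD (D.Delta_finite a),
      injectiveDimension_le_iff, E.hasInjectiveDimensionLE_iff hD' (E.filtered_Nabla_self _)]
    exact forall_congr' fun b ↦ (hext_G d b a).symm

end

end QuasiHereditary

theorem proposition3p1p1
    {k : Type v} [Field k] {S : Type u} [Ring S] [Algebra k S] [Module.Finite k S]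
    {Λ : Type w} [PartialOrder Λ]
    -- a quasi-hereditary algebra `S`
    (D : QuasiHereditary.Labelling S Λ) (hD : D.IsQuasiHereditary)
    -- its indecomposable tilting modules `U a = T(a)` and a full tilting module `T`
    (U : Λ → ModuleCat.{u} S) (hU : ∀ a : Λ, D.IsIndecomposableTilting a (U a))
    (T : ModuleCat.{u} S) (hT : D.IsFullTilting U T)
    -- the simple modules of the Ringel dual, with the opposite order on the labels:
    -- the simple module labelled by `a` is the head of `Hom_S(T, T(a))`
    (E : QuasiHereditary.Labelling (QuasiHereditary.RingelDual T) Λᵒᵈ)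
    (hE : ∀ a : Λ, ∃ f : QuasiHereditary.F T (U a) →ₗ[QuasiHereditary.RingelDual T]
      E.L (OrderDual.toDual a), Function.Surjective f)
    (a : Λ) :
    (D.wfd (D.Nabla a) : WithBot ℕ∞) =
        CategoryTheory.projectiveDimension (E.Delta (OrderDual.toDual a)) ∧
      CategoryTheory.injectiveDimension (D.Nabla a) =
        (E.gfd (E.Delta (OrderDual.toDual a)) : WithBot ℕ∞) ∧
      CategoryTheory.projectiveDimension (D.Delta a) =
        (E.wfd (E.Nabla (OrderDual.toDual a)) : WithBot ℕ∞) ∧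
      (D.gfd (D.Delta a) : WithBot ℕ∞) =
        CategoryTheory.injectiveDimension (E.Nabla (OrderDual.toDual a)) := by
  -- `k` embeds into `S ≠ 0`, so it can be replaced by a field in the universe of `S`
  have hL := (D.isSimple a).nontrivial
  have hS : Nontrivial S := Module.nontrivial S (D.L a)
  have : Small.{u} k := small_of_injective (algebraMap k S).injective
  let e : Shrink.{u} k ≃+* k := Shrink.ringEquiv k
  let _ : Algebra (Shrink.{u} k) S := Algebra.compHom S e.toRingHom
  have : Module.Finite (Shrink.{u} k) S :=
    Module.Finite.of_surjective (σ := (e.symm : k →+* Shrink.{u} k))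
      { toFun := fun x : S ↦ x
        map_add' := fun _ _ ↦ rfl
        map_smul' := fun c x ↦ by
          change c • x = e (e.symm c) • x
          rw [e.apply_symm_apply] } Function.surjective_id
  exact QuasiHereditary.dimensions_ringelDual (Shrink.{u} k) hD hU hT hE a
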